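/- Let $n_1,n_2\ge 1$ be coprime integers, let $\omega_1,\omega_2,\omega_3$ be nonzero real numbers with $n_1\omega_2=n_2\omega_1$ and with $\omega_3$ rationally independent of $\omega_1,\omega_2$ (that is, $\omega_3\notin\mathbb{Q}\omega_1+\mathbb{Q}\omega_2$), and let $a_0,a_1,a_2,a_3\in\{1,-1\}$. On $\mathbb{R}^2\times\mathbb{C}^3$, with points $(x_1,x_2,z_1,z_2,z_3)$, consider the linear involutions $$\phi(x_1,x_2,z_1,z_2,z_3)=(x_1,-x_2,\bar z_1,\bar z_2,\bar z_3),\qquad \psi(x_1,x_2,z_1,z_2,z_3)=(a_0x_1,-a_0x_2,a_1\bar z_1,a_2\bar z_2,a_3\bar z_3)$$ and the linear map $$L(x_1,x_2,z_1,z_2,z_3)=(x_2,\,0,\,-i\omega_1z_1,\,-i\omega_2z_2,\,-i\omega_3z_3).$$ Let $X$ be a $C^\infty$ vector field on $\mathbb{R}^2\times\mathbb{C}^3$ with $X(0)=0$, $(dX)_0=L$, $X\circ\phi=-\phi\circ X$ and $X\circ\psi=-\psi\circ X$. Two smooth vector fields $X,Y$ are called formally conjugate (at $0$) if there is a formal power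 series map $H=\mathrm{id}+H_2+H_3+\cdots$, with $H_k$ a homogeneous polynomial map of degree $k$, such that $DH\cdot \hat X=\hat Y\circ H$ as formal power series, where $\hat X,\hat Y$ are the Taylor series of $X,Y$ at $0$. Write $w=z_1^{n_2}\bar z_2^{n_1}$, $R=\operatorname{Re}w$, $I=\operatorname{Im}w$, $q_1=\bar z_1^{\,n_2-1}z_2^{n_1}$ and $q_2=z_1^{n_2}\bar z_2^{\,n_1-1}$. Then the system $\dot x=X(x)$ is formally conjugate to a system of the following form, for some $C^\infty$ real-valued functions $f_i$, all evaluated at the indicated tuple $U$. **Type A** (if $a_0=1$ and $a_1^{n_2}a_2^{n_1}=1$): $U=(x_1,|z_1|^2,|z_2|^2,R,|z_3|^2)$, $f_0,\dots,f_{11}:\mathbb{R}^5\to\mathbb{R}$, $$\begin{aligned} \dot x_1&=x_2+x_1I f_0,\\ \dot x_2&=f_1+x_2I f_0,\\ \dot z_1&=-i\omega_1z_1+iz_1f_2+iq_1f_3+z_1If_4+q_1If_5,\\ \dot z_2&=-i\omega_2z_2+iz_2f_6+iq_2f_7+z_2If_8+q_2If_9,\\ \dot z_3&=-i\omega_3z_3+iz_3f_{10}+z_3If_{11}.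 \end{aligned}$$ **Type B** (if $a_0=1$ and $a_1^{n_2}a_2^{n_1}=-1$): $U=(x_1,|z_1|^2,|z_2|^2,R^2,|z_3|^2)$, $f_0,\dots,f_{11}:\mathbb{R}^5\to\mathbb{R}$, $$\begin{aligned} \dot x_1&=x_2+x_1RI f_0,\\ \dot x_2&=f_1+x_2RI f_0,\\ \dot z_1&=-i\omega_1z_1+iz_1f_2+q_1If_3+iq_1Rf_4+z_1RIf_5,\\ \dot z_2&=-i\omega_2z_2+iz_2f_6+q_2If_7+iq_2Rf_8+z_2RIf_9,\\ \dot z_3&=-i\omega_3z_3+iz_3f_{10}+z_3RIf_{11}. \end{aligned}$$ **Type C** (if $a_0=-1$ and $a_1^{n_2}a_2^{n_1}=1$): $U=(x_1^2,|z_1|^2,|z_2|^2,R,|z_3|^2)$, $f_0,\dots,f_{11}:\mathbb{R}^5\to\mathbb{R}$, $$\begin{aligned} \dot x_1&=x_2+x_1I f_0,\\ \dot x_2&=x_1f_1+x_2I f_0,\\ \dot z_1&=-i\omega_1z_1+iz_1f_2+iq_1f_3+z_1If_4+q_1If_5,\\ \dot z_2&=-i\omega_2z_2+iz_2f_6+iq_2f_7+z_2If_8+q_2If_9,\\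 \dot z_3&=-i\omega_3z_3+iz_3f_{10}+z_3If_{11}. \end{aligned}$$ **Type D** (if $a_0=-1$ and $a_1^{n_2}a_2^{n_1}=-1$): $U=(x_1^2,|z_1|^2,|z_2|^2,R^2,x_1R,|z_3|^2)$, $f_0,\dots,f_{18}:\mathbb{R}^6\to\mathbb{R}$, $$\begin{aligned} \dot x_1&=x_2+x_1^2If_0+x_1RIf_1,\\ \dot x_2&=x_1f_2+x_1x_2If_0+Rf_3+x_2RIf_1,\\ \dot z_1&=-i\omega_1z_1+iz_1f_4+q_1If_5+ix_1q_1f_6+x_1z_1If_7+iq_1Rf_8+z_1RIf_9,\\ \dot z_2&=-i\omega_2z_2+iz_2f_{10}+q_2If_{11}+ix_1q_2f_{12}+x_1z_2If_{13}+iq_2Rf_{14}+z_2RIf_{15},\\ \dot z_3&=-i\omega_3z_3+iz_3f_{16}+x_1z_3If_{17}+z_3RIf_{18}. \end{aligned}$$ -/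

import Mathlib

open scoped ContDiff Nat

noncomputable section

namespace Bireversible

/-! ### Formal conjugacy of smooth vector fields -/

section Formal

variable {E : Type*} [NormedAddCommGroup E] [NormedSpace ℝ E]

/-- The Taylor series at the origin of a (smooth) map `X : E → E`: its term of degree `n`,
evaluated on the diagonal, is `v ↦ (1 / n!) D^n X(0)(v, …, v)`. -/
def taylorAtZero (X : E → E) : FormalMultilinearSeries ℝ E E :=
  fun n => ((n ! : ℝ)⁻¹) • iteratedFDeriv ℝ n X 0

/-- The term of degree `n` of a formal power series, as a homogeneous polynomial map. -/
def homTerm (P : FormalMultilinearSeries ℝ E E) (n : ℕ) (v : E) : E :=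
  P n (fun _ => v)

/-- The term of degree `k` of the formal map `v ↦ DH(v) · P(v)`. The terms of `DH` coming from the
degree `i` term of `H` have degree `i - 1`, hence the sum over `i + j = k + 1`. -/
def derivApplyTerm (H P : FormalMultilinearSeries ℝ E E) (k : ℕ) (v : E) : E :=
  ∑ ij ∈ Finset.HasAntidiagonal.antidiagonal (k + 1), fderiv ℝ (homTerm H ij.1) v (homTerm P ij.2 v)

/-- `X` and `Y` are formally conjugate at the origin: there is a formal change of coordinates
`H = id + H₂ + H₃ + ⋯` (with `H k` homogeneous polynomial of degree `k`) which conjugates the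
Taylor series of `X` to the Taylor series of `Y`, that is, `DH · X = Y ∘ H` as formal power
series (equality of homogeneous terms in every degree). -/
def FormallyConjugate (X Y : E → E) : Prop :=
  ∃ H : FormalMultilinearSeries ℝ E E,
    (∀ v, homTerm H 0 v = 0) ∧ (∀ v, homTerm H 1 v = v) ∧
      ∀ (k : ℕ) (v : E),
        derivApplyTerm H (taylorAtZero X) k v = homTerm ((taylorAtZero Y).comp H) k v

/-- `κ` is a reversing symmetry of the vector field `X`. -/
def IsReversingSymmetry (κ : E → E) (X : E → E) : Prop :=
  ∀ v, X (κ v) = -κ (X v)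

end Formal

/-! ### The setting on `ℝ² × ℂ³` -/

/-- The phase space `ℝ² × ℂ³`, with points `(x₁, x₂, z₁, z₂, z₃)`. -/
abbrev Phase : Type := ℝ × ℝ × ℂ × ℂ × ℂ

/-- The linear part, in complex coordinates: the nilpotent block `(x₁, x₂) ↦ (x₂, 0)`, and on each
`ℂ ≃ ℝ²` the block `(u, v) ↦ (ω v, -ω u)`, i.e. multiplication by `-iω`. -/
def linearPart (ω₁ ω₂ ω₃ : ℝ) : Phase → Phase
  | (_, x₂, z₁, z₂, z₃) =>
    (x₂, 0, -Complex.I * ω₁ * z₁, -Complex.I * ω₂ * z₂, -Complex.I * ω₃ * z₃)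

/-- The involution `φ`. -/
def phi : Phase → Phase
  | (x₁, x₂, z₁, z₂, z₃) => (x₁, -x₂, star z₁, star z₂, star z₃)

/-- The involution `ψ` with signs `a₀, a₁, a₂, a₃`. -/
def psi (a₀ a₁ a₂ a₃ : ℝ) : Phase → Phase
  | (x₁, x₂, z₁, z₂, z₃) => (a₀ * x₁, -(a₀ * x₂), a₁ * star z₁, a₂ * star z₂, a₃ * star z₃)

/-- `z₁ ^ n₂ * conj z₂ ^ n₁`. -/
def resMonomial (n₁ n₂ : ℕ) (z₁ z₂ : ℂ) : ℂ := z₁ ^ n₂ * star z₂ ^ n₁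

/-- `conj z₁ ^ (n₂ - 1) * z₂ ^ n₁`. -/
def resField₁ (n₁ n₂ : ℕ) (z₁ z₂ : ℂ) : ℂ := star z₁ ^ (n₂ - 1) * z₂ ^ n₁

/-- `z₁ ^ n₂ * conj z₂ ^ (n₁ - 1)`. -/
def resField₂ (n₁ n₂ : ℕ) (z₁ z₂ : ℂ) : ℂ := z₁ ^ n₂ * star z₂ ^ (n₁ - 1)

/-- Normal form of type A. -/
def typeA (n₁ n₂ : ℕ) (ω₁ ω₂ ω₃ : ℝ) (f : Fin 12 → (Fin 5 → ℝ) → ℝ) : Phase → Phase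
  | (x₁, x₂, z₁, z₂, z₃) =>
    let re : ℝ := (resMonomial n₁ n₂ z₁ z₂).re
    let im : ℝ := (resMonomial n₁ n₂ z₁ z₂).im
    let q₁ : ℂ := resField₁ n₁ n₂ z₁ z₂
    let q₂ : ℂ := resField₂ n₁ n₂ z₁ z₂
    let F : Fin 12 → ℝ := fun i => f i ![x₁, ‖z₁‖ ^ 2, ‖z₂‖ ^ 2, re, ‖z₃‖ ^ 2]
    ( x₂ + x₁ * im * F 0,
      F 1 + x₂ * im * F 0,
      -Complex.I * ω₁ * z₁ + Complex.I * z₁ * F 2 + Complex.I * q₁ * F 3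
        + z₁ * im * F 4 + q₁ * im * F 5,
      -Complex.I * ω₂ * z₂ + Complex.I * z₂ * F 6 + Complex.I * q₂ * F 7
        + z₂ * im * F 8 + q₂ * im * F 9,
      -Complex.I * ω₃ * z₃ + Complex.I * z₃ * F 10 + z₃ * im * F 11 )

/-- Normal form of type B. -/
def typeB (n₁ n₂ : ℕ) (ω₁ ω₂ ω₃ : ℝ) (f : Fin 12 → (Fin 5 → ℝ) → ℝ) : Phase → Phase
  | (x₁, x₂, z₁, z₂, z₃) =>
    let re : ℝ := (resMonomial n₁ n₂ z₁ z₂).re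
    let im : ℝ := (resMonomial n₁ n₂ z₁ z₂).im
    let q₁ : ℂ := resField₁ n₁ n₂ z₁ z₂
    let q₂ : ℂ := resField₂ n₁ n₂ z₁ z₂
    let F : Fin 12 → ℝ := fun i => f i ![x₁, ‖z₁‖ ^ 2, ‖z₂‖ ^ 2, re ^ 2, ‖z₃‖ ^ 2]
    ( x₂ + x₁ * re * im * F 0,
      F 1 + x₂ * re * im * F 0,
      -Complex.I * ω₁ * z₁ + Complex.I * z₁ * F 2 + q₁ * im * F 3
        + Complex.I * q₁ * re * F 4 + z₁ * re * im * F 5,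
      -Complex.I * ω₂ * z₂ + Complex.I * z₂ * F 6 + q₂ * im * F 7
        + Complex.I * q₂ * re * F 8 + z₂ * re * im * F 9,
      -Complex.I * ω₃ * z₃ + Complex.I * z₃ * F 10 + z₃ * re * im * F 11 )

/-- Normal form of type C. -/
def typeC (n₁ n₂ : ℕ) (ω₁ ω₂ ω₃ : ℝ) (f : Fin 12 → (Fin 5 → ℝ) → ℝ) : Phase → Phase
  | (x₁, x₂, z₁, z₂, z₃) =>
    let re : ℝ := (resMonomial n₁ n₂ z₁ z₂).re
    let im : ℝ := (resMonomial n₁ n₂ z₁ z₂).im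
    let q₁ : ℂ := resField₁ n₁ n₂ z₁ z₂
    let q₂ : ℂ := resField₂ n₁ n₂ z₁ z₂
    let F : Fin 12 → ℝ := fun i => f i ![x₁ ^ 2, ‖z₁‖ ^ 2, ‖z₂‖ ^ 2, re, ‖z₃‖ ^ 2]
    ( x₂ + x₁ * im * F 0,
      x₁ * F 1 + x₂ * im * F 0,
      -Complex.I * ω₁ * z₁ + Complex.I * z₁ * F 2 + Complex.I * q₁ * F 3
        + z₁ * im * F 4 + q₁ * im * F 5,
      -Complex.I * ω₂ * z₂ + Complex.I * z₂ * F 6 + Complex.I * q₂ * F 7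
        + z₂ * im * F 8 + q₂ * im * F 9,
      -Complex.I * ω₃ * z₃ + Complex.I * z₃ * F 10 + z₃ * im * F 11 )

/-- Normal form of type D. -/
def typeD (n₁ n₂ : ℕ) (ω₁ ω₂ ω₃ : ℝ) (f : Fin 19 → (Fin 6 → ℝ) → ℝ) : Phase → Phase
  | (x₁, x₂, z₁, z₂, z₃) =>
    let re : ℝ := (resMonomial n₁ n₂ z₁ z₂).re
    let im : ℝ := (resMonomial n₁ n₂ z₁ z₂).im
    let q₁ : ℂ := resField₁ n₁ n₂ z₁ z₂
    let q₂ : ℂ := resField₂ n₁ n₂ z₁ z₂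
    let F : Fin 19 → ℝ :=
      fun i => f i ![x₁ ^ 2, ‖z₁‖ ^ 2, ‖z₂‖ ^ 2, re ^ 2, x₁ * re, ‖z₃‖ ^ 2]
    ( x₂ + x₁ ^ 2 * im * F 0 + x₁ * re * im * F 1,
      x₁ * F 2 + x₁ * x₂ * im * F 0 + re * F 3 + x₂ * re * im * F 1,
      -Complex.I * ω₁ * z₁ + Complex.I * z₁ * F 4 + q₁ * im * F 5 + Complex.I * x₁ * q₁ * F 6
        + x₁ * z₁ * im * F 7 + Complex.I * q₁ * re * F 8 + z₁ * re * im * F 9,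
      -Complex.I * ω₂ * z₂ + Complex.I * z₂ * F 10 + q₂ * im * F 11 + Complex.I * x₁ * q₂ * F 12
        + x₁ * z₂ * im * F 13 + Complex.I * q₂ * re * F 14 + z₂ * re * im * F 15,
      -Complex.I * ω₃ * z₃ + Complex.I * z₃ * F 16 + x₁ * z₃ * im * F 17
        + z₃ * re * im * F 18 )

end Bireversible

end

/-! This is a normal form argument carried out degree by degree, with all formal identities replaced
by estimates `O(‖v‖ ^ n)`. A homogeneous map of degree `n` that is `O(‖v‖ ^ (n + 1))` vanishes
(`IsHom.eq_zero_of_vanishes`), so two formal series agree in degree `k` as soon as suitable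
polynomial truncations agree to order `k + 1` (`formal_eq_of_vanishes`).

If `H` conjugates `X` to `Y` up to order `k + 1`, the leading part `Z` of the defect is homogeneous
and reversible. Adding `h` to `H` changes it to `Z + Dh·L - L∘h`, and what remains is absorbed into
`Y` (`ConjUpTo.step`). Thus it suffices to solve this homological equation with a remainder of the
prescribed shape. The coefficients then arise as formal sums of quasi-homogeneous functions of the
invariants, and a weighted Borel lemma (`exists_contDiff_of_expansion`) turns them into smooth
functions.

On monomials the Lie derivative along `L` acts as `x₂ ∂/∂x₁` plus the scalar `-i · freq`. Nonzero
total scalars are inverted because the rest is nilpotent; at resonance only monomials free of `x₂`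
survive, together with a radial field `g · (x₁, x₂)` from the nilpotent block
(`exists_homological`). Rational independence and coprimality identify the resonant monomials:
moduli times powers of `w` or its conjugate, possibly multiplied by a coordinate `z_j` or by `q₁`,
`q₂` (`resonance`, `Resonant.decomp_one`, `Resonant.decomp_two`). Since `(Im w)²` is a polynomial in
the other invariants, powers of `w` reduce to `A + i (Im w) B`.

Reversibility is imposed by averaging, first over `φ`, which leaves twelve generators, then over
`ψ`. Each product of an invariant monomial and a generator is an eigenvector of `ψ` with sign `±1`,
hence is kept or killed. The sign depends only on `a₀`, on `a₁ ^ n₂ * a₂ ^ n₁` and on the parities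
of the exponents of `x₁` and `Re w`; counting parities gives the four types. -/

namespace Bireversible

open Filter Topology Asymptotics

set_option linter.unusedSectionVars false

/-! ### Homogeneous maps and order of vanishing at the origin. -/

section Order

variable {E F G : Type*} [NormedAddCommGroup E] [NormedSpace ℝ E]
  [NormedAddCommGroup F] [NormedSpace ℝ F] [NormedAddCommGroup G] [NormedSpace ℝ G]

/-- A smooth map that is homogeneous of degree `k`. -/
def IsHom (k : ℕ) (g : E → F) : Prop :=
  ContDiff ℝ ∞ g ∧ ∀ (t : ℝ) (v : E), g (t • v) = t ^ k • g v

/-- The map `g` is `O(‖v‖ ^ n)` at the origin. -/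
def Vanishes (n : ℕ) (g : E → F) : Prop :=
  g =O[𝓝 0] fun v => ‖v‖ ^ n

theorem Vanishes.add {n : ℕ} {g h : E → F} (hg : Vanishes n g) (hh : Vanishes n h) :
    Vanishes n (fun v => g v + h v) := IsBigO.add hg hh

theorem Vanishes.sub {n : ℕ} {g h : E → F} (hg : Vanishes n g) (hh : Vanishes n h) :
    Vanishes n (fun v => g v - h v) := IsBigO.sub hg hh

theorem Vanishes.neg {n : ℕ} {g : E → F} (hg : Vanishes n g) :
    Vanishes n (fun v => -g v) := IsBigO.neg_left hg

theorem vanishes_zero (n : ℕ) : Vanishes n (fun _ : E => (0 : F)) := isBigO_zero _ _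

theorem Vanishes.sum {ι : Type*} {n : ℕ} {g : ι → E → F} {s : Finset ι}
    (hg : ∀ i ∈ s, Vanishes n (g i)) : Vanishes n (fun v => ∑ i ∈ s, g i v) :=
  IsBigO.fun_sum hg

theorem isBigO_norm_pow_of_le {m n : ℕ} (h : m ≤ n) :
    (fun v : E => ‖v‖ ^ n) =O[𝓝 0] fun v => ‖v‖ ^ m := by
  refine IsBigO.of_bound 1 ?_
  filter_upwards [Metric.ball_mem_nhds (0 : E) one_pos] with v hv
  have : ‖v‖ ≤ 1 := by simpa using (mem_ball_zero_iff.1 hv).le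
  simpa using pow_le_pow_of_le_one (norm_nonneg _) this h

theorem Vanishes.mono {m n : ℕ} {g : E → F} (hg : Vanishes n g) (h : m ≤ n) : Vanishes m g :=
  IsBigO.trans hg (isBigO_norm_pow_of_le h)

theorem Vanishes.comp {n : ℕ} {g : F → G} {a : E → F} (hg : Vanishes n g) (ha : Vanishes 1 a) :
    Vanishes n (fun v => g (a v)) := by
  have h0 : Tendsto a (𝓝 0) (𝓝 0) := by
    have : Tendsto (fun v : E => ‖v‖ ^ 1) (𝓝 0) (𝓝 0) := by
      simpa using (continuous_norm.tendsto (0 : E))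
    exact IsBigO.trans_tendsto ha this
  have h1 := hg.comp_tendsto h0
  refine h1.trans ?_
  have := (IsBigO.norm_left ha).pow n
  simpa only [pow_one, Function.comp_def] using this

theorem Vanishes.clm_apply {m n : ℕ} {A : E → F →L[ℝ] G} {b : E → F} (hA : Vanishes m A)
    (hb : Vanishes n b) : Vanishes (m + n) (fun v => A v (b v)) := by
  have h := IsBigO.mul (IsBigO.norm_left hA) (IsBigO.norm_left hb)
  refine IsBigO.trans (IsBigO.of_bound 1 (Eventually.of_forall fun v => ?_))
    (h.congr_right fun v => (pow_add _ _ _).symm)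
  simpa using (A v).le_opNorm (b v)

theorem Vanishes.smul {m n : ℕ} {c : E → ℝ} {b : E → F} (hc : Vanishes m c)
    (hb : Vanishes n b) : Vanishes (m + n) (fun v => c v • b v) := by
  have := IsBigO.smul hc hb
  simpa [Vanishes, pow_add] using this

theorem Vanishes.clm_comp {n : ℕ} (A : F →L[ℝ] G) {g : E → F} (hg : Vanishes n g) :
    Vanishes n (fun v => A (g v)) :=
  (A.isBigO_comp g _).trans hg

theorem vanishes_id : Vanishes 1 (fun v : E => v) := by
  refine IsBigO.of_bound 1 (Eventually.of_forall fun v => ?_)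
  simp

theorem vanishes_clm (A : E →L[ℝ] F) : Vanishes 1 (fun v => A v) := vanishes_id.clm_comp A

theorem vanishes_zero_of_continuousAt {g : E → F} (hg : ContinuousAt g 0) : Vanishes 0 g := by
  have : g =O[𝓝 0] fun _ => (1 : ℝ) := hg.tendsto.isBigO_one ℝ
  simpa [Vanishes] using this

theorem vanishes_one_of_differentiableAt {g : E → F} (hg : DifferentiableAt ℝ g 0)
    (h0 : g 0 = 0) : Vanishes 1 g := by
  have := hg.isBigO_sub
  simp only [h0, sub_zero] at this
  simpa [Vanishes] using this.norm_right

/-- Rescale `v` to norm `r / 2`, inside a ball where continuity bounds `g`. Homogeneity is required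
only for `t ≠ 0` so that the lemma applies to a derivative, whose scaling law is obtained by
cancelling `t`; this is why the value at `0` needs its own hypothesis. -/
theorem norm_smul_pow_aux {k : ℕ} {g : E → F}
    (hg : ∀ (t : ℝ) (v : E), t ≠ 0 → g (t • v) = t ^ k • g v)
    (hc : ContinuousAt g 0) (h0 : k = 0 ∨ g 0 = 0) : Vanishes k g := by
  obtain ⟨C, hC⟩ := (vanishes_zero_of_continuousAt hc).bound
  obtain ⟨r, hr, hrC⟩ := Metric.eventually_nhds_iff_ball.1 hC
  refine IsBigO.of_bound (C * (2 / r) ^ k) (Eventually.of_forall fun v => ?_)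
  rcases eq_or_ne v 0 with rfl | hv
  · rcases h0 with rfl | h0
    · simpa using hrC 0 (by simpa using hr)
    · have hC0 : 0 ≤ C := by
        have := hrC 0 (by simpa using hr)
        simp only [pow_zero, norm_one, mul_one] at this
        exact (norm_nonneg _).trans this
      rw [h0, norm_zero]
      positivity
  · have hvn : 0 < ‖v‖ := norm_pos_iff.2 hv
    have ht : 2 * ‖v‖ / r ≠ 0 := by positivity
    have hv' : v = (2 * ‖v‖ / r) • ((2 * ‖v‖ / r)⁻¹ • v) := by
      rw [smul_smul, mul_inv_cancel₀ ht, one_smul]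
    have hm : (2 * ‖v‖ / r)⁻¹ • v ∈ Metric.ball (0 : E) r := by
      rw [mem_ball_zero_iff, norm_smul, norm_inv, Real.norm_of_nonneg (by positivity)]
      field_simp
      linarith
    have := hrC _ hm
    rw [hv', hg _ _ ht, norm_smul, norm_pow, Real.norm_of_nonneg (by positivity), ← hv']
    simp only [pow_zero, norm_one, mul_one] at this
    rw [norm_pow, norm_norm]
    calc (2 * ‖v‖ / r) ^ k * ‖g ((2 * ‖v‖ / r)⁻¹ • v)‖ ≤ (2 * ‖v‖ / r) ^ k * C := by gcongr
      _ = C * (2 / r) ^ k * ‖v‖ ^ k := by rw [div_pow, div_pow, mul_pow]; ring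

theorem IsHom.map_zero {k : ℕ} {g : E → F} (hg : IsHom k g) (hk : 1 ≤ k) : g 0 = 0 := by
  have := hg.2 0 0
  rwa [smul_zero, zero_pow (by omega), zero_smul] at this

theorem IsHom.vanishes {k : ℕ} {g : E → F} (hg : IsHom k g) : Vanishes k g := by
  refine norm_smul_pow_aux (fun t v _ => hg.2 t v) hg.1.continuous.continuousAt ?_
  rcases Nat.eq_zero_or_pos k with h | h
  · exact Or.inl h
  · exact Or.inr (hg.map_zero h)

theorem IsHom.add {k : ℕ} {g h : E → F} (hg : IsHom k g) (hh : IsHom k h) :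
    IsHom k (fun v => g v + h v) :=
  ⟨hg.1.add hh.1, fun t v => by simp only [hg.2, hh.2, smul_add]⟩

theorem IsHom.sub {k : ℕ} {g h : E → F} (hg : IsHom k g) (hh : IsHom k h) :
    IsHom k (fun v => g v - h v) :=
  ⟨hg.1.sub hh.1, fun t v => by simp only [hg.2, hh.2, smul_sub]⟩

theorem IsHom.const_smul {k : ℕ} {g : E → F} (c : ℝ) (hg : IsHom k g) :
    IsHom k (fun v => c • g v) :=
  ⟨hg.1.const_smul c, fun t v => by simp only [hg.2]; rw [smul_comm]⟩

theorem isHom_zero (k : ℕ) : IsHom k (fun _ : E => (0 : F)) :=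
  ⟨contDiff_const, fun t v => by simp⟩

theorem IsHom.sum {ι : Type*} {k : ℕ} {g : ι → E → F} {s : Finset ι}
    (hg : ∀ i ∈ s, IsHom k (g i)) : IsHom k (fun v => ∑ i ∈ s, g i v) :=
  ⟨ContDiff.sum fun i hi => (hg i hi).1, fun t v => by
    rw [Finset.smul_sum]
    exact Finset.sum_congr rfl fun i hi => (hg i hi).2 t v⟩

theorem IsHom.clm_comp {k : ℕ} {g : E → F} (A : F →L[ℝ] G) (hg : IsHom k g) :
    IsHom k (fun v => A (g v)) :=
  ⟨A.contDiff.comp hg.1, fun t v => by simp only [hg.2, map_smul]⟩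

theorem IsHom.comp_clm {k : ℕ} {g : F → G} (A : E →L[ℝ] F) (hg : IsHom k g) :
    IsHom k (fun v => g (A v)) :=
  ⟨hg.1.comp A.contDiff, fun t v => by simp only [hg.2, map_smul]⟩

theorem isHom_clm (A : E →L[ℝ] F) : IsHom 1 (fun v => A v) :=
  ⟨A.contDiff, fun t v => by simp⟩

theorem IsHom.smul {k l : ℕ} {c : E → ℝ} {g : E → F} (hc : IsHom k c) (hg : IsHom l g) :
    IsHom (k + l) (fun v => c v • g v) :=
  ⟨hc.1.smul hg.1, fun t v => by
    simp only [hc.2, hg.2, smul_smul, smul_eq_mul, pow_add]; ring_nf⟩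

/-- Differentiating in `s` the identity `g (t v + s b(t v)) = t ^ k g (v + t ^ j s b(v))` gives the
scaling law without dividing by `t`, so `t = 0` is included. Writing the degree of `b` as `j + 1`
avoids truncated subtraction. -/
theorem IsHom.fderiv_apply {k j : ℕ} {g : E → F} {b : E → E} (hg : IsHom k g)
    (hb : IsHom (j + 1) b) : IsHom (k + j) (fun v => fderiv ℝ g v (b v)) := by
  refine ⟨(hg.1.fderiv_right (m := ∞) le_rfl).clm_apply hb.1, fun t v => ?_⟩
  have hd : Differentiable ℝ g := hg.1.differentiable (by simp)
  have key : ∀ (x w : E), HasDerivAt (fun s : ℝ => g (x + s • w)) (fderiv ℝ g x w) 0 := by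
    intro x w
    have h1 : HasDerivAt (fun s : ℝ => x + s • w) w 0 := by
      simpa using ((hasDerivAt_id (0 : ℝ)).smul_const w).const_add x
    have h2 : HasFDerivAt g (fderiv ℝ g x) (x + (0 : ℝ) • w) := by
      simpa using (hd x).hasFDerivAt
    exact h2.comp_hasDerivAt (0 : ℝ) h1
  have e1 := key (t • v) (b (t • v))
  have e2 : HasDerivAt (fun s : ℝ => g (t • v + s • b (t • v)))
      (t ^ (k + j) • fderiv ℝ g v (b v)) 0 := by
    have h3 : (fun s : ℝ => g (t • v + s • b (t • v)))
        = fun s => t ^ k • g (v + (t ^ j * s) • b v) := by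
      funext s
      rw [← hg.2, hb.2, smul_add, smul_smul, smul_smul, pow_succ]
      ring_nf
    rw [h3, pow_add, mul_smul]
    refine HasDerivAt.const_smul (t ^ k) ?_
    have h4 := (key v (b v))
    have h5 : HasDerivAt (fun s : ℝ => t ^ j * s) (t ^ j) 0 := by
      simpa using (hasDerivAt_id (0 : ℝ)).const_mul (t ^ j)
    have h4' : HasDerivAt (fun s : ℝ => g (v + s • b v)) (fderiv ℝ g v (b v)) (t ^ j * 0) := by
      simpa using h4
    exact HasDerivAt.scomp (0 : ℝ) h4' h5
  exact e1.unique e2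

theorem IsHom.vanishes_fderiv {k : ℕ} {g : E → F} (hg : IsHom (k + 1) g) :
    Vanishes k (fderiv ℝ g) := by
  have hd : Differentiable ℝ g := hg.1.differentiable (by simp)
  have hs : ∀ (t : ℝ) (v : E), t ≠ 0 → fderiv ℝ g (t • v) = t ^ k • fderiv ℝ g v := by
    intro t v ht
    ext w
    have h : HasFDerivAt (fun u => g (t • u)) (t ^ (k + 1) • fderiv ℝ g v) v := by
      simp only [hg.2]
      exact (hd v).hasFDerivAt.const_smul _
    have h' : HasFDerivAt (fun u => g (t • u)) ((fderiv ℝ g (t • v)).comp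
        (t • ContinuousLinearMap.id ℝ E)) v :=
      (hd (t • v)).hasFDerivAt.comp v ((hasFDerivAt_id v).const_smul t)
    have := congrArg (fun A : E →L[ℝ] F => A w) (h.unique h')
    simp only [smul_apply, ContinuousLinearMap.comp_apply,
      ContinuousLinearMap.id_apply, map_smul] at this
    rw [pow_succ', mul_smul] at this
    rw [smul_apply]
    exact (smul_right_injective F ht this).symm
  have hc : Continuous (fderiv ℝ g) := hg.1.continuous_fderiv (by simp)
  refine norm_smul_pow_aux hs hc.continuousAt ?_
  rcases Nat.eq_zero_or_pos k with h | h
  · exact Or.inl h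
  · right
    -- For `k ≥ 1`, scaling by `2` at the origin gives `Dg(0) = 2 ^ k Dg(0)`, which forces `Dg(0) =
    -- 0`.
    have h1 := hs 2 0 two_ne_zero
    rw [smul_zero] at h1
    have h2 : (1 - (2 : ℝ) ^ k) • fderiv ℝ g 0 = 0 := by
      rw [sub_smul, one_smul, ← h1, sub_self]
    have h3 : (1 - (2 : ℝ) ^ k) ≠ 0 := by
      have : (1 : ℝ) < 2 ^ k := one_lt_pow₀ (by norm_num) (by omega)
      linarith
    exact (smul_eq_zero.1 h2).resolve_left h3

/-- Mean value estimate. -/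
theorem Vanishes.sub_comp {m n : ℕ} {g : F → G} {a b : E → F} (hg : Differentiable ℝ g)
    (hg' : Vanishes n (fderiv ℝ g)) (ha : Vanishes 1 a) (hb : Vanishes 1 b)
    (hab : Vanishes m (fun v => a v - b v)) :
    Vanishes (n + m) (fun v => g (a v) - g (b v)) := by
  obtain ⟨C, hC0, hC⟩ := IsBigO.exists_nonneg hg'
  obtain ⟨r, hr, hrC⟩ := Metric.eventually_nhds_iff_ball.1 hC.bound
  obtain ⟨A, hA0, hA⟩ := IsBigO.exists_nonneg ha
  obtain ⟨B, hB0, hB⟩ := IsBigO.exists_nonneg hb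
  obtain ⟨D, hD0, hD⟩ := IsBigO.exists_nonneg hab
  have hsmall : ∀ᶠ v : E in 𝓝 0, (A + B) * ‖v‖ < r := by
    have : Tendsto (fun v : E => (A + B) * ‖v‖) (𝓝 0) (𝓝 0) := by
      simpa using (continuous_norm.tendsto (0 : E)).const_mul (A + B)
    exact this.eventually (gt_mem_nhds hr)
  refine IsBigO.of_bound (C * (A + B) ^ n * D) ?_
  filter_upwards [hA.bound, hB.bound, hD.bound, hsmall] with v hAv hBv hDv hv
  simp only [pow_one, norm_norm] at hAv hBv
  rw [norm_pow, norm_norm] at hDv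
  -- A ball containing both `a v` and `b v`; being convex, it also contains the segment between
  -- them.
  set R := (A + B) * ‖v‖ with hR
  have hvn := norm_nonneg v
  have hmem : ∀ x ∈ Metric.closedBall (0 : F) R, ‖fderiv ℝ g x‖ ≤ C * R ^ n := by
    intro x hx
    have hx' : ‖x‖ ≤ R := by simpa using hx
    refine (hrC x (mem_ball_zero_iff.2 (hx'.trans_lt hv))).trans ?_
    rw [norm_pow, norm_norm]
    gcongr
  have hle := (convex_closedBall (0 : F) R).norm_image_sub_le_of_norm_fderiv_le (𝕜 := ℝ) (f := g)
    (fun x _ => hg x) hmem (x := b v) (y := a v)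
    (by rw [mem_closedBall_zero_iff]; refine hBv.trans ?_; rw [hR]; gcongr; linarith)
    (by rw [mem_closedBall_zero_iff]; refine hAv.trans ?_; rw [hR]; gcongr; linarith)
  refine hle.trans ?_
  rw [norm_pow, norm_norm]
  calc C * R ^ n * ‖a v - b v‖ ≤ C * R ^ n * (D * ‖v‖ ^ m) := by gcongr
    _ = C * (A + B) ^ n * D * ‖v‖ ^ (n + m) := by rw [hR, mul_pow, pow_add]; ring

end Order

/-! ### Taylor expansions, and formal identities as asymptotic ones. -/

section Taylor

variable {E F G : Type*} [NormedAddCommGroup E] [NormedSpace ℝ E]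
  [NormedAddCommGroup F] [NormedSpace ℝ F] [NormedAddCommGroup G] [NormedSpace ℝ G]

/-- Along a ray, `t ^ n ‖g v‖ = ‖g (t v)‖ ≤ C t ^ (n + 1) ‖v‖ ^ (n + 1)`; cancel `t ^ n` and let `t
→ 0⁺`. -/
theorem IsHom.eq_zero_of_vanishes {n : ℕ} {g : E → F} (hg : IsHom n g) (h : Vanishes (n + 1) g)
    (v : E) : g v = 0 := by
  obtain ⟨C, hC⟩ := h.bound
  have hline : Tendsto (fun t : ℝ => t • v) (𝓝[>] 0) (𝓝 0) := by
    have : Tendsto (fun t : ℝ => t • v) (𝓝 0) (𝓝 ((0 : ℝ) • v)) :=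
      (continuous_id.smul continuous_const).tendsto 0
    rw [zero_smul] at this
    exact this.mono_left nhdsWithin_le_nhds
  have h1 : ∀ᶠ t : ℝ in 𝓝[>] 0, ‖g v‖ ≤ t * (C * ‖v‖ ^ (n + 1)) := by
    filter_upwards [hline.eventually hC, self_mem_nhdsWithin] with t ht ht0
    have ht0' : 0 < t := ht0
    rw [hg.2, norm_smul, norm_pow, norm_pow, norm_norm, norm_smul, Real.norm_of_nonneg ht0'.le,
      mul_pow] at ht
    have : t ^ n * ‖g v‖ ≤ t ^ n * (t * (C * ‖v‖ ^ (n + 1))) := by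
      refine ht.trans (le_of_eq ?_)
      ring
    exact le_of_mul_le_mul_left this (by positivity)
  have h2 : Tendsto (fun t : ℝ => t * (C * ‖v‖ ^ (n + 1))) (𝓝[>] 0) (𝓝 0) := by
    have : Tendsto (fun t : ℝ => t * (C * ‖v‖ ^ (n + 1))) (𝓝 0) (𝓝 (0 * (C * ‖v‖ ^ (n + 1)))) :=
      (continuous_id.mul continuous_const).tendsto 0
    rw [zero_mul] at this
    exact this.mono_left nhdsWithin_le_nhds
  exact norm_le_zero_iff.1 (ge_of_tendsto h2 h1)

/-- Uniqueness of expansions into homogeneous terms. The top term is itself of order `n`, so it may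
be dropped to reach the induction hypothesis; once the lower terms are gone, it vanishes too. -/
theorem eq_zero_of_vanishes_sum {n : ℕ} {P : ℕ → E → F} (hP : ∀ j < n, IsHom j (P j))
    (h : Vanishes n (fun v => ∑ j ∈ Finset.range n, P j v)) : ∀ j < n, ∀ v, P j v = 0 := by
  induction n with
  | zero => intro j hj; omega
  | succ n ih =>
    have h1 : ∀ j < n, ∀ v, P j v = 0 := by
      refine ih (fun j hj => hP j (by omega)) ?_
      have := (h.mono (Nat.le_succ n)).sub (hP n (Nat.lt_succ_self n)).vanishes
      simpa [Finset.sum_range_succ] using this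
    intro j hj v
    rcases Nat.lt_succ_iff_lt_or_eq.1 hj with hj | rfl
    · exact h1 j hj v
    · refine (hP j (Nat.lt_succ_self j)).eq_zero_of_vanishes ?_ v
      refine h.congr_left fun w => ?_
      rw [Finset.sum_range_succ, Finset.sum_eq_zero fun i hi => h1 i (Finset.mem_range.1 hi) w,
        zero_add]

theorem isHom_diag {n : ℕ} (M : ContinuousMultilinearMap ℝ (fun _ : Fin n => E) F) :
    IsHom n (fun v => M fun _ => v) := by
  refine ⟨M.contDiff.comp (contDiff_pi.2 fun _ => contDiff_id), fun t v => ?_⟩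
  have := M.map_smul_univ (fun _ => t) (fun _ => v)
  simpa using this

/-- The homogeneous term of degree `n` of the Taylor expansion of `g` at the origin. -/
noncomputable def taylorTerm (g : E → F) (n : ℕ) (v : E) : F :=
  (n ! : ℝ)⁻¹ • iteratedFDeriv ℝ n g 0 fun _ => v

theorem isHom_taylorTerm (g : E → F) (n : ℕ) : IsHom n (taylorTerm g n) :=
  (isHom_diag _).const_smul _

theorem homTerm_taylorAtZero (X : E → E) (n : ℕ) (v : E) :
    homTerm (taylorAtZero X) n v = taylorTerm X n v := rfl

theorem isHom_homTerm (H : FormalMultilinearSeries ℝ E E) (n : ℕ) : IsHom n (homTerm H n) :=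
  isHom_diag _

/-- Taylor's formula with integral remainder: the derivative of order `n` is continuous, hence
bounded near the origin. Order `0` is plain continuity. -/
theorem vanishes_sub_taylor [CompleteSpace F] {g : E → F} (hg : ContDiff ℝ ∞ g) (n : ℕ) :
    Vanishes n (fun v => g v - ∑ j ∈ Finset.range n, taylorTerm g j v) := by
  cases n with
  | zero => simpa using vanishes_zero_of_continuousAt hg.continuous.continuousAt
  | succ n =>
    have hc : Continuous (iteratedFDeriv ℝ (n + 1) g) :=
      hg.continuous_iteratedFDeriv (by exact_mod_cast le_top)
    obtain ⟨C, hC⟩ := (vanishes_zero_of_continuousAt hc.continuousAt).bound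
    obtain ⟨r, hr, hrC⟩ := Metric.eventually_nhds_iff_ball.1 hC
    refine IsBigO.of_bound ((n ! : ℝ)⁻¹ * C) ?_
    filter_upwards [Metric.ball_mem_nhds (0 : E) hr] with v hv
    have ht := map_add_eq_sum_add_integral_iteratedFDeriv (f := g) (x := 0) (y := v) (n := n)
      (fun t _ => (hg.of_le (by exact_mod_cast le_top)).contDiffAt)
    rw [zero_add] at ht
    have e : g v - ∑ j ∈ Finset.range (n + 1), taylorTerm g j v
        = (n ! : ℝ)⁻¹ • ∫ t in (0 : ℝ)..1,
          (1 - t) ^ n • iteratedFDeriv ℝ (n + 1) g (0 + t • v) (fun _ ↦ v) := by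
      rw [sub_eq_iff_eq_add']; exact ht
    rw [e, norm_smul, norm_inv, Real.norm_natCast, mul_assoc, norm_pow, norm_norm]
    gcongr
    have hb := intervalIntegral.norm_integral_le_of_norm_le_const (a := (0 : ℝ)) (b := 1)
      (f := fun t => (1 - t) ^ n • iteratedFDeriv ℝ (n + 1) g (0 + t • v) (fun _ ↦ v))
      (C := C * ‖v‖ ^ (n + 1)) ?_
    · simpa using hb
    · intro t ht
      rw [Set.uIoc_of_le zero_le_one] at ht
      have hm : 0 + t • v ∈ Metric.ball (0 : E) r := by
        rw [zero_add, mem_ball_zero_iff, norm_smul, Real.norm_of_nonneg ht.1.le]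
        have := mem_ball_zero_iff.1 hv
        nlinarith [norm_nonneg v, ht.2]
      have h1 := hrC _ hm
      simp only [pow_zero, norm_one, mul_one] at h1
      have h2 : ‖(1 - t) ^ n‖ ≤ 1 := by
        rw [norm_pow, Real.norm_of_nonneg (by linarith [ht.2])]
        exact pow_le_one₀ (by linarith [ht.2]) (by linarith [ht.1])
      rw [norm_smul]
      calc _ ≤ 1 * (‖iteratedFDeriv ℝ (n + 1) g (0 + t • v)‖ * ‖v‖ ^ (n + 1)) := by
            gcongr
            refine (ContinuousMultilinearMap.le_opNorm _ _).trans ?_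
            simp
        _ ≤ C * ‖v‖ ^ (n + 1) := by rw [one_mul]; gcongr

/-- A smooth map of order `n` agrees with its Taylor term of degree `n` to order `n + 1`. -/
theorem Vanishes.sub_taylorTerm [CompleteSpace F] {n : ℕ} {g : E → F} (hg : ContDiff ℝ ∞ g)
    (h : Vanishes n g) : Vanishes (n + 1) (fun v => g v - taylorTerm g n v) := by
  have h0 : ∀ j < n, ∀ v, taylorTerm g j v = 0 := by
    refine eq_zero_of_vanishes_sum (fun j _ => isHom_taylorTerm g j) ?_
    have := h.sub (vanishes_sub_taylor hg n)
    simpa using this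
  refine (vanishes_sub_taylor hg (n + 1)).congr_left fun v => ?_
  rw [Finset.sum_range_succ, Finset.sum_eq_zero fun i hi => h0 i (Finset.mem_range.1 hi) v,
    zero_add]

/-- Truncation of a formal series. -/
noncomputable def truncSeries (N : ℕ) (p : FormalMultilinearSeries ℝ E F) :
    FormalMultilinearSeries ℝ E F :=
  fun n => if n < N then p n else 0

theorem truncSeries_sum (N : ℕ) (p : FormalMultilinearSeries ℝ E F) (v : E) :
    (truncSeries N p).sum v = ∑ j ∈ Finset.range N, p j fun _ => v := by
  rw [FormalMultilinearSeries.sum_of_finite (n := N)]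
  · unfold FormalMultilinearSeries.partialSum
    refine Finset.sum_congr rfl fun j hj => ?_
    simp [truncSeries, Finset.mem_range.1 hj]
  · intro m hm
    simp [truncSeries, not_lt.2 hm]

/-- A composition of the integer `m` has length and blocks at most `m`, so degree `m` never sees the
terms cut off. -/
theorem truncSeries_comp (N : ℕ) (q p : FormalMultilinearSeries ℝ E E) {m : ℕ} (hm : m < N) :
    (truncSeries N q).comp (truncSeries N p) m = q.comp p m := by
  unfold FormalMultilinearSeries.comp
  refine Finset.sum_congr rfl fun c _ => ?_
  ext v
  rw [FormalMultilinearSeries.compAlongComposition_apply,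
    FormalMultilinearSeries.compAlongComposition_apply]
  have h1 : truncSeries N q c.length = q c.length := by
    simp [truncSeries, c.length_le.trans_lt hm]
  have h2 : (truncSeries N p).applyComposition c v = p.applyComposition c v := by
    funext i
    have : c.blocksFun i < N := (c.blocksFun_le i).trans_lt hm
    simp [FormalMultilinearSeries.applyComposition, truncSeries, this]
  rw [h1, h2]

/-- Truncated series converge, being polynomial, so the composition theorem for analytic functions
applies to them even when `q` and `p` diverge. -/
theorem vanishes_comp_sub (N : ℕ) (q p : FormalMultilinearSeries ℝ E E)
    (hp : ∀ v, homTerm p 0 v = 0) :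
    Vanishes N (fun v => (∑ j ∈ Finset.range N, homTerm q j
        (∑ i ∈ Finset.range N, homTerm p i v))
      - ∑ m ∈ Finset.range N, homTerm (q.comp p) m v) := by
  have hq := ((truncSeries N q).hasFiniteFPowerSeriesOnBall_of_finite (n := N)
    (fun m hm => by simp [truncSeries, not_lt.2 hm])).toHasFPowerSeriesOnBall.hasFPowerSeriesAt
  have hp' := ((truncSeries N p).hasFiniteFPowerSeriesOnBall_of_finite (n := N)
    (fun m hm => by simp [truncSeries, not_lt.2 hm])).toHasFPowerSeriesOnBall.hasFPowerSeriesAt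
  have h0 : (truncSeries N p).sum 0 = 0 := by
    rw [truncSeries_sum]
    refine Finset.sum_eq_zero fun j _ => ?_
    cases j with
    | zero => exact hp 0
    | succ j => exact (isHom_homTerm p (j + 1)).map_zero (by omega)
  -- The outer series must be centred at the value of the inner sum at the origin.
  rw [← h0] at hq
  have := (hq.comp hp').isBigO_sub_partialSum_pow N
  refine this.congr_left fun v => ?_
  simp only [zero_add, Function.comp_apply, truncSeries_sum]
  congr 1
  unfold FormalMultilinearSeries.partialSum
  refine Finset.sum_congr rfl fun m hm => ?_
  rw [truncSeries_comp N q p (Finset.mem_range.1 hm)]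
  rfl

/-- Separates a product of two truncated series into its reliable part, the antidiagonals of total
degree below `N`, and an overflow of high order. -/
theorem sum_square_eq {M : Type*} [AddCommMonoid M] (N : ℕ) (T : ℕ → ℕ → M) :
    ∑ i ∈ Finset.range N, ∑ j ∈ Finset.range N, T i j
      = (∑ m ∈ Finset.range N, ∑ p ∈ Finset.HasAntidiagonal.antidiagonal m, T p.1 p.2)
        + ∑ p ∈ (Finset.range N ×ˢ Finset.range N).filter (fun p => N ≤ p.1 + p.2),
            T p.1 p.2 := by
  rw [← Finset.sum_product']
  rw [← Finset.sum_filter_add_sum_filter_not _ (fun p : ℕ × ℕ => p.1 + p.2 < N)]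
  congr 1
  · rw [← Finset.sum_fiberwise_of_maps_to (g := fun p : ℕ × ℕ => p.1 + p.2) (t := Finset.range N)]
    · refine Finset.sum_congr rfl fun m hm => ?_
      refine Finset.sum_congr ?_ fun _ _ => rfl
      ext p
      have := Finset.mem_range.1 hm
      simp only [Finset.mem_filter, Finset.mem_product, Finset.mem_range,
        Finset.HasAntidiagonal.mem_antidiagonal]
      omega
    · intro p hp
      simpa using (Finset.mem_filter.1 hp).2
  · refine Finset.sum_congr ?_ fun _ _ => rfl
    ext p
    simp

theorem isHom_derivTerm (H : FormalMultilinearSeries ℝ E E) {P : ℕ → E → E}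
    (hP : ∀ j, IsHom j (P j)) (hP0 : ∀ v, P 0 v = 0) {i j m : ℕ} (h : i + j = m + 1) :
    IsHom m (fun v => fderiv ℝ (homTerm H i) v (P j v)) := by
  cases j with
  | zero =>
    simp only [hP0, map_zero]
    exact isHom_zero m
  | succ j =>
    have : i + j = m := by omega
    exact this ▸ (isHom_homTerm H i).fderiv_apply (hP (j + 1))

/-- The bridge from estimates to formal conjugacy. Differentiation lowers degree by one and `X 0 =
0`, so terms of `H` up to degree `k + 1` determine both sides through degree `k`. Each side is
expanded to order `k + 1` and uniqueness of homogeneous expansions is applied to the difference. -/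
theorem formal_eq_of_vanishes [CompleteSpace E] {X Y : E → E} (hX : ContDiff ℝ ∞ X)
    (hX0 : X 0 = 0) (hY : ContDiff ℝ ∞ Y) (H : FormalMultilinearSeries ℝ E E)
    (hH0 : ∀ v, homTerm H 0 v = 0) (k : ℕ)
    (hv : Vanishes (k + 1) (fun v =>
      fderiv ℝ (fun u => ∑ i ∈ Finset.range (k + 2), homTerm H i u) v (X v)
        - Y (∑ i ∈ Finset.range (k + 2), homTerm H i v))) (v : E) :
    derivApplyTerm H (taylorAtZero X) k v = homTerm ((taylorAtZero Y).comp H) k v := by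
  have hT0 : ∀ v, taylorTerm X 0 v = 0 := by
    intro v; simp [taylorTerm, hX0]
  have hHd : ∀ i, Differentiable ℝ (homTerm H i) := fun i =>
    (isHom_homTerm H i).1.differentiable (by simp)
  have hHf : ∀ i, Vanishes (i - 1) (fderiv ℝ (homTerm H i)) := by
    intro i
    cases i with
    | zero =>
      have hc : Continuous (fderiv ℝ (homTerm H 0)) :=
        (isHom_homTerm H 0).1.continuous_fderiv (by simp)
      exact vanishes_zero_of_continuousAt hc.continuousAt
    | succ i => exact (isHom_homTerm H (i + 1)).vanishes_fderiv
  have hHv : Vanishes 1 (fun v => ∑ i ∈ Finset.range (k + 2), homTerm H i v) := by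
    refine Vanishes.sum fun i _ => ?_
    cases i with
    | zero => exact (vanishes_zero 1).congr_left fun v => (hH0 v).symm
    | succ i => exact (isHom_homTerm H (i + 1)).vanishes.mono (by omega)
  -- the derivative side
  have hA : Vanishes (k + 1) (fun v =>
      fderiv ℝ (fun u => ∑ i ∈ Finset.range (k + 2), homTerm H i u) v (X v)
        - ∑ m ∈ Finset.range (k + 1), derivApplyTerm H (taylorAtZero X) m v) := by
    have h1 : Vanishes (k + 1) (fun v => ∑ i ∈ Finset.range (k + 2), fderiv ℝ (homTerm H i) v
        (X v - ∑ j ∈ Finset.range (k + 2), taylorTerm X j v)) := by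
      refine Vanishes.sum fun i _ => ?_
      exact ((hHf i).clm_apply (vanishes_sub_taylor hX (k + 2))).mono (by omega)
    have h2 : Vanishes (k + 1) (fun v =>
        ∑ p ∈ (Finset.range (k + 2) ×ˢ Finset.range (k + 2)).filter
          (fun p => k + 2 ≤ p.1 + p.2), fderiv ℝ (homTerm H p.1) v (taylorTerm X p.2 v)) := by
      refine Vanishes.sum fun p hp => ?_
      have hp' := (Finset.mem_filter.1 hp).2
      have h3 := isHom_derivTerm H (fun j => isHom_taylorTerm X j) hT0
        (i := p.1) (j := p.2) (m := p.1 + p.2 - 1) (by omega)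
      exact h3.vanishes.mono (by omega)
    refine (h1.add h2).congr_left fun v => ?_
    have e1 : fderiv ℝ (fun u => ∑ i ∈ Finset.range (k + 2), homTerm H i u) v (X v)
        = ∑ i ∈ Finset.range (k + 2), fderiv ℝ (homTerm H i) v (X v) := by
      rw [fderiv_fun_sum fun i _ => (hHd i) v]
      simp
    have e2 := sum_square_eq (k + 2) (fun i j => fderiv ℝ (homTerm H i) v (taylorTerm X j v))
    -- `derivApplyTerm` in degree `m` runs over the antidiagonal of `m + 1`. The one left over by
    -- this shift is `{(0, 0)}`, which contributes nothing since `X` has no constant term.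
    rw [Finset.sum_range_succ' (fun m => ∑ p ∈ Finset.HasAntidiagonal.antidiagonal m,
      fderiv ℝ (homTerm H p.1) v (taylorTerm X p.2 v)) (k + 1)] at e2
    rw [show Finset.HasAntidiagonal.antidiagonal 0 = {((0 : ℕ), (0 : ℕ))} from rfl] at e2
    simp only [Finset.sum_singleton, hT0, map_zero, add_zero] at e2
    have e3 : ∀ m, derivApplyTerm H (taylorAtZero X) m v
        = ∑ p ∈ Finset.HasAntidiagonal.antidiagonal (m + 1),
          fderiv ℝ (homTerm H p.1) v (taylorTerm X p.2 v) := fun m => rfl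
    simp only [e1, e3, map_sub, map_sum, Finset.sum_sub_distrib, e2]
    abel
  have hB : Vanishes (k + 1) (fun v => Y (∑ i ∈ Finset.range (k + 2), homTerm H i v)
      - ∑ m ∈ Finset.range (k + 1), homTerm ((taylorAtZero Y).comp H) m v) := by
    have h1 := ((vanishes_sub_taylor hY (k + 2)).comp hHv).mono (Nat.le_succ (k + 1))
    have h2 := (vanishes_comp_sub (k + 2) (taylorAtZero Y) H hH0).mono (Nat.le_succ (k + 1))
    have h3 := (isHom_homTerm ((taylorAtZero Y).comp H) (k + 1)).vanishes
    refine ((h1.add h2).add h3).congr_left fun v => ?_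
    rw [Finset.sum_range_succ (fun m => homTerm ((taylorAtZero Y).comp H) m v)]
    simp only [homTerm_taylorAtZero]
    abel
  have hfin := eq_zero_of_vanishes_sum (n := k + 1)
    (P := fun m v => derivApplyTerm H (taylorAtZero X) m v
      - homTerm ((taylorAtZero Y).comp H) m v)
    (fun m _ => IsHom.sub (IsHom.sum fun p hp => isHom_derivTerm H
      (fun j => isHom_taylorTerm X j) hT0 (Finset.HasAntidiagonal.mem_antidiagonal.1 hp)) (isHom_homTerm _ m)) (by
      refine ((hv.sub hA).add hB).congr_left fun v => ?_
      rw [Finset.sum_sub_distrib]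
      abel) k (Nat.lt_succ_self k) v
  exact sub_eq_zero.1 hfin

end Taylor

/-! ### Borel summation with weighted dilations. -/

section Borel

variable {E F : Type*} [NormedAddCommGroup E] [NormedSpace ℝ E]
  [NormedAddCommGroup F] [NormedSpace ℝ F] {κ : Type*} [Fintype κ]

theorem IsHom.exists_bound {k : ℕ} {g : E → F} (hg : IsHom k g) :
    ∃ C, ∀ v, ‖g v‖ ≤ C * ‖v‖ ^ k := by
  obtain ⟨C, hC⟩ := hg.vanishes.bound
  refine ⟨C, fun v => ?_⟩
  have hline : Tendsto (fun t : ℝ => t • v) (𝓝[>] 0) (𝓝 0) := by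
    have : Tendsto (fun t : ℝ => t • v) (𝓝 0) (𝓝 ((0 : ℝ) • v)) :=
      (continuous_id.smul continuous_const).tendsto 0
    rw [zero_smul] at this
    exact this.mono_left nhdsWithin_le_nhds
  obtain ⟨t, ht, ht0⟩ := ((hline.eventually hC).and self_mem_nhdsWithin).exists
  have ht0' : 0 < t := ht0
  rw [hg.2, norm_smul, norm_pow, norm_pow, norm_norm, norm_smul, Real.norm_of_nonneg ht0'.le,
    mul_pow] at ht
  have : t ^ k * ‖g v‖ ≤ t ^ k * (C * ‖v‖ ^ k) := by
    refine ht.trans (le_of_eq ?_)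
    ring
  exact le_of_mul_le_mul_left this (by positivity)

/-- The weighted dilation with weights `w`. -/
noncomputable def dil (w : κ → ℕ) (t : ℝ) : (κ → ℝ) →L[ℝ] (κ → ℝ) :=
  ContinuousLinearMap.pi fun i => t ^ w i • ContinuousLinearMap.proj i

theorem dil_apply (w : κ → ℕ) (t : ℝ) (u : κ → ℝ) (i : κ) : dil w t u i = t ^ w i * u i := by
  simp [dil]

theorem norm_dil_le (w : κ → ℕ) {t : ℝ} (ht : 1 ≤ t) : ‖dil w t‖ ≤ t ^ ∑ i, w i := by
  refine ContinuousLinearMap.opNorm_le_bound _ (by positivity) fun u => ?_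
  refine (pi_norm_le_iff_of_nonneg (by positivity)).2 fun i => ?_
  rw [dil_apply, norm_mul, norm_pow, Real.norm_of_nonneg (by linarith)]
  gcongr ?_ * ?_
  · refine pow_le_pow_right₀ ht ?_
    exact Finset.single_le_sum (f := w) (fun _ _ => Nat.zero_le _) (Finset.mem_univ i)
  · exact norm_le_pi_norm u i

theorem exists_norm_iteratedFDeriv_le {g : (κ → ℝ) → ℝ} (hg : ContDiff ℝ ∞ g)
    (hs : HasCompactSupport g) (n : ℕ) :
    ∃ M, ∀ j ≤ n, ∀ u, ‖iteratedFDeriv ℝ j g u‖ ≤ M := by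
  have h1 : ∀ j, ∃ M, ∀ u, ‖iteratedFDeriv ℝ j g u‖ ≤ M := fun j =>
    (hs.iteratedFDeriv j).exists_bound_of_continuous
      (hg.continuous_iteratedFDeriv (by exact_mod_cast le_top))
  choose M hM using h1
  refine ⟨∑ j ∈ Finset.range (n + 1), |M j|, fun j hj u => ?_⟩
  refine ((hM j u).trans (le_abs_self _)).trans ?_
  exact Finset.single_le_sum (f := fun j => |M j|) (fun _ _ => abs_nonneg _)
    (Finset.mem_range.2 (by omega))

set_option maxHeartbeats 400000 in
/-- **Borel's lemma** for quasi-homogeneous expansions. -/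
theorem exists_contDiff_of_expansion (w : κ → ℕ) {U : E → κ → ℝ} (hU : ContDiff ℝ ∞ U)
    (hw : ∀ i, 1 ≤ w i) (hUd : ∀ (t : ℝ) v, U (t • v) = dil w t (U v)) (P : ℕ → (κ → ℝ) → ℝ)
    (hP : ∀ n, ContDiff ℝ ∞ (P n)) (hPd : ∀ n (t : ℝ) u, P n (dil w t u) = t ^ n * P n u) :
    ∃ f : (κ → ℝ) → ℝ, ContDiff ℝ ∞ f ∧
      ∀ K, Vanishes K (fun v => f (U v) - ∑ n ∈ Finset.range K, P n (U v)) := by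
  let χ : ContDiffBump (0 : κ → ℝ) := ⟨1, 2, one_pos, one_lt_two⟩
  set g : ℕ → (κ → ℝ) → ℝ := fun n u => χ u * P n u with hgdef
  have hg : ∀ n, ContDiff ℝ ∞ (g n) := fun n => χ.contDiff.mul (hP n)
  have hgs : ∀ n, HasCompactSupport (g n) := fun n => χ.hasCompactSupport.mul_right
  have hPU : ∀ n, IsHom n (fun v => P n (U v)) := fun n =>
    ⟨(hP n).comp hU, fun t v => by simp only [hUd, hPd, smul_eq_mul]⟩
  have hgP : ∀ n u, ‖g n u‖ ≤ ‖P n u‖ := fun n u => by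
    rw [hgdef, norm_mul, Real.norm_of_nonneg χ.nonneg]
    exact mul_le_of_le_one_left (norm_nonneg _) χ.le_one
  have hM : ∀ n, ∃ M : ℝ, 1 ≤ M ∧ (∀ j ≤ n, ∀ u, ‖iteratedFDeriv ℝ j (g n) u‖ ≤ M) ∧
      ∀ v, ‖P n (U v)‖ ≤ M * ‖v‖ ^ n := by
    intro n
    obtain ⟨A, hA⟩ := exists_norm_iteratedFDeriv_le (hg n) (hgs n) n
    obtain ⟨B, hB⟩ := (hPU n).exists_bound
    refine ⟨max 1 (max A B), le_max_left _ _, fun j hj u => ?_, fun v => ?_⟩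
    · exact (hA j hj u).trans ((le_max_left _ _).trans (le_max_right _ _))
    · refine (hB v).trans ?_
      gcongr
      exact (le_max_right _ _).trans (le_max_right _ _)
  choose M hM1 hMg hMP using hM
  -- Chosen so that `M n / l n = 2⁻ⁿ`; this one ratio drives both the smoothness of the sum and the
  -- tail estimate.
  set l : ℕ → ℝ := fun n => 2 ^ n * M n with hldef
  have hl1 : ∀ n, 1 ≤ l n := fun n => one_le_mul_of_one_le_of_one_le
    (one_le_pow₀ one_le_two) (hM1 n)
  have hl0 : ∀ n, 0 < l n := fun n => one_pos.trans_le (hl1 n)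
  have hMl : ∀ n, M n / l n = (1 / 2) ^ n := fun n => by
    have : M n ≠ 0 := by linarith [hM1 n]
    simp only [hldef]
    rw [one_div, inv_pow]
    field_simp
  -- Where the rescaled cutoff equals `1`, quasi-homogeneity makes this equal to `P n`. Elsewhere
  -- the prefactor keeps it small.
  set T : ℕ → (κ → ℝ) → ℝ := fun n u => (l n ^ n)⁻¹ * g n (dil w (l n) u) with hTdef
  have hTs : ∀ n, ContDiff ℝ ∞ (T n) := fun n =>
    contDiff_const.mul ((hg n).comp (dil w (l n)).contDiff)
  have hsm : ContDiff ℝ ∞ fun u => ∑' n, T n u := by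
    refine contDiff_tsum_of_eventually (N := ⊤) (v := fun _ n => (1 / 2 : ℝ) ^ n) hTs
      (fun k _ => summable_geometric_two) fun k _ => ?_
    rw [Nat.cofinite_eq_atTop]
    -- Differentiating `k` times through the dilation costs at most `l n ^ ((∑ i, w i) * k)`. Beyond
    -- this threshold that is at most `l n ^ (n - 1)`, and `k ≤ n` makes the bound `M n` available.
    filter_upwards [eventually_ge_atTop (k + (∑ i, w i) * k + 1)] with n hn u
    have e1 : T n = (l n ^ n)⁻¹ • (g n ∘ dil w (l n)) := rfl
    have hcomp : ContDiff ℝ k (g n ∘ dil w (l n)) :=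
      ((hg n).comp (dil w (l n)).contDiff).of_le (by exact_mod_cast le_top)
    rw [e1, iteratedFDeriv_const_smul_apply hcomp.contDiffAt, norm_smul,
      (dil w (l n)).iteratedFDeriv_comp_right (hg n) u (by exact_mod_cast le_top), norm_inv,
      norm_pow, Real.norm_of_nonneg (hl0 n).le]
    have hb : ‖(iteratedFDeriv ℝ k (g n) (dil w (l n) u)).compContinuousLinearMap
        fun _ => dil w (l n)‖ ≤ M n * l n ^ ((∑ i, w i) * k) := by
      refine (ContinuousMultilinearMap.norm_compContinuousLinearMap_le _ _).trans ?_
      rw [Finset.prod_const, Finset.card_univ, Fintype.card_fin, pow_mul]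
      gcongr
      · linarith [hM1 n]
      · exact hMg n k (by omega) _
      · exact norm_dil_le w (hl1 n)
    calc _ ≤ (l n ^ n)⁻¹ * (M n * l n ^ ((∑ i, w i) * k)) := by
          have := hl0 n
          gcongr
      _ ≤ (l n ^ n)⁻¹ * (M n * l n ^ (n - 1)) := by
          have := hl0 n
          have := hM1 n
          gcongr
          · exact hl1 n
          · omega
      _ = M n / l n := by
          have := hl0 n
          obtain ⟨m, rfl⟩ : ∃ m, n = m + 1 := ⟨n - 1, by omega⟩
          rw [Nat.add_sub_cancel, pow_succ]
          field_simp
      _ = (1 / 2) ^ n := hMl n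
  refine ⟨fun u => ∑' n, T n u, hsm, fun K => ?_⟩
  -- The bound holds for every `v`: when `l N * ‖v‖ ≤ 1` it comes from homogeneity of `P N ∘ U`, and
  -- otherwise the uniform bound `M N` is enlarged by a factor at least `1`.
  have htail : ∀ n v, ‖T (n + K) (U v)‖ ≤ (M K + 1) * ‖v‖ ^ K * (1 / 2) ^ n := by
    intro n v
    set N := n + K with hN
    have hlp := hl0 N
    have hsup : ‖g N (U (l N • v))‖ ≤ M N * (l N * ‖v‖) ^ K := by
      have hy : ‖l N • v‖ = l N * ‖v‖ := by rw [norm_smul, Real.norm_of_nonneg hlp.le]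
      rcases le_total (l N * ‖v‖) 1 with h | h
      · refine (hgP _ _).trans ((hMP N _).trans ?_)
        rw [hy]
        have := hM1 N
        refine mul_le_mul_of_nonneg_left ?_ (by linarith)
        exact pow_le_pow_of_le_one (by positivity) h (by omega)
      · have h0 := hMg N 0 (Nat.zero_le _) (U (l N • v))
        rw [norm_iteratedFDeriv_zero] at h0
        refine h0.trans ?_
        have := hM1 N
        exact le_mul_of_one_le_right (by linarith) (one_le_pow₀ h)
    have hT : ‖T N (U v)‖ ≤ M N * ‖v‖ ^ K * (l N ^ K / l N ^ N) := by
      simp only [hTdef]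
      rw [← hUd, norm_mul, norm_inv, norm_pow, Real.norm_of_nonneg hlp.le]
      calc _ ≤ (l N ^ N)⁻¹ * (M N * (l N * ‖v‖) ^ K) := by gcongr
        _ = _ := by rw [mul_pow]; ring
    refine hT.trans ?_
    have hMN := hM1 N
    have hMK := hM1 K
    -- The term of index `K` gains no power of `l` and contributes `M K` to the constant; every
    -- later term gains `1 / l N`, which turns `M N` into `2 ^ (-N)`.
    cases n with
    | zero =>
      have : N = K := by omega
      rw [this, div_self (pow_pos (hl0 K) K).ne']
      simp only [mul_one, pow_zero]
      gcongr
      linarith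
    | succ n =>
      have h1 : l N ^ K / l N ^ N ≤ 1 / l N := by
        rw [div_le_div_iff₀ (by positivity) hlp, one_mul, ← pow_succ]
        exact pow_le_pow_right₀ (hl1 N) (by omega)
      calc M N * ‖v‖ ^ K * (l N ^ K / l N ^ N) ≤ M N * ‖v‖ ^ K * (1 / l N) := by gcongr
        _ = ‖v‖ ^ K * (M N / l N) := by ring
        _ = 1 * ‖v‖ ^ K * (1 / 2) ^ N := by rw [hMl]; ring
        _ ≤ (M K + 1) * ‖v‖ ^ K * (1 / 2) ^ (n + 1) := by
          gcongr ?_ * _ * ?_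
          · linarith
          · exact pow_le_pow_of_le_one (by norm_num) (by norm_num) (by omega)
  have hsumm : ∀ v : E, Summable fun n => (M K + 1) * ‖v‖ ^ K * (1 / 2 : ℝ) ^ n := fun v =>
    summable_geometric_two.mul_left _
  have hsT : ∀ v, Summable fun n => T (n + K) (U v) := fun v =>
    Summable.of_norm_bounded (hsumm v) fun n => htail n v
  have htv : Vanishes K fun v => ∑' n, T (n + K) (U v) := by
    refine IsBigO.of_bound ((M K + 1) * 2) (Eventually.of_forall fun v => ?_)
    have := tsum_of_norm_bounded (hsumm v).hasSum fun n => htail n v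
    rw [tsum_mul_left, tsum_geometric_two] at this
    refine this.trans (le_of_eq ?_)
    rw [norm_pow, norm_norm]
    ring
  -- Each of these finitely many differences is zero on a neighbourhood of the origin, because `U 0
  -- = 0` and the cutoff is `1` there.
  have hhead : Vanishes K fun v => ∑ n ∈ Finset.range K, (T n (U v) - P n (U v)) := by
    refine Vanishes.sum fun n _ => ?_
    have hU0 : U 0 = 0 := by
      have := hUd 0 0
      rw [smul_zero] at this
      rw [this]
      ext i
      rw [dil_apply, zero_pow (by have := hw i; omega), zero_mul]
      rfl
    have hc : Tendsto (fun v => dil w (l n) (U v)) (𝓝 0) (𝓝 0) := by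
      have := ((dil w (l n)).continuous.comp hU.continuous).tendsto 0
      simpa [hU0, Function.comp_def] using this
    have : (fun v => T n (U v) - P n (U v)) =ᶠ[𝓝 0] fun _ => (0 : ℝ) := by
      filter_upwards [hc.eventually χ.eventuallyEq_one] with v hv
      have := (hl0 n).ne'
      simp only [hTdef, hgdef, hv, hPd, Pi.one_apply]
      field_simp
      ring
    exact IsBigO.congr' (vanishes_zero K) this.symm EventuallyEq.rfl
  have key : ∀ v, (∑' n, T n (U v)) - ∑ n ∈ Finset.range K, P n (U v)
      = ∑' n, T (n + K) (U v) + ∑ n ∈ Finset.range K, (T n (U v) - P n (U v)) := fun v => by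
    have h1 : ∑ n ∈ Finset.range K, T n (U v) + ∑' n, T (n + K) (U v) = ∑' n, T n (U v) :=
      Summable.sum_add_tsum_nat_add' (f := fun n => T n (U v)) (hsT v)
    rw [← h1, Finset.sum_sub_distrib]
    ring
  have hfin := htv.add hhead
  clear_value T
  exact IsBigO.congr_left hfin fun v => (key v).symm

end Borel

/-! ### Construction of the conjugacy degree by degree. -/

section Recursion

variable {E F : Type*} [NormedAddCommGroup E] [NormedSpace ℝ E] [CompleteSpace E]
  [NormedAddCommGroup F] [NormedSpace ℝ F]

theorem IsHom.taylorTerm_eq [CompleteSpace F] {n : ℕ} {g : E → F} (hg : IsHom n g) (v : E) :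
    taylorTerm g n v = g v := by
  have h := hg.vanishes.sub_taylorTerm hg.1
  exact (sub_eq_zero.1 ((hg.sub (isHom_taylorTerm g n)).eq_zero_of_vanishes h v)).symm

theorem vanishes_two_sub_fderiv [CompleteSpace F] {g : E → F} (hg : ContDiff ℝ ∞ g)
    (h0 : g 0 = 0) : Vanishes 2 (fun v => g v - fderiv ℝ g 0 v) := by
  refine (vanishes_sub_taylor hg 2).congr_left fun v => ?_
  simp [Finset.sum_range_succ, taylorTerm, h0]

theorem fderiv_eq_zero_of_vanishes {g : E → F} (h : Vanishes 2 g) : fderiv ℝ g 0 = 0 := by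
  have h0 : g 0 = 0 := by
    obtain ⟨C, hC⟩ := h.bound
    simpa using hC.self_of_nhds
  refine HasFDerivAt.fderiv ?_
  rw [hasFDerivAt_iff_isLittleO_nhds_zero]
  have : (fun v : E => ‖v‖ ^ 2) =o[𝓝 0] fun v => v := by
    simpa using (isLittleO_norm_pow_id (E' := E) one_lt_two)
  simpa [h0] using IsBigO.trans_isLittleO h this

theorem vanishes_fderiv_of_vanishes_two {g : E → F} (hg : ContDiff ℝ ∞ g) (h : Vanishes 2 g) :
    Vanishes 1 (fderiv ℝ g) :=
  vanishes_one_of_differentiableAt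
    ((hg.fderiv_right (m := ∞) le_rfl).differentiable (by simp) 0) (fderiv_eq_zero_of_vanishes h)

theorem fderiv_apply_of_equivariant {h : E → E} (hh : Differentiable ℝ h) {κ : E →L[ℝ] E}
    (he : ∀ v, h (κ v) = κ (h v)) (v w : E) :
    fderiv ℝ h (κ v) (κ w) = κ (fderiv ℝ h v w) := by
  have h1 : HasFDerivAt (fun v => h (κ v)) ((fderiv ℝ h (κ v)).comp κ) v :=
    (hh (κ v)).hasFDerivAt.comp v κ.hasFDerivAt
  have h2 : HasFDerivAt (fun v => h (κ v)) (κ.comp (fderiv ℝ h v)) v := by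
    simp only [he]
    exact κ.hasFDerivAt.comp v (hh v).hasFDerivAt
  exact congrArg (fun A : E →L[ℝ] E => A w) (h1.unique h2)

/-- `H` conjugates `X` to `Y` up to terms of order `k + 1`, where `H` is tangent to the identity
and equivariant and `Y` is reversible with linear part `L`. -/
structure ConjUpTo (X : E → E) (L : E →L[ℝ] E) (Γ : Set (E →L[ℝ] E)) (k : ℕ) (H Y : E → E) :
    Prop where
  smoothH : ContDiff ℝ ∞ H
  smoothY : ContDiff ℝ ∞ Y
  tangent : Vanishes 2 (fun v => H v - v)
  linear : Vanishes 2 (fun v => Y v - L v)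
  equivariant : ∀ κ ∈ Γ, ∀ v, H (κ v) = κ (H v)
  reversible : ∀ κ ∈ Γ, ∀ v, Y (κ v) = -κ (Y v)
  conj : Vanishes (k + 1) (fun v => fderiv ℝ H v (X v) - Y (H v))

variable {X : E → E} {L : E →L[ℝ] E} {Γ : Set (E →L[ℝ] E)} {k : ℕ} {H Y : E → E}

/-- `Z` is the Taylor term of degree `k + 1` of the defect. The defect is reversible because `X` and
`Y` are and `H` is equivariant; comparing leading terms passes this on to `Z`. -/
theorem ConjUpTo.isHom_residual (hc : ConjUpTo X L Γ k H Y) (hX : ContDiff ℝ ∞ X)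
    (hXΓ : ∀ κ ∈ Γ, ∀ v, X (κ v) = -κ (X v)) :
    ∃ Z : E → E, IsHom (k + 1) Z ∧ (∀ κ ∈ Γ, ∀ v, Z (κ v) = -κ (Z v)) ∧
      Vanishes (k + 2) (fun v => fderiv ℝ H v (X v) - Y (H v) - Z v) := by
  have hs : ContDiff ℝ ∞ (fun v => fderiv ℝ H v (X v) - Y (H v)) :=
    ((hc.smoothH.fderiv_right (m := ∞) le_rfl).clm_apply hX).sub (hc.smoothY.comp hc.smoothH)
  have hv := hc.conj.sub_taylorTerm hs
  have hZ := isHom_taylorTerm (fun v => fderiv ℝ H v (X v) - Y (H v)) (k + 1)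
  set Z := taylorTerm (fun v => fderiv ℝ H v (X v) - Y (H v)) (k + 1)
  refine ⟨Z, hZ, fun κ hκ v => ?_, hv⟩
  have hd : Differentiable ℝ H := hc.smoothH.differentiable (by simp)
  have h1 : Vanishes (k + 2) (fun v => Z (κ v) + κ (Z v)) := by
    refine (((hv.comp (vanishes_clm κ)).add (hv.clm_comp κ)).neg).congr_left fun v => ?_
    rw [hXΓ κ hκ, map_neg, fderiv_apply_of_equivariant hd (hc.equivariant κ hκ),
      hc.equivariant κ hκ, hc.reversible κ hκ, map_sub, map_sub]
    abel
  exact eq_neg_of_add_eq_zero_left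
    (((hZ.comp_clm κ).add (hZ.clm_comp κ)).eq_zero_of_vanishes h1 v)

/-- Modulo order `k + 2`, replacing `H` by `H + h` adds `Dh·L` to `DH·X` and `L∘h` to `Y∘H`, so the
new defect has leading term `Z + Dh·L - L∘h = D`, which is cancelled by adding `D` to `Y`. -/
theorem ConjUpTo.step (hc : ConjUpTo X L Γ k H Y) (hk : 1 ≤ k)
    (hXL : Vanishes 2 (fun v => X v - L v)) (hLΓ : ∀ κ ∈ Γ, ∀ v, L (κ v) = -κ (L v))
    {Z h D : E → E} (hZΓ : ∀ κ ∈ Γ, ∀ v, Z (κ v) = -κ (Z v))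
    (hZ : IsHom (k + 1) Z)
    (hZv : Vanishes (k + 2) (fun v => fderiv ℝ H v (X v) - Y (H v) - Z v))
    (hh : IsHom (k + 1) h) (hhΓ : ∀ κ ∈ Γ, ∀ v, h (κ v) = κ (h v))
    (hD : ∀ v, Z v + fderiv ℝ h v (L v) - L (h v) = D v) :
    ConjUpTo X L Γ (k + 1) (fun v => H v + h v) (fun v => Y v + D v) := by
  have hdH : Differentiable ℝ H := hc.smoothH.differentiable (by simp)
  have hdh : Differentiable ℝ h := hh.1.differentiable (by simp)
  have hDh : IsHom (k + 1) D := by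
    have := (hZ.add (hh.fderiv_apply (j := 0) (isHom_clm L))).sub (hh.clm_comp L)
    rwa [show D = _ from funext fun v => (hD v).symm]
  have hH1 : Vanishes 1 H := by
    refine ((hc.tangent.mono one_le_two).add vanishes_id).congr_left fun v => ?_
    abel
  have hh1 : Vanishes 1 h := hh.vanishes.mono (by omega)
  refine ⟨hc.smoothH.add hh.1, hc.smoothY.add hDh.1, ?_, ?_, ?_, ?_, ?_⟩
  · refine (hc.tangent.add (hh.vanishes.mono (by omega))).congr_left fun v => ?_
    abel
  · refine (hc.linear.add (hDh.vanishes.mono (by omega))).congr_left fun v => ?_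
    abel
  · intro κ hκ v
    rw [hc.equivariant κ hκ, hhΓ κ hκ, map_add]
  · intro κ hκ v
    rw [hc.reversible κ hκ, ← hD, ← hD, hZΓ κ hκ, hhΓ κ hκ, hLΓ κ hκ, hLΓ κ hκ, map_neg,
      fderiv_apply_of_equivariant hdh (hhΓ κ hκ)]
    simp only [map_add, map_sub]
    abel
  -- Three errors are negligible: `L` in place of `X` inside `Dh`, the nonlinear part of `Y` at the
  -- shifted argument, and `D` evaluated at `v` instead of at the new `H v`.
  · have e1 : Vanishes (k + 2) (fun v => fderiv ℝ h v (X v - L v)) :=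
      (hh.vanishes_fderiv).clm_apply hXL
    have hYL : ContDiff ℝ ∞ (fun v => Y v - L v) := hc.smoothY.sub L.contDiff
    have e2 : Vanishes (k + 2) (fun v =>
        (Y (H v + h v) - L (H v + h v)) - (Y (H v) - L (H v))) := by
      have := Vanishes.sub_comp (g := fun v => Y v - L v) (m := k + 1)
        (hYL.differentiable (by simp))
        (vanishes_fderiv_of_vanishes_two hYL hc.linear) (hH1.add hh1) hH1
        (hh.vanishes.congr_left fun v => by abel)
      exact this.mono (by omega)
    have e3 : Vanishes (k + 2) (fun v => D (H v + h v) - D v) :=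
      Vanishes.sub_comp (hDh.1.differentiable (by simp)) hDh.vanishes_fderiv
        (hH1.add hh1) vanishes_id
        ((hc.tangent.add (hh.vanishes.mono (by omega : 2 ≤ k + 1))).congr_left fun v => by abel)
    refine (((hZv.add e1).sub e2).sub e3).congr_left fun v => ?_
    rw [fderiv_fun_add (hdH v) (hdh v), add_apply, ← hD v]
    simp only [map_sub, map_add]
    abel

variable {ι κ : Type*} [Fintype ι] [Fintype κ]

/-- A coefficient `P` such that `P ∘ U • G` is homogeneous of degree `k`, for `G` homogeneous of
degree `d` and `U` quasi-homogeneous with weights `w`. -/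
def IsCoeff (w : κ → ℕ) (d k : ℕ) (P : (κ → ℝ) → ℝ) : Prop :=
  ContDiff ℝ ∞ P ∧ ∀ (t : ℝ) u, t ^ d * P (dil w t u) = t ^ k * P u

theorem isCoeff_zero (w : κ → ℕ) (d k : ℕ) : IsCoeff w d k (fun _ => 0) :=
  ⟨contDiff_const, fun t u => by simp⟩

theorem continuous_dil_apply (w : κ → ℕ) (u : κ → ℝ) : Continuous fun t => dil w t u := by
  refine continuous_pi fun i => ?_
  simp only [dil_apply]
  fun_prop

/-- The factor `t ^ d` cancels for `t ≠ 0`, and continuity in `t` extends the identity to `t = 0`.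
-/
theorem IsCoeff.map_dil {w : κ → ℕ} {d n : ℕ} {P : (κ → ℝ) → ℝ} (hP : IsCoeff w d (n + d) P)
    (t : ℝ) (u : κ → ℝ) : P (dil w t u) = t ^ n * P u := by
  have hd : Dense ({0}ᶜ : Set ℝ) := dense_compl_singleton 0
  have hc := hP.1.continuous
  have hcd := continuous_dil_apply w u
  refine congrFun (Continuous.ext_on (f := fun t => P (dil w t u)) (g := fun t => t ^ n * P u) hd
    (hc.comp hcd) (by fun_prop) fun s hs => ?_) t
  have h1 := hP.2 s u
  rw [pow_add, mul_comm (s ^ n), mul_assoc] at h1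
  exact mul_left_cancel₀ (pow_ne_zero d hs) h1

/-- A coefficient of negative degree: `t ^ (d - k) * P (dil w t u) = P u` for `t ≠ 0`, hence by
continuity also at `t = 0`, where the left side is zero. -/
theorem IsCoeff.eq_zero {w : κ → ℕ} {d k : ℕ} {P : (κ → ℝ) → ℝ} (hP : IsCoeff w d k P)
    (hk : k < d) (u : κ → ℝ) : P u = 0 := by
  obtain ⟨m, rfl⟩ : ∃ m, d = k + (m + 1) := ⟨d - k - 1, by omega⟩
  have hd : Dense ({0}ᶜ : Set ℝ) := dense_compl_singleton 0
  have hc := hP.1.continuous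
  have hcd := continuous_dil_apply w u
  have := congrFun (Continuous.ext_on (f := fun t => t ^ (m + 1) * P (dil w t u))
    (g := fun t => P u) hd ((continuous_pow _).mul (hc.comp hcd)) continuous_const fun s hs => ?_) 0
  · simpa using this.symm
  · have h1 := hP.2 s u
    rw [pow_add, mul_assoc] at h1
    exact mul_left_cancel₀ (pow_ne_zero k hs) h1

/-- Summation of a formal sum of coefficients. -/
theorem exists_contDiff_of_coeff {w : κ → ℕ} {U : E → κ → ℝ} (hU : ContDiff ℝ ∞ U)
    (hw : ∀ i, 1 ≤ w i) (hUd : ∀ (t : ℝ) v, U (t • v) = dil w t (U v)) {d : ℕ}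
    {P : ℕ → (κ → ℝ) → ℝ} (hP : ∀ n, IsCoeff w d n (P n)) :
    ∃ f : (κ → ℝ) → ℝ, ContDiff ℝ ∞ f ∧ ∀ K (G : E → F), IsHom d G →
      Vanishes K (fun v => (f (U v) - ∑ n ∈ Finset.range K, P n (U v)) • G v) := by
  -- The index is shifted by the degree `d` of the generator; the omitted `P n` with `n < d` vanish
  -- by `IsCoeff.eq_zero`.
  obtain ⟨f, hf, hfv⟩ := exists_contDiff_of_expansion w hU hw hUd (fun n => P (n + d))
    (fun n => (hP _).1) (fun n => (hP _).map_dil)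
  refine ⟨f, hf, fun K G hG => ?_⟩
  have h1 := ((hfv (K - d)).smul hG.vanishes).mono (by omega : K ≤ K - d + d)
  refine h1.congr_left fun v => ?_
  have : ∑ n ∈ Finset.range K, P n (U v) = ∑ n ∈ Finset.range (K - d), P (n + d) (U v) := by
    rcases le_total d K with h | h
    · obtain ⟨m, rfl⟩ := Nat.exists_eq_add_of_le h
      rw [Finset.sum_range_add, Finset.sum_eq_zero fun n hn =>
        (hP n).eq_zero (Finset.mem_range.1 hn) _, zero_add, Nat.add_sub_cancel_left]
      exact Finset.sum_congr rfl fun n _ => by rw [add_comm]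
    · rw [Nat.sub_eq_zero_of_le h, Finset.sum_eq_zero fun n hn =>
        (hP n).eq_zero ((Finset.mem_range.1 hn).trans_le h) _, Finset.sum_range_zero]
  rw [this]

/-- The homological equation is solvable in all degrees `≥ 2`, with remainder
`∑ i, P i (U v) • G i v`. -/
def Solvable (L : E →L[ℝ] E) (Γ : Set (E →L[ℝ] E)) (w : κ → ℕ) (U : E → κ → ℝ) (G : ι → E → E)
    (d : ι → ℕ) : Prop :=
  ∀ k, 2 ≤ k → ∀ Z : E → E, IsHom k Z → (∀ κ ∈ Γ, ∀ v, Z (κ v) = -κ (Z v)) →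
    ∃ (h : E → E) (P : ι → (κ → ℝ) → ℝ), IsHom k h ∧ (∀ κ ∈ Γ, ∀ v, h (κ v) = κ (h v)) ∧
      (∀ i, IsCoeff w (d i) k (P i)) ∧
      ∀ v, Z v + fderiv ℝ h v (L v) - L (h v) = ∑ i, P i (U v) • G i v

/-- Iterates `ConjUpTo.step` from the pair `(id, L)`. One sequence of corrections serves all orders:
later steps never alter lower degrees. -/
theorem exists_conjUpTo_sequence {w : κ → ℕ} {U : E → κ → ℝ} {G : ι → E → E} {d : ι → ℕ}
    (hLΓ : ∀ κ ∈ Γ, ∀ v, L (κ v) = -κ (L v)) (hsolve : Solvable L Γ w U G d)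
    (hX : ContDiff ℝ ∞ X) (hXL : Vanishes 2 (fun v => X v - L v))
    (hXΓ : ∀ κ ∈ Γ, ∀ v, X (κ v) = -κ (X v)) :
    ∃ (h : ℕ → E → E) (P : ℕ → ι → (κ → ℝ) → ℝ), (∀ n, IsHom n (h n)) ∧ (∀ v, h 0 v = 0) ∧
      (∀ v, h 1 v = v) ∧ (∀ n i, IsCoeff w (d i) n (P n i)) ∧
      ∀ n, ConjUpTo X L Γ (n + 1) (fun v => ∑ j ∈ Finset.range (n + 2), h j v)
        (fun v => L v + ∑ i, (∑ j ∈ Finset.range (n + 2), P j i (U v)) • G i v) := by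
  have base : ConjUpTo X L Γ 1 (fun v => v) L := by
    refine ⟨contDiff_id, L.contDiff, ?_, ?_, fun _ _ _ => rfl, hLΓ, ?_⟩
    · simpa using vanishes_zero (E := E) (F := E) 2
    · simpa using vanishes_zero (E := E) (F := E) 2
    · simpa using hXL
  have next : ∀ (n : ℕ) (s : {p : (E → E) × (E → E) // ConjUpTo X L Γ (n + 1) p.1 p.2}),
      ∃ (s' : {p : (E → E) × (E → E) // ConjUpTo X L Γ (n + 2) p.1 p.2}) (h : E → E)
        (P : ι → (κ → ℝ) → ℝ), IsHom (n + 2) h ∧ (∀ i, IsCoeff w (d i) (n + 2) (P i)) ∧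
        (∀ v, s'.1.1 v = s.1.1 v + h v) ∧ ∀ v, s'.1.2 v = s.1.2 v + ∑ i, P i (U v) • G i v := by
    rintro n ⟨⟨H, Y⟩, hc⟩
    obtain ⟨Z, hZ, hZΓ, hZv⟩ := hc.isHom_residual hX hXΓ
    obtain ⟨h, P, hh, hhΓ, hP, hD⟩ := hsolve (n + 2) (by omega) Z hZ hZΓ
    exact ⟨⟨⟨_, _⟩, hc.step (by omega) hXL hLΓ hZΓ hZ hZv hh hhΓ hD⟩, h, P, hh, hP,
      fun v => rfl, fun v => rfl⟩
  choose nx h P hh hP hH hY using next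
  let s : ∀ n : ℕ, {p : (E → E) × (E → E) // ConjUpTo X L Γ (n + 1) p.1 p.2} := fun n =>
    Nat.rec ⟨⟨_, _⟩, base⟩ (fun n s => nx n s) n
  -- Degrees `0` and `1` encode the identity; genuine corrections start in degree `2`.
  let h' : ℕ → E → E
    | 0 => fun _ => 0
    | 1 => fun v => v
    | n + 2 => h n (s n)
  let P' : ℕ → ι → (κ → ℝ) → ℝ
    | 0 => fun _ _ => 0
    | 1 => fun _ _ => 0
    | n + 2 => P n (s n)
  have hs1 : ∀ n, (s n).1.1 = fun v => ∑ j ∈ Finset.range (n + 2), h' j v := by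
    intro n
    induction n with
    | zero => funext v; simp [Finset.sum_range_succ, h', s]
    | succ n ih =>
      funext v
      rw [Finset.sum_range_succ, ← congrFun ih v]
      exact hH n (s n) v
  have hs2 : ∀ n, (s n).1.2 = fun v =>
      L v + ∑ i, (∑ j ∈ Finset.range (n + 2), P' j i (U v)) • G i v := by
    intro n
    induction n with
    | zero => funext v; simp [Finset.sum_range_succ, P', s]
    | succ n ih =>
      funext v
      have h1 : ∀ i, (∑ j ∈ Finset.range (n + 1 + 2), P' j i (U v)) • G i v
          = (∑ j ∈ Finset.range (n + 2), P' j i (U v)) • G i v + P n (s n) i (U v) • G i v := by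
        intro i
        rw [Finset.sum_range_succ, add_smul]
      simp only [h1, Finset.sum_add_distrib]
      rw [← add_assoc, ← congrFun ih v]
      exact hY n (s n) v
  refine ⟨h', P', ?_, fun _ => rfl, fun _ => rfl, ?_, fun n => ?_⟩
  · rintro (_ | _ | n)
    · exact isHom_zero 0
    · exact isHom_clm (ContinuousLinearMap.id ℝ E)
    · exact hh n (s n)
  · rintro (_ | _ | n) i
    · exact isCoeff_zero _ _ _
    · exact isCoeff_zero _ _ _
    · exact hP n (s n) i
  · have := (s n).2
    rwa [hs1, hs2] at this

/-- **Formal normal form theorem.** -/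
theorem exists_formallyConjugate {w : κ → ℕ} {U : E → κ → ℝ} {G : ι → E → E} {d : ι → ℕ}
    (hU : ContDiff ℝ ∞ U) (hw : ∀ i, 1 ≤ w i) (hUd : ∀ (t : ℝ) v, U (t • v) = dil w t (U v))
    (hG : ∀ i, IsHom (d i) (G i))
    (hLΓ : ∀ κ ∈ Γ, ∀ v, L (κ v) = -κ (L v)) (hsolve : Solvable L Γ w U G d)
    (hX : ContDiff ℝ ∞ X) (hX0 : X 0 = 0) (hXL : fderiv ℝ X 0 = L)
    (hXΓ : ∀ κ ∈ Γ, ∀ v, X (κ v) = -κ (X v)) :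
    ∃ f : ι → (κ → ℝ) → ℝ, (∀ i, ContDiff ℝ ∞ (f i)) ∧
      FormallyConjugate X (fun v => L v + ∑ i, f i (U v) • G i v) := by
  obtain ⟨h, P, hh, hh0, hh1, hP, hc⟩ := exists_conjUpTo_sequence hLΓ hsolve hX
    (hXL ▸ vanishes_two_sub_fderiv hX hX0) hXΓ
  choose f hf hfv using fun i => exists_contDiff_of_coeff (F := E) hU hw hUd (fun n => hP n i)
  -- A smooth homogeneous map equals its own Taylor term of that degree, so this series has `h n` as
  -- its homogeneous terms.
  let H : FormalMultilinearSeries ℝ E E := fun n => taylorAtZero (h n) n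
  have hH : ∀ n, homTerm H n = h n := fun n => funext fun v => (hh n).taylorTerm_eq v
  refine ⟨f, hf, H, fun v => by rw [hH, hh0], fun v => by rw [hH, hh1], fun k v => ?_⟩
  have hY : ContDiff ℝ ∞ (fun v => L v + ∑ i, f i (U v) • G i v) :=
    L.contDiff.add (ContDiff.sum fun i _ => ((hf i).comp hU).smul (hG i).1)
  refine formal_eq_of_vanishes hX hX0 hY H (fun v => by rw [hH, hh0]) k ?_ v
  simp only [hH]
  have hHv : Vanishes 1 (fun v => ∑ i ∈ Finset.range (k + 2), h i v) := by
    refine (((hc k).tangent.mono one_le_two).add vanishes_id).congr_left fun v => ?_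
    abel
  have h2 : Vanishes (k + 2) (fun v =>
      ∑ i, (f i (U v) - ∑ n ∈ Finset.range (k + 2), P n i (U v)) • G i v) :=
    Vanishes.sum fun i _ => hfv i (k + 2) (G i) (hG i)
  -- The truncated coefficients are exchanged for their Borel sums; the error, of order `k + 2`, is
  -- evaluated at the truncated conjugacy.
  have h3 := ((hc k).conj.sub (h2.comp hHv)).mono (Nat.le_succ (k + 1))
  refine h3.congr_left fun v => ?_
  simp only [sub_smul, Finset.sum_sub_distrib]
  abel

end Recursion

/-! ### Derivation along a linear vector field. -/

section LieDerivative

variable {E F G : Type*} [NormedAddCommGroup E] [NormedSpace ℝ E]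
  [NormedAddCommGroup F] [NormedSpace ℝ F] [NormedAddCommGroup G] [NormedSpace ℝ G]
  {L : E →L[ℝ] E}

/-- `f'` is the derivative of the smooth map `f` along the linear vector field `L`. -/
def HasLie (L : E →L[ℝ] E) (f f' : E → F) : Prop :=
  ContDiff ℝ ∞ f ∧ ∀ v, fderiv ℝ f v (L v) = f' v

theorem HasLie.differentiable {f f' : E → F} (hf : HasLie L f f') : Differentiable ℝ f :=
  hf.1.differentiable (by simp)

theorem hasLie_of_contDiff {f : E → F} (hf : ContDiff ℝ ∞ f) :
    HasLie L f (fun v => fderiv ℝ f v (L v)) := ⟨hf, fun _ => rfl⟩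

theorem HasLie.add {f f' g g' : E → F} (hf : HasLie L f f') (hg : HasLie L g g') :
    HasLie L (fun v => f v + g v) (fun v => f' v + g' v) :=
  ⟨hf.1.add hg.1, fun v => by
    rw [fderiv_fun_add (hf.differentiable v) (hg.differentiable v), add_apply, hf.2, hg.2]⟩

theorem HasLie.sub {f f' g g' : E → F} (hf : HasLie L f f') (hg : HasLie L g g') :
    HasLie L (fun v => f v - g v) (fun v => f' v - g' v) :=
  ⟨hf.1.sub hg.1, fun v => by
    rw [fderiv_fun_sub (hf.differentiable v) (hg.differentiable v), sub_apply, hf.2, hg.2]⟩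

theorem HasLie.clm_comp {f f' : E → F} (A : F →L[ℝ] G) (hf : HasLie L f f') :
    HasLie L (fun v => A (f v)) (fun v => A (f' v)) :=
  ⟨A.contDiff.comp hf.1, fun v => by
    have := (A.hasFDerivAt.comp v (hf.differentiable v).hasFDerivAt).fderiv
    simp only [Function.comp_def] at this
    rw [this, ContinuousLinearMap.comp_apply, hf.2]⟩

theorem hasLie_clm (A : E →L[ℝ] F) : HasLie L (fun v => A v) (fun v => A (L v)) :=
  ⟨A.contDiff, fun v => by rw [A.fderiv]⟩

theorem HasLie.mul {f f' g g' : E → ℂ} (hf : HasLie L f f') (hg : HasLie L g g') :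
    HasLie L (fun v => f v * g v) (fun v => f' v * g v + f v * g' v) :=
  ⟨hf.1.mul hg.1, fun v => by
    rw [fderiv_fun_mul (hf.differentiable v) (hg.differentiable v), add_apply, smul_apply,
      smul_apply, hf.2, hg.2, smul_eq_mul, smul_eq_mul]
    ring⟩

theorem HasLie.const_mul {f f' : E → ℂ} (c : ℂ) (hf : HasLie L f f') :
    HasLie L (fun v => c * f v) (fun v => c * f' v) :=
  hf.clm_comp ((ContinuousLinearMap.mul ℝ ℂ) c)

theorem hasLie_zero : HasLie L (fun _ : E => (0 : F)) (fun _ => 0) :=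
  ⟨contDiff_const, fun v => by simp⟩

theorem HasLie.congr_deriv {f f' f'' : E → F} (hf : HasLie L f f') (h : ∀ v, f' v = f'' v) :
    HasLie L f f'' := ⟨hf.1, fun v => (hf.2 v).trans (h v)⟩

theorem HasLie.pow {f f' : E → ℂ} (hf : HasLie L f f') (n : ℕ) :
    HasLie L (fun v => f v ^ n) (fun v => n * f v ^ (n - 1) * f' v) := by
  induction n with
  | zero =>
    simp only [pow_zero, Nat.cast_zero, zero_mul]
    exact ⟨contDiff_const, fun v => by simp⟩
  | succ n ih =>
    simp only [pow_succ]
    refine (ih.mul hf).congr_deriv fun v => ?_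
    cases n with
    | zero => simp
    | succ n => simp; ring

/-- Eigenvalues of a derivation add under products. This and `HasLie.eigen_mul` yield the frequency
of a monomial. -/
theorem HasLie.eigen_pow {f : E → ℂ} {c : ℂ} (hf : HasLie L f (fun v => c * f v)) (n : ℕ) :
    HasLie L (fun v => f v ^ n) (fun v => n * c * f v ^ n) := by
  refine (hf.pow n).congr_deriv fun v => ?_
  cases n with
  | zero => simp
  | succ n => simp only [Nat.add_sub_cancel]; ring

theorem HasLie.eigen_mul {f g : E → ℂ} {c d : ℂ} (hf : HasLie L f (fun v => c * f v))
    (hg : HasLie L g (fun v => d * g v)) :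
    HasLie L (fun v => f v * g v) (fun v => (c + d) * (f v * g v)) :=
  (hf.mul hg).congr_deriv fun v => by ring

theorem HasLie.isHom {k : ℕ} {f f' : E → F} (hf : HasLie L f f') (h : IsHom k f) :
    IsHom k f' := by
  have := h.fderiv_apply (j := 0) (isHom_clm L)
  rwa [show f' = _ from funext fun v => (hf.2 v).symm]

end LieDerivative

/-! ### Smooth homogeneous functions as polynomials in `x`, `z` and conjugates. -/

section Monomials

/-- The linear part as a continuous linear map. -/
noncomputable def linCLM (ω₁ ω₂ ω₃ : ℝ) : Phase →L[ℝ] Phase :=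
  LinearMap.toContinuousLinearMap
    { toFun := linearPart ω₁ ω₂ ω₃
      map_add' := fun u v => by
        simp only [linearPart, Prod.mk_add_mk, mul_add, add_zero]
      map_smul' := fun t v => by
        simp only [linearPart, Prod.smul_fst, Prod.smul_snd, Prod.smul_mk, smul_eq_mul,
          Complex.real_smul, RingHom.id_apply, mul_zero, Prod.mk.injEq, true_and]
        refine ⟨?_, ?_, ?_⟩ <;> ring }

theorem linCLM_apply (ω₁ ω₂ ω₃ : ℝ) (v : Phase) : linCLM ω₁ ω₂ ω₃ v =
    (v.2.1, 0, -Complex.I * ω₁ * v.2.2.1, -Complex.I * ω₂ * v.2.2.2.1,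
      -Complex.I * ω₃ * v.2.2.2.2) := rfl

/-- The monomial in `z` and its conjugate. -/
noncomputable def zmon (p q : Fin 3 → ℕ) (v : Phase) : ℂ :=
  (v.2.2.1 ^ p 0 * star v.2.2.1 ^ q 0) * (v.2.2.2.1 ^ p 1 * star v.2.2.2.1 ^ q 1)
    * (v.2.2.2.2 ^ p 2 * star v.2.2.2.2 ^ q 2)

/-- The general monomial on the phase space. -/
noncomputable def mono (a b : ℕ) (p q : Fin 3 → ℕ) (v : Phase) : ℂ :=
  (v.1 : ℂ) ^ a * (v.2.1 : ℂ) ^ b * zmon p q v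

/-- The degree of `zmon p q`. -/
def zdeg (p q : Fin 3 → ℕ) : ℕ := p 0 + q 0 + (p 1 + q 1) + (p 2 + q 2)

/-- Complex polynomial functions that are homogeneous of degree `k`. -/
noncomputable def Polys (k : ℕ) : Submodule ℂ (Phase → ℂ) :=
  Submodule.span ℂ {g | ∃ a b p q, a + b + zdeg p q = k ∧ g = mono a b p q}

theorem mono_mem_polys {a b k : ℕ} {p q : Fin 3 → ℕ} (h : a + b + zdeg p q = k) :
    mono a b p q ∈ Polys k := Submodule.subset_span ⟨a, b, p, q, h, rfl⟩

theorem mul_mem_polys {m n : ℕ} {f g : Phase → ℂ} (hf : f ∈ Polys m) (hg : g ∈ Polys n) :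
    f * g ∈ Polys (m + n) := by
  have h : Polys m * Polys n ≤ Polys (m + n) := by
    unfold Polys
    rw [Submodule.span_mul_span]
    refine Submodule.span_mono ?_
    rintro _ ⟨_, ⟨a, b, p, q, h, rfl⟩, _, ⟨a', b', p', q', h', rfl⟩, rfl⟩
    refine ⟨a + a', b + b', p + p', q + q', ?_, ?_⟩
    · simp only [zdeg, Pi.add_apply] at *
      omega
    · funext v
      simp only [Pi.mul_apply, mono, zmon, Pi.add_apply, pow_add]
      ring
  exact h (Submodule.mul_mem_mul hf hg)

theorem isHom_const_mul {E : Type*} [NormedAddCommGroup E] [NormedSpace ℝ E] {k : ℕ} {g : E → ℂ}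
    (c : ℂ) (hg : IsHom k g) : IsHom k (fun v => c * g v) :=
  hg.clm_comp ((ContinuousLinearMap.mul ℝ ℂ) c)

theorem isHom_mono (a b : ℕ) (p q : Fin 3 → ℕ) : IsHom (a + b + zdeg p q) (mono a b p q) := by
  constructor
  · have h : ∀ {f : Phase → ℂ}, ContDiff ℝ ∞ f → ContDiff ℝ ∞ fun v => star (f v) :=
      fun hf => Complex.conjCLE.contDiff.comp hf
    have h1 : ContDiff ℝ ∞ fun v : Phase => (v.1 : ℂ) :=
      Complex.ofRealCLM.contDiff.comp contDiff_fst
    have h2 : ContDiff ℝ ∞ fun v : Phase => (v.2.1 : ℂ) :=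
      Complex.ofRealCLM.contDiff.comp contDiff_snd.fst
    have h3 : ContDiff ℝ ∞ fun v : Phase => v.2.2.1 := contDiff_snd.snd.fst
    have h4 : ContDiff ℝ ∞ fun v : Phase => v.2.2.2.1 := contDiff_snd.snd.snd.fst
    have h5 : ContDiff ℝ ∞ fun v : Phase => v.2.2.2.2 := contDiff_snd.snd.snd.snd
    exact ((h1.pow a).mul (h2.pow b)).mul ((((h3.pow _).mul ((h h3).pow _)).mul
      ((h4.pow _).mul ((h h4).pow _))).mul ((h5.pow _).mul ((h h5).pow _)))
  · intro t v
    simp only [mono, zmon, zdeg, Prod.smul_fst, Prod.smul_snd, smul_eq_mul, Complex.real_smul,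
      star_mul', Complex.ofReal_mul, mul_pow, pow_add, Complex.ofReal_pow]
    simp only [Complex.star_def, Complex.conj_ofReal]
    ring

theorem isHom_of_mem_polys {k : ℕ} {g : Phase → ℂ} (hg : g ∈ Polys k) : IsHom k g := by
  refine Submodule.span_induction ?_ (isHom_zero k) (fun f g _ _ hf hg => hf.add hg)
    (fun c f _ hf => isHom_const_mul c hf) hg
  rintro _ ⟨a, b, p, q, rfl, rfl⟩
  exact isHom_mono a b p q

/-- Real coordinates on the phase space. -/
noncomputable def rcoord (v : Phase) : Fin 8 → ℝ :=
  ![v.1, v.2.1, v.2.2.1.re, v.2.2.1.im, v.2.2.2.1.re, v.2.2.2.1.im, v.2.2.2.2.re, v.2.2.2.2.im]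

/-- The real basis of the phase space. -/
noncomputable def rbasis : Fin 8 → Phase :=
  ![(1, 0, 0, 0, 0), (0, 1, 0, 0, 0), (0, 0, 1, 0, 0), (0, 0, Complex.I, 0, 0),
    (0, 0, 0, 1, 0), (0, 0, 0, Complex.I, 0), (0, 0, 0, 0, 1), (0, 0, 0, 0, Complex.I)]

theorem sum_rcoord (v : Phase) : ∑ i, rcoord v i • rbasis i = v := by
  obtain ⟨x, y, z₁, z₂, z₃⟩ := v
  simp [Fin.sum_univ_eight, rcoord, rbasis, Complex.re_add_im]

theorem rcoord_mem_polys (i : Fin 8) : (fun v => (rcoord v i : ℂ)) ∈ Polys 1 := by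
  have hre : ∀ (f : Phase → ℂ), f ∈ Polys 1 → (fun v => star (f v)) ∈ Polys 1 →
      (fun v => ((f v).re : ℂ)) ∈ Polys 1 := by
    intro f h1 h2
    have := (Polys 1).smul_mem (1 / 2 : ℂ) ((Polys 1).add_mem h1 h2)
    convert this using 1
    funext v
    simp only [Pi.smul_apply, Pi.add_apply, smul_eq_mul, Complex.star_def, Complex.add_conj]
    push_cast
    ring
  have him : ∀ (f : Phase → ℂ), f ∈ Polys 1 → (fun v => star (f v)) ∈ Polys 1 →
      (fun v => ((f v).im : ℂ)) ∈ Polys 1 := by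
    intro f h1 h2
    have := (Polys 1).smul_mem (-Complex.I / 2 : ℂ) ((Polys 1).sub_mem h1 h2)
    convert this using 1
    funext v
    simp only [Pi.smul_apply, Pi.sub_apply, smul_eq_mul, Complex.star_def, Complex.sub_conj]
    push_cast
    linear_combination ((f v).im : ℂ) * Complex.I_sq
  have hx1 : (fun v : Phase => (v.1 : ℂ)) ∈ Polys 1 := by
    convert mono_mem_polys (k := 1) (a := 1) (b := 0) (p := 0) (q := 0) (by simp [zdeg]) using 1
    funext v; simp [mono, zmon]
  have hx2 : (fun v : Phase => (v.2.1 : ℂ)) ∈ Polys 1 := by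
    convert mono_mem_polys (k := 1) (a := 0) (b := 1) (p := 0) (q := 0) (by simp [zdeg]) using 1
    funext v; simp [mono, zmon]
  have hz1 : (fun v : Phase => v.2.2.1) ∈ Polys 1 := by
    convert mono_mem_polys (k := 1) (a := 0) (b := 0) (p := ![1, 0, 0]) (q := 0)
      (by simp [zdeg]) using 1
    funext v; simp [mono, zmon]
  have hz1' : (fun v : Phase => star v.2.2.1) ∈ Polys 1 := by
    convert mono_mem_polys (k := 1) (a := 0) (b := 0) (q := ![1, 0, 0]) (p := 0)
      (by simp [zdeg]) using 1
    funext v; simp [mono, zmon]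
  have hz2 : (fun v : Phase => v.2.2.2.1) ∈ Polys 1 := by
    convert mono_mem_polys (k := 1) (a := 0) (b := 0) (p := ![0, 1, 0]) (q := 0)
      (by simp [zdeg]) using 1
    funext v; simp [mono, zmon]
  have hz2' : (fun v : Phase => star v.2.2.2.1) ∈ Polys 1 := by
    convert mono_mem_polys (k := 1) (a := 0) (b := 0) (q := ![0, 1, 0]) (p := 0)
      (by simp [zdeg]) using 1
    funext v; simp [mono, zmon]
  have hz3 : (fun v : Phase => v.2.2.2.2) ∈ Polys 1 := by
    convert mono_mem_polys (k := 1) (a := 0) (b := 0) (p := ![0, 0, 1]) (q := 0)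
      (by simp [zdeg]) using 1
    funext v; simp [mono, zmon]
  have hz3' : (fun v : Phase => star v.2.2.2.2) ∈ Polys 1 := by
    convert mono_mem_polys (k := 1) (a := 0) (b := 0) (q := ![0, 0, 1]) (p := 0)
      (by simp [zdeg]) using 1
    funext v; simp [mono, zmon]
  fin_cases i
  exacts [hx1, hx2, hre _ hz1 hz1', him _ hz1 hz1', hre _ hz2 hz2', him _ hz2 hz2',
    hre _ hz3 hz3', him _ hz3 hz3']

theorem one_mem_polys : (1 : Phase → ℂ) ∈ Polys 0 := by
  convert mono_mem_polys (k := 0) (a := 0) (b := 0) (p := 0) (q := 0) (by simp [zdeg]) using 1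
  funext v; simp [mono, zmon]

theorem prod_rcoord_mem_polys {k : ℕ} (s : Fin k → Fin 8) :
    (∏ i, fun v => (rcoord v (s i) : ℂ)) ∈ Polys k := by
  induction k with
  | zero => simpa using one_mem_polys
  | succ k ih =>
    rw [Fin.prod_univ_castSucc]
    exact mul_mem_polys (ih _) (rcoord_mem_polys _)

/-- The function equals its Taylor term of degree `k`; multilinear expansion in a real basis makes
that a polynomial in the real coordinates, which are complex combinations of the `x`, the `z` and
their conjugates. -/
theorem mem_polys_of_isHom {k : ℕ} {g : Phase → ℂ} (hg : IsHom k g) : g ∈ Polys k := by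
  have h : g = ∑ s : Fin k → Fin 8,
      ((k ! : ℝ)⁻¹ • iteratedFDeriv ℝ k g 0 fun i => rbasis (s i)) •
        ∏ i, fun v => (rcoord v (s i) : ℂ) := by
    funext v
    rw [← hg.taylorTerm_eq v, taylorTerm]
    conv_lhs => rw [show (fun _ : Fin k => v) = fun _ => ∑ i, rcoord v i • rbasis i from
      funext fun _ => (sum_rcoord v).symm]
    rw [ContinuousMultilinearMap.map_sum, Finset.smul_sum, Finset.sum_apply]
    refine Finset.sum_congr rfl fun s _ => ?_
    rw [ContinuousMultilinearMap.map_smul_univ]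
    simp only [Pi.smul_apply, Finset.prod_apply, smul_eq_mul, Complex.real_smul,
      Complex.ofReal_prod]
    ring
  rw [h]
  exact Submodule.sum_mem _ fun s _ => Submodule.smul_mem _ _ (prod_rcoord_mem_polys s)

end Monomials

/-! ### The homological equation for the linear part. -/

section Homological

variable (ω₁ ω₂ ω₃ : ℝ)

/-- The frequency of the monomial `zmon p q`. -/
def freq (p q : Fin 3 → ℕ) : ℝ :=
  ω₁ * ((p 0 : ℝ) - q 0) + ω₂ * ((p 1 : ℝ) - q 1) + ω₃ * ((p 2 : ℝ) - q 2)

theorem hasLie_zmon (p q : Fin 3 → ℕ) : HasLie (linCLM ω₁ ω₂ ω₃) (zmon p q)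
    (fun v => (-Complex.I * freq ω₁ ω₂ ω₃ p q) * zmon p q v) := by
  set L := linCLM ω₁ ω₂ ω₃ with hL
  let c1 : Phase →L[ℝ] ℂ := (ContinuousLinearMap.fst ℝ ℂ (ℂ × ℂ)).comp
    ((ContinuousLinearMap.snd ℝ ℝ (ℂ × ℂ × ℂ)).comp (ContinuousLinearMap.snd ℝ ℝ (ℝ × ℂ × ℂ × ℂ)))
  let s : Phase →L[ℝ] ℂ × ℂ := (ContinuousLinearMap.snd ℝ ℂ (ℂ × ℂ)).comp
    ((ContinuousLinearMap.snd ℝ ℝ (ℂ × ℂ × ℂ)).comp (ContinuousLinearMap.snd ℝ ℝ (ℝ × ℂ × ℂ × ℂ)))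
  let c2 : Phase →L[ℝ] ℂ := (ContinuousLinearMap.fst ℝ ℂ ℂ).comp s
  let c3 : Phase →L[ℝ] ℂ := (ContinuousLinearMap.snd ℝ ℂ ℂ).comp s
  have conj : ∀ {f : Phase → ℂ} {ν : ℝ}, HasLie L f (fun v => (-Complex.I * ν) * f v) →
      HasLie L (fun v => star (f v)) (fun v => (Complex.I * ν) * star (f v)) := by
    intro f ν hf
    refine (hf.clm_comp (Complex.conjCLE : ℂ →L[ℝ] ℂ)).congr_deriv fun v => ?_
    simp
  have h1 : HasLie L (fun v => v.2.2.1) (fun v => (-Complex.I * ω₁) * v.2.2.1) :=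
    (hasLie_clm c1).congr_deriv fun v => rfl
  have h2 : HasLie L (fun v => v.2.2.2.1) (fun v => (-Complex.I * ω₂) * v.2.2.2.1) :=
    (hasLie_clm c2).congr_deriv fun v => rfl
  have h3 : HasLie L (fun v => v.2.2.2.2) (fun v => (-Complex.I * ω₃) * v.2.2.2.2) :=
    (hasLie_clm c3).congr_deriv fun v => rfl
  have h := (((h1.eigen_pow (p 0)).eigen_mul ((conj h1).eigen_pow (q 0))).eigen_mul
    ((h2.eigen_pow (p 1)).eigen_mul ((conj h2).eigen_pow (q 1)))).eigen_mul
    ((h3.eigen_pow (p 2)).eigen_mul ((conj h3).eigen_pow (q 2)))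
  refine HasLie.congr_deriv h fun v => ?_
  simp only [freq, zmon]
  push_cast
  ring

/-- The nilpotent block turns one `x₁` into an `x₂`, and the rotations contribute a scalar. At `a =
0` the truncated `a - 1` is harmless because its coefficient is zero. -/
theorem hasLie_mono (a b : ℕ) (p q : Fin 3 → ℕ) : HasLie (linCLM ω₁ ω₂ ω₃) (mono a b p q)
    (fun v => a * mono (a - 1) (b + 1) p q v
      + (-Complex.I * freq ω₁ ω₂ ω₃ p q) * mono a b p q v) := by
  set L := linCLM ω₁ ω₂ ω₃ with hL
  have h1 : HasLie L (fun v => (v.1 : ℂ)) (fun v => (v.2.1 : ℂ)) :=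
    hasLie_clm (Complex.ofRealCLM.comp (ContinuousLinearMap.fst ℝ ℝ (ℝ × ℂ × ℂ × ℂ)))
  have h2 : HasLie L (fun v => (v.2.1 : ℂ)) (fun v => 0 * (v.2.1 : ℂ)) :=
    (hasLie_clm (Complex.ofRealCLM.comp ((ContinuousLinearMap.fst ℝ ℝ (ℂ × ℂ × ℂ)).comp
      (ContinuousLinearMap.snd ℝ ℝ (ℝ × ℂ × ℂ × ℂ))))).congr_deriv fun v => by
      simp [hL, linCLM_apply]
  have h := ((h1.pow a).mul (h2.eigen_pow b)).mul (hasLie_zmon ω₁ ω₂ ω₃ p q)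
  refine HasLie.congr_deriv h fun v => ?_
  simp only [mono]
  ring

/-- Span of the monomials of degree `n` in `x₁, x₂` with fixed part in `z`. -/
noncomputable def Block (n : ℕ) (p q : Fin 3 → ℕ) : Submodule ℂ (Phase → ℂ) :=
  Submodule.span ℂ {g | ∃ a b, a + b = n ∧ g = mono a b p q}

variable {ω₁ ω₂ ω₃}

theorem block_le_polys {n k : ℕ} {p q : Fin 3 → ℕ} (h : n + zdeg p q = k) :
    Block n p q ≤ Polys k := by
  refine Submodule.span_mono ?_
  rintro _ ⟨a, b, rfl, rfl⟩
  exact ⟨a, b, p, q, h, rfl⟩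

/-- On a block the Lie derivative plus `μ` is a nonzero scalar plus the nilpotent `x₂ ∂/∂x₁`, hence
invertible. The induction on the exponent of `x₁` is the finite Neumann series. -/
theorem exists_lie_block {n : ℕ} {p q : Fin 3 → ℕ} {μ : ℂ}
    (h : -Complex.I * freq ω₁ ω₂ ω₃ p q + μ ≠ 0) {u : Phase → ℂ} (hu : u ∈ Block n p q) :
    ∃ g ∈ Block n p q, HasLie (linCLM ω₁ ω₂ ω₃) g (fun v => u v - μ * g v) := by
  refine Submodule.span_induction ?_ ?_ ?_ ?_ hu
  · rintro _ ⟨a, b, rfl, rfl⟩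
    clear hu
    induction a generalizing b with
    | zero =>
      refine ⟨_, Submodule.smul_mem _ (-Complex.I * freq ω₁ ω₂ ω₃ p q + μ)⁻¹
        (Submodule.subset_span ⟨0, b, rfl, rfl⟩), ?_⟩
      refine ((hasLie_mono ω₁ ω₂ ω₃ 0 b p q).const_mul _).congr_deriv fun v => ?_
      simp only [Pi.smul_apply, smul_eq_mul]
      push_cast
      linear_combination mono 0 b p q v * inv_mul_cancel₀ h
    | succ a ih =>
      obtain ⟨g, hg, hgL⟩ := ih (b + 1)
      have e : a + (b + 1) = a + 1 + b := by ring
      rw [e] at hg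
      refine ⟨_, Submodule.smul_mem _ (-Complex.I * freq ω₁ ω₂ ω₃ p q + μ)⁻¹
        (Submodule.sub_mem _ (Submodule.subset_span ⟨a + 1, b, rfl, rfl⟩)
          (Submodule.smul_mem _ (a + 1 : ℂ) hg)), ?_⟩
      refine (((hasLie_mono ω₁ ω₂ ω₃ (a + 1) b p q).sub (hgL.const_mul (a + 1))).const_mul
        _).congr_deriv fun v => ?_
      simp only [Pi.smul_apply, Pi.sub_apply, smul_eq_mul, Nat.add_sub_cancel]
      push_cast
      linear_combination mono (a + 1) b p q v * inv_mul_cancel₀ h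
  · exact ⟨0, Submodule.zero_mem _, hasLie_zero.congr_deriv fun v => by simp⟩
  · rintro f g - - ⟨f', hf', hf⟩ ⟨g', hg', hg⟩
    exact ⟨_, Submodule.add_mem _ hf' hg', (hf.add hg).congr_deriv fun v => by
      simp only [Pi.add_apply]; ring⟩
  · rintro c f - ⟨f', hf', hf⟩
    exact ⟨_, Submodule.smul_mem _ c hf', (hf.const_mul c).congr_deriv fun v => by
      simp only [Pi.smul_apply, smul_eq_mul]; ring⟩

variable (ω₁ ω₂ ω₃) in
/-- Span of the monomials of degree `k` that do not involve `x₂` and have frequency `ν`. -/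
noncomputable def Res (ν : ℝ) (k : ℕ) : Submodule ℂ (Phase → ℂ) :=
  Submodule.span ℂ
    {g | ∃ a p q, a + zdeg p q = k ∧ freq ω₁ ω₂ ω₃ p q = ν ∧ g = mono a 0 p q}

theorem res_le_polys (ν : ℝ) (k : ℕ) : Res ω₁ ω₂ ω₃ ν k ≤ Polys k := by
  refine Submodule.span_mono ?_
  rintro _ ⟨a, p, q, h, -, rfl⟩
  exact ⟨a, 0, p, q, h, rfl⟩

/-- This is the equation in a complex component rotating with frequency `ν`. Off resonance the block
operator is invertible; at resonance it reduces to `x₂ ∂/∂x₁`, whose image contains every monomial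
divisible by `x₂`. -/
theorem exists_lie_complex (ν : ℝ) {k : ℕ} {u : Phase → ℂ} (hu : u ∈ Polys k) :
    ∃ g ∈ Polys k, ∃ y ∈ Res ω₁ ω₂ ω₃ ν k, HasLie (linCLM ω₁ ω₂ ω₃) g
      (fun v => y v - u v - Complex.I * ν * g v) := by
  refine Submodule.span_induction ?_ ?_ ?_ ?_ hu
  · rintro _ ⟨a, b, p, q, hk, rfl⟩
    by_cases h : freq ω₁ ω₂ ω₃ p q = ν
    · rcases b with _ | b
      · exact ⟨0, Submodule.zero_mem _, _, Submodule.subset_span ⟨a, p, q, hk, h, rfl⟩,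
          hasLie_zero.congr_deriv fun v => by simp⟩
      · refine ⟨_, Submodule.smul_mem _ (-(a + 1 : ℂ)⁻¹)
          (mono_mem_polys (a := a + 1) (b := b) (p := p) (q := q) (by omega)),
          0, Submodule.zero_mem _, ?_⟩
        refine ((hasLie_mono ω₁ ω₂ ω₃ (a + 1) b p q).const_mul _).congr_deriv fun v => ?_
        have ha : (a + 1 : ℂ) ≠ 0 := by exact_mod_cast Nat.succ_ne_zero a
        simp only [Pi.smul_apply, Pi.zero_apply, smul_eq_mul, Nat.add_sub_cancel, h]
        field_simp
        push_cast
        ring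
    · have h' : -Complex.I * freq ω₁ ω₂ ω₃ p q + Complex.I * ν ≠ 0 := by
        intro h0
        apply h
        have : Complex.I * ((ν : ℂ) - freq ω₁ ω₂ ω₃ p q) = 0 := by rw [← h0]; ring
        have := (mul_eq_zero.1 this).resolve_left Complex.I_ne_zero
        exact_mod_cast (sub_eq_zero.1 this).symm
      obtain ⟨g, hg, hgL⟩ := exists_lie_block h' (n := a + b) (u := -mono a b p q)
        (Submodule.neg_mem _ (Submodule.subset_span ⟨a, b, rfl, rfl⟩))
      exact ⟨g, block_le_polys hk hg, 0, Submodule.zero_mem _, hgL.congr_deriv fun v => by simp⟩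
  · exact ⟨0, Submodule.zero_mem _, 0, Submodule.zero_mem _,
      hasLie_zero.congr_deriv fun v => by simp⟩
  · rintro f g - - ⟨f', hf', y, hy, hf⟩ ⟨g', hg', y', hy', hg⟩
    exact ⟨_, Submodule.add_mem _ hf' hg', _, Submodule.add_mem _ hy hy',
      (hf.add hg).congr_deriv fun v => by simp only [Pi.add_apply]; ring⟩
  · rintro c f - ⟨f', hf', y, hy, hf⟩
    exact ⟨_, Submodule.smul_mem _ c hf', _, Submodule.smul_mem _ c hy,
      (hf.const_mul c).congr_deriv fun v => by
      simp only [Pi.smul_apply, smul_eq_mul]; ring⟩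

/-- Solution of the second order equation coming from the nilpotent block. -/
theorem exists_lie_nilpotent {k : ℕ} {u : Phase → ℂ} (hu : u ∈ Polys (k + 1)) :
    ∃ h ∈ Polys (k + 1), ∃ (h' h'' y' : Phase → ℂ), ∃ g ∈ Res ω₁ ω₂ ω₃ 0 k,
      ∃ h₀ ∈ Res ω₁ ω₂ ω₃ 0 (k + 1), HasLie (linCLM ω₁ ω₂ ω₃) h h' ∧
        HasLie (linCLM ω₁ ω₂ ω₃) h' h'' ∧ HasLie (linCLM ω₁ ω₂ ω₃) (fun v => (v.1 : ℂ) * g v) y' ∧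
        ∀ v, u v + h'' v = v.2.1 * g v + y' v + h₀ v := by
  refine Submodule.span_induction ?_ ?_ ?_ ?_ hu
  · rintro _ ⟨a, b, p, q, hk, rfl⟩
    have z0 : ∀ (y : Phase → ℂ) (hy : ∀ v, 0 = y v),
        HasLie (linCLM ω₁ ω₂ ω₃) (fun v => (v.1 : ℂ) * (0 : Phase → ℂ) v) y := fun y hy => by
      simpa using (hasLie_zero (F := ℂ) (L := linCLM ω₁ ω₂ ω₃)).congr_deriv hy
    -- At frequency zero the square of `x₂ ∂/∂x₁` reaches exactly the monomials divisible by `x₂ ^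
    -- 2`. Those free of `x₂` go to `h₀`. Those linear in `x₂` go to `g`: with `g = c x₁ ^ a` the
    -- contribution is `c (1 + (a + 1)) x₁ ^ a x₂`, whence `c = 1 / (a + 2)`. At nonzero frequency
    -- the operator is inverted twice.
    by_cases h : freq ω₁ ω₂ ω₃ p q = 0
    · rcases b with _ | _ | b
      · refine ⟨0, Submodule.zero_mem _, fun _ => 0, fun _ => 0, fun _ => 0, 0,
          Submodule.zero_mem _, _, Submodule.subset_span ⟨a, p, q, hk, h, rfl⟩, hasLie_zero,
          hasLie_zero, z0 _ fun _ => rfl, fun v => by simp⟩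
      · have ha : (a + 2 : ℂ) ≠ 0 := by exact_mod_cast Nat.succ_ne_zero (a + 1)
        refine ⟨0, Submodule.zero_mem _, fun _ => 0, fun _ => 0,
          fun v => (a + 2 : ℂ)⁻¹ * ((a + 1) * mono a 1 p q v), _,
          Submodule.smul_mem _ (a + 2 : ℂ)⁻¹
            (Submodule.subset_span ⟨a, p, q, by omega, h, rfl⟩),
          0, Submodule.zero_mem _, hasLie_zero, hasLie_zero, ?_, fun v => ?_⟩
        · have h1 := ((hasLie_mono ω₁ ω₂ ω₃ (a + 1) 0 p q).const_mul (a + 2 : ℂ)⁻¹)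
          have e : (fun v : Phase => (a + 2 : ℂ)⁻¹ * mono (a + 1) 0 p q v)
              = fun v => (v.1 : ℂ) * ((a + 2 : ℂ)⁻¹ • mono a 0 p q) v := by
            funext v
            simp only [mono, Pi.smul_apply, smul_eq_mul]
            ring
          rw [e] at h1
          refine h1.congr_deriv fun v => ?_
          rw [h]
          simp
        · simp only [Pi.smul_apply, Pi.zero_apply, smul_eq_mul, mono]
          field_simp
          ring
      · have ha : (a + 2 : ℂ) ≠ 0 := by exact_mod_cast Nat.succ_ne_zero (a + 1)
        have ha' : (a + 1 : ℂ) ≠ 0 := by exact_mod_cast Nat.succ_ne_zero a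
        have h1 := ((hasLie_mono ω₁ ω₂ ω₃ (a + 2) b p q).const_mul (-((a + 1) * (a + 2) : ℂ)⁻¹))
        have h2 := ((hasLie_mono ω₁ ω₂ ω₃ (a + 1) (b + 1) p q).const_mul (-(a + 1 : ℂ)⁻¹))
        refine ⟨_, Submodule.smul_mem _ (-((a + 1) * (a + 2) : ℂ)⁻¹)
          (mono_mem_polys (a := a + 2) (b := b) (p := p) (q := q) (by omega)),
          fun v => -(a + 1 : ℂ)⁻¹ * mono (a + 1) (b + 1) p q v, fun v => -mono a (b + 2) p q v,
          fun _ => 0, 0, Submodule.zero_mem _, 0, Submodule.zero_mem _,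
          h1.congr_deriv fun v => ?_, h2.congr_deriv fun v => ?_, z0 _ fun _ => rfl,
          fun v => by simp⟩
        · rw [h]
          simp only [show a + 2 - 1 = a + 1 from rfl]
          push_cast
          field_simp
          ring
        · rw [h]
          simp only [Nat.add_sub_cancel]
          push_cast
          field_simp
          ring
    · have h' : -Complex.I * freq ω₁ ω₂ ω₃ p q + 0 ≠ 0 := by
        simpa using h
      obtain ⟨f, hf, hfL⟩ := exists_lie_block h' (n := a + b) (u := -mono a b p q)
        (Submodule.neg_mem _ (Submodule.subset_span ⟨a, b, rfl, rfl⟩))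
      obtain ⟨g, hg, hgL⟩ := exists_lie_block h' hf
      exact ⟨g, block_le_polys hk hg, f, -mono a b p q, fun _ => 0, 0, Submodule.zero_mem _, 0,
        Submodule.zero_mem _, hgL.congr_deriv fun v => by simp,
        hfL.congr_deriv fun v => by simp, z0 _ fun _ => rfl, fun v => by simp⟩
  · refine ⟨0, Submodule.zero_mem _, fun _ => 0, fun _ => 0, fun _ => 0, 0,
      Submodule.zero_mem _, 0, Submodule.zero_mem _, hasLie_zero, hasLie_zero, ?_,
      fun v => by simp⟩
    simpa using (hasLie_zero (F := ℂ) (L := linCLM ω₁ ω₂ ω₃))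
  · rintro f₁ f₂ - - ⟨h₁, m₁, a₁, b₁, y₁, g₁, hg₁, c₁, hc₁, l₁, l₁', l₁'', e₁⟩
      ⟨h₂, m₂, a₂, b₂, y₂, g₂, hg₂, c₂, hc₂, l₂, l₂', l₂'', e₂⟩
    refine ⟨_, Submodule.add_mem _ m₁ m₂, _, _, fun v => y₁ v + y₂ v, _,
      Submodule.add_mem _ hg₁ hg₂, _, Submodule.add_mem _ hc₁ hc₂, l₁.add l₂, l₁'.add l₂', ?_,
      fun v => ?_⟩
    · simpa only [Pi.add_apply, mul_add] using l₁''.add l₂''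
    · simp only [Pi.add_apply]
      linear_combination e₁ v + e₂ v
  · rintro c f₁ - ⟨h₁, m₁, a₁, b₁, y₁, g₁, hg₁, c₁, hc₁, l₁, l₁', l₁'', e₁⟩
    refine ⟨_, Submodule.smul_mem _ c m₁, _, _, fun v => c * y₁ v, _,
      Submodule.smul_mem _ c hg₁, _, Submodule.smul_mem _ c hc₁, l₁.const_mul c, l₁'.const_mul c,
      ?_, fun v => ?_⟩
    · simpa only [Pi.smul_apply, smul_eq_mul, mul_left_comm] using l₁''.const_mul c
    · simp only [Pi.smul_apply, smul_eq_mul]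
      linear_combination c * e₁ v

theorem HasLie.prodMk {E F G : Type*} [NormedAddCommGroup E] [NormedSpace ℝ E]
    [NormedAddCommGroup F] [NormedSpace ℝ F] [NormedAddCommGroup G] [NormedSpace ℝ G]
    {L : E →L[ℝ] E} {f f' : E → F} {g g' : E → G} (hf : HasLie L f f') (hg : HasLie L g g') :
    HasLie L (fun v => (f v, g v)) (fun v => (f' v, g' v)) :=
  ⟨hf.1.prodMk hg.1, fun v => by
    rw [(hf.differentiable v).fderiv_prodMk (hg.differentiable v),
      ContinuousLinearMap.prod_apply, hf.2, hg.2]⟩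

theorem IsHom.prodMk {E F G : Type*} [NormedAddCommGroup E] [NormedSpace ℝ E]
    [NormedAddCommGroup F] [NormedSpace ℝ F] [NormedAddCommGroup G] [NormedSpace ℝ G]
    {k : ℕ} {f : E → F} {g : E → G} (hf : IsHom k f) (hg : IsHom k g) :
    IsHom k (fun v => (f v, g v)) :=
  ⟨hf.1.prodMk hg.1, fun t v => by simp only [hf.2, hg.2, Prod.smul_mk]⟩

/-- The homological equation, without symmetries. -/
theorem exists_homological {k : ℕ} {Z : Phase → Phase} (hZ : IsHom (k + 1) Z) :
    ∃ h : Phase → Phase, IsHom (k + 1) h ∧ ∃ g ∈ Res ω₁ ω₂ ω₃ 0 k,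
      ∃ y₀ ∈ Res ω₁ ω₂ ω₃ 0 (k + 1), ∃ y₁ ∈ Res ω₁ ω₂ ω₃ ω₁ (k + 1),
      ∃ y₂ ∈ Res ω₁ ω₂ ω₃ ω₂ (k + 1), ∃ y₃ ∈ Res ω₁ ω₂ ω₃ ω₃ (k + 1),
      ∀ v, Z v + fderiv ℝ h v (linCLM ω₁ ω₂ ω₃ v) - linCLM ω₁ ω₂ ω₃ (h v)
        = (v.1 * (g v).re, v.2.1 * (g v).re + (y₀ v).re, y₁ v, y₂ v, y₃ v) := by
  set L := linCLM ω₁ ω₂ ω₃ with hL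
  let s2 := ContinuousLinearMap.snd ℝ ℝ (ℝ × ℂ × ℂ × ℂ)
  let s3 := (ContinuousLinearMap.snd ℝ ℝ (ℂ × ℂ × ℂ)).comp s2
  let s4 := (ContinuousLinearMap.snd ℝ ℂ (ℂ × ℂ)).comp s3
  have hZ1 : IsHom (k + 1) (fun v => (Z v).1) := hZ.clm_comp (ContinuousLinearMap.fst ℝ ℝ _)
  have hZ2 : IsHom (k + 1) (fun v => (Z v).2.1) :=
    hZ.clm_comp ((ContinuousLinearMap.fst ℝ ℝ (ℂ × ℂ × ℂ)).comp s2)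
  have hZ3 : IsHom (k + 1) (fun v => (Z v).2.2.1) :=
    hZ.clm_comp ((ContinuousLinearMap.fst ℝ ℂ (ℂ × ℂ)).comp s3)
  have hZ4 : IsHom (k + 1) (fun v => (Z v).2.2.2.1) :=
    hZ.clm_comp ((ContinuousLinearMap.fst ℝ ℂ ℂ).comp s4)
  have hZ5 : IsHom (k + 1) (fun v => (Z v).2.2.2.2) :=
    hZ.clm_comp ((ContinuousLinearMap.snd ℝ ℂ ℂ).comp s4)
  obtain ⟨h₃, hh₃, y₁, hy₁, l₃⟩ := exists_lie_complex (ω₁ := ω₁) (ω₂ := ω₂) (ω₃ := ω₃) ω₁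
    (mem_polys_of_isHom hZ3)
  obtain ⟨h₄, hh₄, y₂, hy₂, l₄⟩ := exists_lie_complex (ω₁ := ω₁) (ω₂ := ω₂) (ω₃ := ω₃) ω₂
    (mem_polys_of_isHom hZ4)
  obtain ⟨h₅, hh₅, y₃, hy₃, l₅⟩ := exists_lie_complex (ω₁ := ω₁) (ω₂ := ω₂) (ω₃ := ω₃) ω₃
    (mem_polys_of_isHom hZ5)
  have lZ1 : HasLie L (fun v => (Z v).1) _ := hasLie_of_contDiff hZ1.1
  set Z1' := fun v => fderiv ℝ (fun v => (Z v).1) v (L v) with hZ1'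
  have hZ1'h : IsHom (k + 1) Z1' := lZ1.isHom hZ1
  -- Solving the first real component for `h₂` gives `h₂ = Z₁ + 𝓛h₁ - x₁ g`, where `𝓛` is the Lie
  -- derivative. Substituting into the second leaves a second order equation for `h₁` with source
  -- `Z₂ + 𝓛Z₁`. It is solved over `ℂ`, and real parts are taken afterwards.
  obtain ⟨f, hf, f', f'', y', g, hg, y₀, hy₀, l, l', l'', e⟩ :=
    exists_lie_nilpotent (ω₁ := ω₁) (ω₂ := ω₂) (ω₃ := ω₃)
      (mem_polys_of_isHom ((hZ2.add hZ1'h).clm_comp Complex.ofRealCLM))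
  have lf := l.clm_comp Complex.reCLM
  have lf' := l'.clm_comp Complex.reCLM
  have lg := l''.clm_comp Complex.reCLM
  have hfh := isHom_of_mem_polys hf
  have hgh : IsHom (k + 1) (fun v : Phase => (v.1 : ℂ) * g v) := by
    have := (isHom_clm (ContinuousLinearMap.fst ℝ ℝ (ℝ × ℂ × ℂ × ℂ))).smul
      (isHom_of_mem_polys (res_le_polys _ _ hg))
    rw [add_comm 1 k] at this
    simp only [Complex.real_smul] at this
    exact this
  have hh₁ : IsHom (k + 1) (fun v => (f v).re) := hfh.clm_comp Complex.reCLM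
  have hh₂ : IsHom (k + 1) (fun v => (Z v).1 + (f' v).re - (v.1 * g v).re) :=
    (hZ1.add ((l.isHom hfh).clm_comp Complex.reCLM)).sub (hgh.clm_comp Complex.reCLM)
  have lh := lf.prodMk (((lZ1.add lf').sub lg).prodMk (l₃.prodMk (l₄.prodMk l₅)))
  refine ⟨_, hh₁.prodMk (hh₂.prodMk ((isHom_of_mem_polys hh₃).prodMk
    ((isHom_of_mem_polys hh₄).prodMk (isHom_of_mem_polys hh₅)))), g, hg, y₀, hy₀, y₁, hy₁, y₂, hy₂,
    y₃, hy₃, fun v => ?_⟩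
  have hd := lh.2 v
  simp only [Complex.reCLM_apply] at hd
  rw [hd, hL, linCLM_apply]
  have e' := congrArg Complex.re (e v)
  simp only [Complex.ofRealCLM_apply, Complex.add_re, Complex.ofReal_re, Complex.re_ofReal_mul]
    at e'
  refine Prod.ext ?_ (Prod.ext ?_ (Prod.ext ?_ (Prod.ext ?_ ?_)))
  · simp only [Prod.fst_add, Prod.fst_sub, Complex.re_ofReal_mul]
    ring
  · simp only [Prod.fst_add, Prod.fst_sub, Prod.snd_add, Prod.snd_sub, hZ1'] at e' ⊢
    linarith
  · simp only [Prod.fst_add, Prod.fst_sub, Prod.snd_add, Prod.snd_sub]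
    ring
  · simp only [Prod.fst_add, Prod.fst_sub, Prod.snd_add, Prod.snd_sub]
    ring
  · simp only [Prod.snd_add, Prod.snd_sub]
    ring

end Homological

/-! ### Averaging over a reversing involution. -/

section Averaging

variable {E : Type*} [NormedAddCommGroup E] [NormedSpace ℝ E]

/-- The projection onto the vector fields that are reversed by the involution `κ`. -/
noncomputable def revProj (κ : E →L[ℝ] E) : (E → E) →ₗ[ℝ] (E → E) where
  toFun Y := fun v => (1 / 2 : ℝ) • (Y v - κ (Y (κ v)))
  map_add' Y Y' := by
    funext v
    simp only [Pi.add_apply, map_add]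
    module
  map_smul' c Y := by
    funext v
    simp only [Pi.smul_apply, map_smul, RingHom.id_apply]
    module

theorem revProj_apply (κ : E →L[ℝ] E) (Y : E → E) (v : E) :
    revProj κ Y v = (1 / 2 : ℝ) • (Y v - κ (Y (κ v))) := rfl

/-- Averaging a solution of the homological equation over an involution. -/
theorem exists_averaged_solution {L κ : E →L[ℝ] E} (hκ : ∀ v, κ (κ v) = v)
    (hL : ∀ v, L (κ v) = -κ (L v)) {k : ℕ} {Z h Y : E → E} (hZ : ∀ v, Z (κ v) = -κ (Z v))
    (hh : IsHom k h) (hY : ∀ v, Z v + fderiv ℝ h v (L v) - L (h v) = Y v) :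
    ∃ h' : E → E, IsHom k h' ∧ (∀ v, h' (κ v) = κ (h' v)) ∧
      (∀ v, Z v + fderiv ℝ h' v (L v) - L (h' v) = revProj κ Y v) ∧
      ∀ κ' : E →L[ℝ] E, (∀ v, κ (κ' v) = κ' (κ v)) → (∀ v, h (κ' v) = κ' (h v)) →
        ∀ v, h' (κ' v) = κ' (h' v) := by
  have hd : Differentiable ℝ h := hh.1.differentiable (by simp)
  refine ⟨fun v => (1 / 2 : ℝ) • (h v + κ (h (κ v))),
    (hh.add ((hh.comp_clm κ).clm_comp κ)).const_smul _, fun v => ?_, fun v => ?_,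
    fun κ' hc he v => ?_⟩
  · simp only [hκ, map_smul, map_add]
    rw [add_comm]
  · have h1 : HasFDerivAt (fun v => (1 / 2 : ℝ) • (h v + κ (h (κ v))))
        ((1 / 2 : ℝ) • (fderiv ℝ h v + κ.comp ((fderiv ℝ h (κ v)).comp κ))) v := by
      refine HasFDerivAt.const_smul (HasFDerivAt.add (hd v).hasFDerivAt ?_) _
      exact κ.hasFDerivAt.comp v ((hd (κ v)).hasFDerivAt.comp v κ.hasFDerivAt)
    have e1 : fderiv ℝ h v (L v) = Y v - Z v + L (h v) := by rw [← hY]; abel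
    have e2 : fderiv ℝ h (κ v) (L (κ v)) = Y (κ v) + κ (Z v) + L (h (κ v)) := by
      rw [← hY, hZ]; abel
    rw [hL, map_neg] at e2
    rw [h1.fderiv, revProj_apply]
    simp only [smul_apply, add_apply, ContinuousLinearMap.comp_apply,
      map_smul, map_add, e1, hL]
    rw [show fderiv ℝ h (κ v) (κ (L v)) = -(Y (κ v) + κ (Z v) + L (h (κ v))) by
      rw [← e2, neg_neg]]
    simp only [map_neg, map_add, hκ]
    module
  · simp only [he, hc, map_smul, map_add]

end Averaging

/-! ### Real invariants, and reduction of powers of the resonant monomial. -/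

section Invariants

variable (n₁ n₂ : ℕ)

/-- The involution `φ` as a continuous linear map. -/
noncomputable def phiCLM : Phase →L[ℝ] Phase :=
  LinearMap.toContinuousLinearMap
    { toFun := phi
      map_add' := fun u v => by
        simp only [phi, Prod.mk_add_mk, star_add, neg_add]
      map_smul' := fun t v => by
        simp [phi, Prod.smul_mk] }

theorem phiCLM_apply (v : Phase) :
    phiCLM v = (v.1, -v.2.1, star v.2.2.1, star v.2.2.2.1, star v.2.2.2.2) := rfl

/-- The resonant monomial as a function on the phase space. -/
noncomputable def wRes (v : Phase) : ℂ := resMonomial n₁ n₂ v.2.2.1 v.2.2.2.1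

/-- The monomials in the real invariants of type A. -/
noncomputable def monA (d a b p c : ℕ) (v : Phase) : ℝ :=
  v.1 ^ d * (‖v.2.2.1‖ ^ 2) ^ a * (‖v.2.2.2.1‖ ^ 2) ^ b * (wRes n₁ n₂ v).re ^ p
    * (‖v.2.2.2.2‖ ^ 2) ^ c

/-- The degree of `monA` on the phase space. -/
def degA (d a b p c : ℕ) : ℕ := d + 2 * a + 2 * b + (n₁ + n₂) * p + 2 * c

/-- Real polynomials in the invariants of type A that are homogeneous of degree `k - e`. -/
noncomputable def Alg (e k : ℕ) : Submodule ℝ (Phase → ℝ) :=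
  Submodule.span ℝ {f | ∃ d a b p c, degA n₁ n₂ d a b p c + e = k ∧ f = monA n₁ n₂ d a b p c}

variable {n₁ n₂}

theorem monA_mem_alg {e k d a b p c : ℕ} (h : degA n₁ n₂ d a b p c + e = k) :
    monA n₁ n₂ d a b p c ∈ Alg n₁ n₂ e k := Submodule.subset_span ⟨d, a, b, p, c, h, rfl⟩

theorem alg_shift {e k : ℕ} (c : ℕ) {f : Phase → ℝ} (hf : f ∈ Alg n₁ n₂ e k) :
    f ∈ Alg n₁ n₂ (e + c) (k + c) := by
  refine Submodule.span_mono ?_ hf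
  rintro _ ⟨d, a, b, p, c', h, rfl⟩
  exact ⟨d, a, b, p, c', by omega, rfl⟩

theorem alg_unshift {e k : ℕ} (c : ℕ) {f : Phase → ℝ} (hf : f ∈ Alg n₁ n₂ (e + c) (k + c)) :
    f ∈ Alg n₁ n₂ e k := by
  refine Submodule.span_mono ?_ hf
  rintro _ ⟨d, a, b, p, c', h, rfl⟩
  exact ⟨d, a, b, p, c', by omega, rfl⟩

theorem alg_mul {e m n : ℕ} {f g : Phase → ℝ} (hf : f ∈ Alg n₁ n₂ 0 m)
    (hg : g ∈ Alg n₁ n₂ e n) : f * g ∈ Alg n₁ n₂ e (m + n) := by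
  have h : Alg n₁ n₂ 0 m * Alg n₁ n₂ e n ≤ Alg n₁ n₂ e (m + n) := by
    unfold Alg
    rw [Submodule.span_mul_span]
    refine Submodule.span_mono ?_
    rintro _ ⟨_, ⟨d, a, b, p, c, h, rfl⟩, _, ⟨d', a', b', p', c', h', rfl⟩, rfl⟩
    refine ⟨d + d', a + a', b + b', p + p', c + c', ?_, ?_⟩
    · simp only [degA, mul_add] at *
      omega
    · funext v
      simp only [Pi.mul_apply, monA, pow_add]
      ring
  exact h (Submodule.mul_mem_mul hf hg)

theorem wRes_phi (v : Phase) : wRes n₁ n₂ (phiCLM v) = star (wRes n₁ n₂ v) := by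
  simp [wRes, resMonomial, phiCLM_apply]

theorem alg_phi {e k : ℕ} {f : Phase → ℝ} (hf : f ∈ Alg n₁ n₂ e k) (v : Phase) :
    f (phiCLM v) = f v := by
  refine Submodule.span_induction ?_ (by simp) (fun f g _ _ h h' => by simp [h, h'])
    (fun c f _ h => by simp [h]) hf
  rintro _ ⟨d, a, b, p, c, -, rfl⟩
  simp only [monA, wRes_phi]
  simp [phiCLM_apply]

theorem normSq_wRes (v : Phase) : (wRes n₁ n₂ v).im ^ 2
    = (‖v.2.2.1‖ ^ 2) ^ n₂ * (‖v.2.2.2.1‖ ^ 2) ^ n₁ - (wRes n₁ n₂ v).re ^ 2 := by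
  have h : ‖wRes n₁ n₂ v‖ ^ 2 = (‖v.2.2.1‖ ^ 2) ^ n₂ * (‖v.2.2.2.1‖ ^ 2) ^ n₁ := by
    simp only [wRes, resMonomial, norm_mul, norm_pow, norm_star]
    ring
  rw [← h, ← Complex.normSq_eq_norm_sq, Complex.normSq_apply]
  ring

/-- Powers of the resonant monomial in terms of the real invariants. -/
theorem exists_wRes_pow (s : ℕ) :
    ∃ A ∈ Alg n₁ n₂ 0 ((n₁ + n₂) * s), ∃ B ∈ Alg n₁ n₂ (n₁ + n₂) ((n₁ + n₂) * s),
      ∀ v, wRes n₁ n₂ v ^ s = A v + Complex.I * (wRes n₁ n₂ v).im * B v := by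
  induction s with
  | zero =>
    exact ⟨monA n₁ n₂ 0 0 0 0 0, monA_mem_alg (by simp [degA]), 0, Submodule.zero_mem _,
      fun v => by simp [monA]⟩
  | succ s ih =>
    obtain ⟨A, hA, B, hB, h⟩ := ih
    have hR : monA n₁ n₂ 0 0 0 1 0 ∈ Alg n₁ n₂ 0 (n₁ + n₂) := monA_mem_alg (by simp [degA])
    have hI : monA n₁ n₂ 0 n₂ n₁ 0 0 - monA n₁ n₂ 0 0 0 2 0 ∈ Alg n₁ n₂ 0 ((n₁ + n₂) * 2) :=
      Submodule.sub_mem _ (monA_mem_alg (by simp [degA]; ring)) (monA_mem_alg (by simp [degA]))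
    -- Multiply `A + i (Im w) B` by `w = Re w + i Im w` and replace `(Im w)²` by `normSq_wRes`. The
    -- substituted polynomial has degree `2 (n₁ + n₂)`, one half of which pays for the degree offset
    -- carried by `B`.
    refine ⟨monA n₁ n₂ 0 0 0 1 0 * A
        - (monA n₁ n₂ 0 n₂ n₁ 0 0 - monA n₁ n₂ 0 0 0 2 0) * B, Submodule.sub_mem _ ?_ ?_,
      A + monA n₁ n₂ 0 0 0 1 0 * B, Submodule.add_mem _ ?_ ?_, fun v => ?_⟩
    · have := alg_mul hR hA
      rwa [show n₁ + n₂ + (n₁ + n₂) * s = (n₁ + n₂) * (s + 1) by ring] at this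
    · refine alg_unshift (n₁ + n₂) ?_
      have := alg_mul hI hB
      rw [zero_add]
      rwa [show (n₁ + n₂) * 2 + (n₁ + n₂) * s = (n₁ + n₂) * (s + 1) + (n₁ + n₂) by ring] at this
    · have := alg_shift (n₁ + n₂) hA
      rwa [zero_add] at this
    · have := alg_mul hR hB
      rwa [show n₁ + n₂ + (n₁ + n₂) * s = (n₁ + n₂) * (s + 1) by ring] at this
    · have h2 : ((wRes n₁ n₂ v).im : ℂ) ^ 2
          = ((‖v.2.2.1‖ ^ 2) ^ n₂ * (‖v.2.2.2.1‖ ^ 2) ^ n₁ - (wRes n₁ n₂ v).re ^ 2 : ℝ) := by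
        rw [← normSq_wRes]; push_cast; rfl
      have h3 : wRes n₁ n₂ v ^ (s + 1) = (A v + Complex.I * (wRes n₁ n₂ v).im * B v)
          * ((wRes n₁ n₂ v).re + (wRes n₁ n₂ v).im * Complex.I) := by
        rw [Complex.re_add_im, pow_succ, h]
      rw [h3]
      simp only [Pi.sub_apply, Pi.add_apply, Pi.mul_apply, monA, pow_zero, one_mul, mul_one,
        pow_one]
      push_cast at h2 ⊢
      linear_combination ((wRes n₁ n₂ v).im : ℂ) ^ 2 * (B v) * Complex.I_sq - (B v) * h2

/-- A `φ`-real function that is a combination of invariants. -/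
theorem exists_inv_decomp (d a b c s : ℕ) {m : ℕ}
    (hm : degA n₁ n₂ d a b 0 c + (n₁ + n₂) * s = m) :
    ∃ A ∈ Alg n₁ n₂ 0 m, ∃ B ∈ Alg n₁ n₂ (n₁ + n₂) m,
      ∀ v, (monA n₁ n₂ d a b 0 c v : ℂ) * wRes n₁ n₂ v ^ s
        = A v + Complex.I * (wRes n₁ n₂ v).im * B v := by
  subst hm
  obtain ⟨A, hA, B, hB, h⟩ := exists_wRes_pow (n₁ := n₁) (n₂ := n₂) s
  have hM : monA n₁ n₂ d a b 0 c ∈ Alg n₁ n₂ 0 (degA n₁ n₂ d a b 0 c) := monA_mem_alg rfl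
  refine ⟨_, alg_mul hM hA, _, alg_mul hM hB, fun v => ?_⟩
  rw [h]
  simp only [Pi.mul_apply]
  push_cast
  ring

theorem exists_inv_decomp_star (d a b c s : ℕ) {m : ℕ}
    (hm : degA n₁ n₂ d a b 0 c + (n₁ + n₂) * s = m) :
    ∃ A ∈ Alg n₁ n₂ 0 m, ∃ B ∈ Alg n₁ n₂ (n₁ + n₂) m,
      ∀ v, (monA n₁ n₂ d a b 0 c v : ℂ) * star (wRes n₁ n₂ v) ^ s
        = A v + Complex.I * (wRes n₁ n₂ v).im * B v := by
  obtain ⟨A, hA, B, hB, h⟩ := exists_inv_decomp d a b c s hm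
  refine ⟨A, hA, -B, Submodule.neg_mem _ hB, fun v => ?_⟩
  have := congrArg star (h v)
  simp only [star_mul', star_pow, star_add, Complex.star_def, Complex.conj_ofReal,
    Complex.conj_I] at this
  rw [Complex.star_def, this, Pi.neg_apply]
  push_cast
  ring

end Invariants

/-! ### Classification of the resonant monomials. -/

section Resonance

variable {n₁ n₂ : ℕ} {ω₁ ω₂ ω₃ : ℝ}

/-- If `c₃ ≠ 0`, dividing by it exhibits `ω₃` as a rational combination of `ω₁` and `ω₂`. Otherwise
multiplying by `n₁` and cancelling `ω₁` gives `n₁ c₁ + n₂ c₂ = 0`, and coprimality finishes. -/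
theorem resonance (hn₂ : 0 < n₂) (hcop : Nat.Coprime n₁ n₂) (hω₁ : ω₁ ≠ 0)
    (hres : (n₁ : ℝ) * ω₂ = (n₂ : ℝ) * ω₁)
    (hind : ω₃ ∉ Submodule.span ℚ ({ω₁, ω₂} : Set ℝ)) {c₁ c₂ c₃ : ℤ}
    (h : ω₁ * c₁ + ω₂ * c₂ + ω₃ * c₃ = 0) :
    c₃ = 0 ∧ ∃ s : ℤ, c₁ = n₂ * s ∧ c₂ = -(n₁ * s) := by
  have h3 : c₃ = 0 := by
    by_contra h3
    apply hind
    have h3' : (c₃ : ℝ) ≠ 0 := by exact_mod_cast h3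
    rw [Submodule.mem_span_pair]
    refine ⟨-(c₁ / c₃ : ℚ), -(c₂ / c₃ : ℚ), ?_⟩
    simp only [Rat.smul_def]
    push_cast
    field_simp
    linear_combination -h
  subst h3
  refine ⟨rfl, ?_⟩
  have h1 : ω₁ * ((n₁ * c₁ + n₂ * c₂ : ℤ) : ℝ) = 0 := by
    push_cast at h ⊢
    linear_combination (n₁ : ℝ) * h - (c₂ : ℝ) * hres
  have h2 : (n₁ * c₁ + n₂ * c₂ : ℤ) = 0 := by
    exact_mod_cast (mul_eq_zero.1 h1).resolve_left hω₁
  have hdvd : (n₂ : ℤ) ∣ c₁ := by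
    have : (n₂ : ℤ) ∣ n₁ * c₁ := ⟨-c₂, by linear_combination h2⟩
    exact (Nat.isCoprime_iff_coprime.2 hcop).symm.dvd_of_dvd_mul_left this
  obtain ⟨s, rfl⟩ := hdvd
  refine ⟨s, rfl, ?_⟩
  have : (n₂ : ℤ) ≠ 0 := by exact_mod_cast hn₂.ne'
  refine mul_left_cancel₀ this ?_
  linear_combination h2

theorem ofReal_norm_sq (z : ℂ) : ((‖z‖ ^ 2 : ℝ) : ℂ) = z * star z := by
  rw [Complex.star_def, Complex.mul_conj, Complex.normSq_eq_norm_sq]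

theorem mono_zero_right (a : ℕ) (p q : Fin 3 → ℕ) (v : Phase) : mono a 0 p q v
    = (v.1 : ℂ) ^ a * zmon p q v := by simp [mono]

theorem coe_monA (d a b c : ℕ) (v : Phase) : (monA n₁ n₂ d a b 0 c v : ℂ)
    = (v.1 : ℂ) ^ d * (v.2.2.1 * star v.2.2.1) ^ a * (v.2.2.2.1 * star v.2.2.2.1) ^ b
      * (v.2.2.2.2 * star v.2.2.2.2) ^ c := by
  simp only [monA, pow_zero, mul_one, Complex.ofReal_mul, Complex.ofReal_pow (v.1)]
  rw [Complex.ofReal_pow (‖v.2.2.1‖ ^ 2), Complex.ofReal_pow (‖v.2.2.2.1‖ ^ 2),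
    Complex.ofReal_pow (‖v.2.2.2.2‖ ^ 2), ofReal_norm_sq, ofReal_norm_sq, ofReal_norm_sq]

variable (n₁ n₂) in
/-- The function `u` is `ξ (A + i (Im w) B)` with real invariant `A`, `B`. -/
def Decomp (e k : ℕ) (ξ u : Phase → ℂ) : Prop :=
  ∃ A ∈ Alg n₁ n₂ e k, ∃ B ∈ Alg n₁ n₂ (n₁ + n₂ + e) k,
    ∀ v, u v = ξ v * (A v + Complex.I * (wRes n₁ n₂ v).im * B v)

theorem decomp_of_pow {e k d a b c s : ℕ} {ξ u : Phase → ℂ}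
    (hk : degA n₁ n₂ d a b 0 c + (n₁ + n₂) * s + e = k)
    (h : ∀ v, u v = ξ v * ((monA n₁ n₂ d a b 0 c v : ℂ) * wRes n₁ n₂ v ^ s)) :
    Decomp n₁ n₂ e k ξ u := by
  obtain ⟨A, hA, B, hB, hAB⟩ := exists_inv_decomp (n₁ := n₁) (n₂ := n₂) d a b c s rfl
  subst hk
  refine ⟨A, ?_, B, alg_shift e hB, fun v => by rw [h, hAB]⟩
  simpa using alg_shift e hA

theorem decomp_of_star_pow {e k d a b c s : ℕ} {ξ u : Phase → ℂ}
    (hk : degA n₁ n₂ d a b 0 c + (n₁ + n₂) * s + e = k)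
    (h : ∀ v, u v = ξ v * ((monA n₁ n₂ d a b 0 c v : ℂ) * star (wRes n₁ n₂ v) ^ s)) :
    Decomp n₁ n₂ e k ξ u := by
  obtain ⟨A, hA, B, hB, hAB⟩ := exists_inv_decomp_star (n₁ := n₁) (n₂ := n₂) d a b c s rfl
  subst hk
  refine ⟨A, ?_, B, alg_shift e hB, fun v => by rw [h, hAB]⟩
  simpa using alg_shift e hA

/-- The hypotheses on the frequencies. -/
structure Resonant (n₁ n₂ : ℕ) (ω₁ ω₂ ω₃ : ℝ) : Prop where
  pos₁ : 0 < n₁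
  pos₂ : 0 < n₂
  coprime : Nat.Coprime n₁ n₂
  ne₁ : ω₁ ≠ 0
  res : (n₁ : ℝ) * ω₂ = (n₂ : ℝ) * ω₁
  ind : ω₃ ∉ Submodule.span ℚ ({ω₁, ω₂} : Set ℝ)

/-- The integer parameter is split by sign: nonnegative values give powers of `w`, the others powers
of its conjugate. The shifts `δ` mark the component of the vector field. -/
theorem Resonant.exists_int (H : Resonant n₁ n₂ ω₁ ω₂ ω₃)
    {p q : Fin 3 → ℕ} {δ₁ δ₂ δ₃ : ℤ}
    (h : freq ω₁ ω₂ ω₃ p q = ω₁ * δ₁ + ω₂ * δ₂ + ω₃ * δ₃) :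
    (p 2 : ℤ) - q 2 = δ₃ ∧ ∃ s : ℕ,
      ((p 0 : ℤ) - q 0 - δ₁ = n₂ * s ∧ (p 1 : ℤ) - q 1 - δ₂ = -(n₁ * s)) ∨
      ((p 0 : ℤ) - q 0 - δ₁ = -(n₂ * s) ∧ (p 1 : ℤ) - q 1 - δ₂ = n₁ * s) := by
  obtain ⟨h3, s, h1, h2⟩ := resonance H.pos₂ H.coprime H.ne₁ H.res H.ind
    (c₁ := (p 0 : ℤ) - q 0 - δ₁) (c₂ := (p 1 : ℤ) - q 1 - δ₂) (c₃ := (p 2 : ℤ) - q 2 - δ₃) (by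
      rw [freq] at h
      push_cast
      linear_combination h)
  refine ⟨by omega, ?_⟩
  obtain ⟨t, rfl | rfl⟩ := s.eq_nat_or_neg
  · exact ⟨t, Or.inl ⟨h1, h2⟩⟩
  · exact ⟨t, Or.inr ⟨by rw [h1]; ring, by rw [h2]; ring⟩⟩

theorem Resonant.decomp_zero (H : Resonant n₁ n₂ ω₁ ω₂ ω₃)
    {a k : ℕ} {p q : Fin 3 → ℕ} (hk : a + zdeg p q = k)
    (h : freq ω₁ ω₂ ω₃ p q = 0) : Decomp n₁ n₂ 0 k (fun _ => 1) (mono a 0 p q) := by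
  obtain ⟨h3, s, ⟨h1, h2⟩ | ⟨h1, h2⟩⟩ := H.exists_int (δ₁ := 0) (δ₂ := 0) (δ₃ := 0)
    (h.trans (by simp))
  · have e0 : p 0 = q 0 + n₂ * s := by zify; linarith
    have e1 : q 1 = p 1 + n₁ * s := by zify; linarith
    have e2 : p 2 = q 2 := by omega
    refine decomp_of_pow (d := a) (a := q 0) (b := p 1) (c := q 2) (s := s) ?_ fun v => ?_
    · rw [← hk, zdeg, e0, e1, e2, degA]; ring
    · rw [mono_zero_right, zmon, e0, e1, e2, coe_monA, wRes, resMonomial]; ring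
  · have e0 : q 0 = p 0 + n₂ * s := by zify; linarith
    have e1 : p 1 = q 1 + n₁ * s := by zify; linarith
    have e2 : p 2 = q 2 := by omega
    refine decomp_of_star_pow (d := a) (a := p 0) (b := q 1) (c := q 2) (s := s) ?_ fun v => ?_
    · rw [← hk, zdeg, e0, e1, e2, degA]; ring
    · rw [mono_zero_right, zmon, e0, e1, e2, coe_monA, wRes, resMonomial, star_mul', star_pow,
        star_pow, star_star]; ring

theorem Resonant.decomp_three (H : Resonant n₁ n₂ ω₁ ω₂ ω₃)
    {a k : ℕ} {p q : Fin 3 → ℕ} (hk : a + zdeg p q = k)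
    (h : freq ω₁ ω₂ ω₃ p q = ω₃) : Decomp n₁ n₂ 1 k (fun v => v.2.2.2.2) (mono a 0 p q) := by
  obtain ⟨h3, s, ⟨h1, h2⟩ | ⟨h1, h2⟩⟩ := H.exists_int (δ₁ := 0) (δ₂ := 0) (δ₃ := 1)
    (h.trans (by simp))
  · have e0 : p 0 = q 0 + n₂ * s := by zify; linarith
    have e1 : q 1 = p 1 + n₁ * s := by zify; linarith
    have e2 : p 2 = q 2 + 1 := by omega
    refine decomp_of_pow (d := a) (a := q 0) (b := p 1) (c := q 2) (s := s) ?_ fun v => ?_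
    · rw [← hk, zdeg, e0, e1, e2, degA]; ring
    · rw [mono_zero_right, zmon, e0, e1, e2, coe_monA, wRes, resMonomial]; ring
  · have e0 : q 0 = p 0 + n₂ * s := by zify; linarith
    have e1 : p 1 = q 1 + n₁ * s := by zify; linarith
    have e2 : p 2 = q 2 + 1 := by omega
    refine decomp_of_star_pow (d := a) (a := p 0) (b := q 1) (c := q 2) (s := s) ?_ fun v => ?_
    · rw [← hk, zdeg, e0, e1, e2, degA]; ring
    · rw [mono_zero_right, zmon, e0, e1, e2, coe_monA, wRes, resMonomial, star_mul', star_pow,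
        star_pow, star_star]; ring

/-- On the conjugate side with `s ≥ 1`, a factor `z₁` need not be present: the monomial is formally
`z₁ w̄ ^ s / |z₁|²` times moduli, and `z₁ w̄ / |z₁|²` is `q₁`. The second component is analogous,
with `q₂ = z₂ w / |z₂|²` and the roles of `w` and `w̄` exchanged. -/
theorem Resonant.decomp_one (H : Resonant n₁ n₂ ω₁ ω₂ ω₃)
    {a k : ℕ} {p q : Fin 3 → ℕ} (hk : a + zdeg p q = k)
    (h : freq ω₁ ω₂ ω₃ p q = ω₁) : Decomp n₁ n₂ 1 k (fun v => v.2.2.1) (mono a 0 p q) ∨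
      Decomp n₁ n₂ (n₁ + n₂ - 1) k (fun v => resField₁ n₁ n₂ v.2.2.1 v.2.2.2.1)
        (mono a 0 p q) := by
  obtain ⟨h3, s, ⟨h1, h2⟩ | ⟨h1, h2⟩⟩ := H.exists_int (δ₁ := 1) (δ₂ := 0) (δ₃ := 0)
    (h.trans (by simp))
  · left
    have e0 : p 0 = q 0 + n₂ * s + 1 := by zify; linarith
    have e1 : q 1 = p 1 + n₁ * s := by zify; linarith
    have e2 : p 2 = q 2 := by omega
    refine decomp_of_pow (d := a) (a := q 0) (b := p 1) (c := q 2) (s := s) ?_ fun v => ?_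
    · rw [← hk, zdeg, e0, e1, e2, degA]; ring
    · rw [mono_zero_right, zmon, e0, e1, e2, coe_monA, wRes, resMonomial]; ring
  · rcases s with _ | s
    · left
      have e0 : p 0 = q 0 + 1 := by push_cast at h1; omega
      have e1 : p 1 = q 1 := by push_cast at h2; omega
      have e2 : p 2 = q 2 := by omega
      refine decomp_of_pow (d := a) (a := q 0) (b := q 1) (c := q 2) (s := 0) ?_ fun v => ?_
      · rw [← hk, zdeg, e0, e1, e2, degA]; ring
      · rw [mono_zero_right, zmon, e0, e1, e2, coe_monA, wRes, resMonomial]; ring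
    · right
      obtain ⟨m, rfl⟩ : ∃ m, n₂ = m + 1 := ⟨n₂ - 1, by have := H.pos₂; omega⟩
      push_cast at h1 h2
      have e0 : q 0 = p 0 + (m + 1) * s + m := by zify; linarith
      have e1 : p 1 = q 1 + n₁ * s + n₁ := by zify; linarith
      have e2 : p 2 = q 2 := by omega
      refine decomp_of_star_pow (d := a) (a := p 0) (b := q 1) (c := q 2) (s := s) ?_ fun v => ?_
      · rw [← hk, zdeg, e0, e1, e2, degA, ← add_assoc n₁, Nat.add_sub_cancel]; ring
      · rw [mono_zero_right, zmon, e0, e1, e2, coe_monA, wRes, resMonomial, resField₁, star_mul',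
          star_pow, star_pow, star_star, Nat.add_sub_cancel]; ring

theorem Resonant.decomp_two (H : Resonant n₁ n₂ ω₁ ω₂ ω₃)
    {a k : ℕ} {p q : Fin 3 → ℕ} (hk : a + zdeg p q = k)
    (h : freq ω₁ ω₂ ω₃ p q = ω₂) : Decomp n₁ n₂ 1 k (fun v => v.2.2.2.1) (mono a 0 p q) ∨
      Decomp n₁ n₂ (n₁ + n₂ - 1) k (fun v => resField₂ n₁ n₂ v.2.2.1 v.2.2.2.1)
        (mono a 0 p q) := by
  obtain ⟨h3, s, ⟨h1, h2⟩ | ⟨h1, h2⟩⟩ := H.exists_int (δ₁ := 0) (δ₂ := 1) (δ₃ := 0)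
    (h.trans (by simp))
  · rcases s with _ | s
    · left
      have e0 : p 0 = q 0 := by push_cast at h1; omega
      have e1 : p 1 = q 1 + 1 := by push_cast at h2; omega
      have e2 : p 2 = q 2 := by omega
      refine decomp_of_pow (d := a) (a := q 0) (b := q 1) (c := q 2) (s := 0) ?_ fun v => ?_
      · rw [← hk, zdeg, e0, e1, e2, degA]; ring
      · rw [mono_zero_right, zmon, e0, e1, e2, coe_monA, wRes, resMonomial]; ring
    · right
      obtain ⟨m, rfl⟩ : ∃ m, n₁ = m + 1 := ⟨n₁ - 1, by have := H.pos₁; omega⟩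
      push_cast at h1 h2
      have e0 : p 0 = q 0 + n₂ * s + n₂ := by zify; linarith
      have e1 : q 1 = p 1 + (m + 1) * s + m := by zify; linarith
      have e2 : p 2 = q 2 := by omega
      refine decomp_of_pow (d := a) (a := q 0) (b := p 1) (c := q 2) (s := s) ?_ fun v => ?_
      · rw [← hk, zdeg, e0, e1, e2, degA, show m + 1 + n₂ - 1 = m + n₂ by omega]; ring
      · rw [mono_zero_right, zmon, e0, e1, e2, coe_monA, wRes, resMonomial, resField₂,
          Nat.add_sub_cancel]; ring
  · left
    have e0 : q 0 = p 0 + n₂ * s := by zify; linarith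
    have e1 : p 1 = q 1 + n₁ * s + 1 := by zify; linarith
    have e2 : p 2 = q 2 := by omega
    refine decomp_of_star_pow (d := a) (a := p 0) (b := q 1) (c := q 2) (s := s) ?_ fun v => ?_
    · rw [← hk, zdeg, e0, e1, e2, degA]; ring
    · rw [mono_zero_right, zmon, e0, e1, e2, coe_monA, wRes, resMonomial, star_mul', star_pow,
        star_pow, star_star]; ring

end Resonance

/-! ### Generators of the `φ`-reversible resonant fields. -/

section Generators

/-- The inclusion of the first complex coordinate. -/
noncomputable def slot₁ : ℂ →L[ℝ] Phase :=
  (ContinuousLinearMap.inr ℝ ℝ (ℝ × ℂ × ℂ × ℂ)).comp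
    ((ContinuousLinearMap.inr ℝ ℝ (ℂ × ℂ × ℂ)).comp (ContinuousLinearMap.inl ℝ ℂ (ℂ × ℂ)))

/-- The inclusion of the second complex coordinate. -/
noncomputable def slot₂ : ℂ →L[ℝ] Phase :=
  (ContinuousLinearMap.inr ℝ ℝ (ℝ × ℂ × ℂ × ℂ)).comp
    ((ContinuousLinearMap.inr ℝ ℝ (ℂ × ℂ × ℂ)).comp
      ((ContinuousLinearMap.inr ℝ ℂ (ℂ × ℂ)).comp (ContinuousLinearMap.inl ℝ ℂ ℂ)))

/-- The inclusion of the third complex coordinate. -/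
noncomputable def slot₃ : ℂ →L[ℝ] Phase :=
  (ContinuousLinearMap.inr ℝ ℝ (ℝ × ℂ × ℂ × ℂ)).comp
    ((ContinuousLinearMap.inr ℝ ℝ (ℂ × ℂ × ℂ)).comp
      ((ContinuousLinearMap.inr ℝ ℂ (ℂ × ℂ)).comp (ContinuousLinearMap.inr ℝ ℂ ℂ)))

theorem slot₁_apply (z : ℂ) : slot₁ z = (0, 0, z, 0, 0) := rfl
theorem slot₂_apply (z : ℂ) : slot₂ z = (0, 0, 0, z, 0) := rfl
theorem slot₃_apply (z : ℂ) : slot₃ z = (0, 0, 0, 0, z) := rfl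

theorem phi_slot₁ (z : ℂ) : phiCLM (slot₁ z) = slot₁ (star z) := by
  simp [phiCLM_apply, slot₁_apply]
theorem phi_slot₂ (z : ℂ) : phiCLM (slot₂ z) = slot₂ (star z) := by
  simp [phiCLM_apply, slot₂_apply]
theorem phi_slot₃ (z : ℂ) : phiCLM (slot₃ z) = slot₃ (star z) := by
  simp [phiCLM_apply, slot₃_apply]

variable (n₁ n₂ : ℕ)

/-- The generators of the module of vector fields of type A. -/
noncomputable def GA : Fin 12 → Phase → Phase :=
  ![fun v => (v.1 * (wRes n₁ n₂ v).im, v.2.1 * (wRes n₁ n₂ v).im, 0, 0, 0),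
    fun _ => (0, 1, 0, 0, 0),
    fun v => slot₁ (Complex.I * v.2.2.1),
    fun v => slot₁ (Complex.I * resField₁ n₁ n₂ v.2.2.1 v.2.2.2.1),
    fun v => slot₁ (v.2.2.1 * (wRes n₁ n₂ v).im),
    fun v => slot₁ (resField₁ n₁ n₂ v.2.2.1 v.2.2.2.1 * (wRes n₁ n₂ v).im),
    fun v => slot₂ (Complex.I * v.2.2.2.1),
    fun v => slot₂ (Complex.I * resField₂ n₁ n₂ v.2.2.1 v.2.2.2.1),
    fun v => slot₂ (v.2.2.2.1 * (wRes n₁ n₂ v).im),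
    fun v => slot₂ (resField₂ n₁ n₂ v.2.2.1 v.2.2.2.1 * (wRes n₁ n₂ v).im),
    fun v => slot₃ (Complex.I * v.2.2.2.2),
    fun v => slot₃ (v.2.2.2.2 * (wRes n₁ n₂ v).im)]

/-- The degrees of the generators of type A. -/
def dA : Fin 12 → ℕ :=
  ![n₁ + n₂ + 1, 0, 1, n₁ + n₂ - 1, n₁ + n₂ + 1, n₁ + n₂ + (n₁ + n₂ - 1),
    1, n₁ + n₂ - 1, n₁ + n₂ + 1, n₁ + n₂ + (n₁ + n₂ - 1), 1, n₁ + n₂ + 1]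

/-- Polynomial vector fields of type A that are homogeneous of degree `k`. -/
noncomputable def NFA (k : ℕ) : Submodule ℝ (Phase → Phase) :=
  Submodule.span ℝ {Y | ∃ i d a b p c, degA n₁ n₂ d a b p c + dA n₁ n₂ i = k ∧
    Y = fun v => monA n₁ n₂ d a b p c v • GA n₁ n₂ i v}

variable {n₁ n₂}

theorem smul_GA_mem {i : Fin 12} {e k : ℕ} (he : e = dA n₁ n₂ i) {f : Phase → ℝ}
    (hf : f ∈ Alg n₁ n₂ e k) : (fun v => f v • GA n₁ n₂ i v) ∈ NFA n₁ n₂ k := by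
  subst he
  refine Submodule.span_induction ?_ ?_ (fun f g _ _ h h' => ?_) (fun c f _ h => ?_) hf
  · rintro _ ⟨d, a, b, p, c, h, rfl⟩
    exact Submodule.subset_span ⟨i, d, a, b, p, c, h, rfl⟩
  · simp only [Pi.zero_apply, zero_smul]
    exact Submodule.zero_mem _
  · simp only [Pi.add_apply, add_smul]
    exact Submodule.add_mem _ h h'
  · simp only [Pi.smul_apply, smul_assoc]
    exact Submodule.smul_mem _ c h

/-- Since `ξ` and `A + i (Im w) B` are conjugated by `φ`, the projection replaces `c` by `(c - c̄) /
2 = i Im c`. Expanding `i ξ (A + i (Im w) B)` gives the two generators `i ξ` and `ξ Im w`, the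
second with a minus sign. -/
theorem revProj_slot_mem {e : ℂ →L[ℝ] Phase} (he : ∀ z, phiCLM (e z) = e (star z))
    {ξ u : Phase → ℂ} (hξ : ∀ v, ξ (phiCLM v) = star (ξ v)) {i i' : Fin 12} {d k : ℕ}
    (hi : ∀ v, GA n₁ n₂ i v = e (Complex.I * ξ v))
    (hi' : ∀ v, GA n₁ n₂ i' v = e (ξ v * (wRes n₁ n₂ v).im)) (hd : d = dA n₁ n₂ i)
    (hd' : n₁ + n₂ + d = dA n₁ n₂ i') (hu : Decomp n₁ n₂ d k ξ u) (c : ℂ) :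
    revProj phiCLM (fun v => e (c * u v)) ∈ NFA n₁ n₂ k := by
  obtain ⟨A, hA, B, hB, h⟩ := hu
  have key : revProj phiCLM (fun v => e (c * u v))
      = c.im • (fun v => A v • GA n₁ n₂ i v) - c.im • (fun v => B v • GA n₁ n₂ i' v) := by
    funext v
    rw [revProj_apply, he, ← map_sub, ← map_smul]
    simp only [Pi.sub_apply, Pi.smul_apply, hi, hi', ← map_smul, ← map_sub]
    congr 1
    rw [h, h, hξ, wRes_phi, alg_phi hA, alg_phi hB]
    have hc : c - star c = 2 * c.im * Complex.I := by
      rw [Complex.star_def, Complex.sub_conj]; push_cast; ring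
    simp only [star_mul', star_add, Complex.conj_conj, Complex.star_def, Complex.conj_I,
      Complex.conj_ofReal, Complex.conj_im, Complex.real_smul, Complex.ofReal_neg,
      map_neg] at hc ⊢
    push_cast
    linear_combination (1 / 2 : ℂ) * (ξ v * (A v + Complex.I * (wRes n₁ n₂ v).im * B v)) * hc
      + c.im * ξ v * (wRes n₁ n₂ v).im * B v * Complex.I_sq
  rw [key]
  exact Submodule.sub_mem _ (Submodule.smul_mem _ _ (smul_GA_mem hd hA))
    (Submodule.smul_mem _ _ (smul_GA_mem hd' hB))

variable {ω₁ ω₂ ω₃ : ℝ}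

/-- Reduction of a statement on `Res` to monomials, along a real linear map. -/
theorem map_res_mem {M : Type*} [AddCommGroup M] [Module ℝ M] (N : Submodule ℝ M)
    (T : (Phase → ℂ) →ₗ[ℝ] M) {ν : ℝ} {k : ℕ}
    (h : ∀ a p q, a + zdeg p q = k → freq ω₁ ω₂ ω₃ p q = ν →
      ∀ c : ℂ, T (fun v => c * mono a 0 p q v) ∈ N)
    {y : Phase → ℂ} (hy : y ∈ Res ω₁ ω₂ ω₃ ν k) : T y ∈ N := by
  -- `T` is only real linear while `Res` is a complex span, so the induction carries all complex
  -- multiples.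
  suffices h' : ∀ c : ℂ, T (c • y) ∈ N by simpa using h' 1
  refine Submodule.span_induction ?_ ?_ (fun f g _ _ h h' c => ?_) (fun c f _ h c' => ?_) hy
  · rintro _ ⟨a, p, q, hk, hν, rfl⟩
    exact h a p q hk hν
  · intro c
    rw [smul_zero, map_zero]
    exact N.zero_mem
  · rw [smul_add, map_add]
    exact N.add_mem (h c) (h' c)
  · rw [smul_smul]
    exact h _

/-- Postcomposition with a real linear map depending on the point, followed by the projection onto
`φ`-reversible fields. -/
noncomputable def revPost (e : Phase → ℂ →ₗ[ℝ] Phase) :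
    (Phase → ℂ) →ₗ[ℝ] (Phase → Phase) :=
  (revProj phiCLM).comp (show (Phase → ℂ) →ₗ[ℝ] (Phase → Phase) from
    { toFun := fun y v => e v (y v)
      map_add' := fun y y' => by funext v; simp
      map_smul' := fun c y => by
        funext v; simp only [Pi.smul_apply, map_smul, RingHom.id_apply] })

theorem revPost_apply (e : Phase → ℂ →ₗ[ℝ] Phase) (y : Phase → ℂ) :
    revPost e y = revProj phiCLM (fun v => e v (y v)) := rfl

/-- The map `y ↦ Re y • u`. -/
noncomputable def reSmul (u : Phase) : ℂ →ₗ[ℝ] Phase :=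
  Complex.reLm.smulRight u

theorem reSmul_apply (u : Phase) (z : ℂ) : reSmul u z = z.re • u := rfl

/-- In the radial field the projection keeps the `φ`-odd part of the coefficient, which carries `Im
w`; in the `x₂` direction it keeps the `φ`-even part, an invariant. The complex components are
covered by `revProj_slot_mem`. -/
theorem Resonant.revProj_mem (H : Resonant n₁ n₂ ω₁ ω₂ ω₃) {k : ℕ} {g y₀ y₁ y₂ y₃ : Phase → ℂ}
    (hg : g ∈ Res ω₁ ω₂ ω₃ 0 k) (hy₀ : y₀ ∈ Res ω₁ ω₂ ω₃ 0 (k + 1))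
    (hy₁ : y₁ ∈ Res ω₁ ω₂ ω₃ ω₁ (k + 1)) (hy₂ : y₂ ∈ Res ω₁ ω₂ ω₃ ω₂ (k + 1))
    (hy₃ : y₃ ∈ Res ω₁ ω₂ ω₃ ω₃ (k + 1)) :
    revProj phiCLM (fun v => ((v.1 * (g v).re, v.2.1 * (g v).re + (y₀ v).re, y₁ v, y₂ v, y₃ v) :
      Phase)) ∈ NFA n₁ n₂ (k + 1) := by
  have e : (fun v => ((v.1 * (g v).re, v.2.1 * (g v).re + (y₀ v).re, y₁ v, y₂ v, y₃ v) : Phase))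
      = (fun v => reSmul (v.1, v.2.1, 0, 0, 0) (g v)) + (fun v => reSmul (0, 1, 0, 0, 0) (y₀ v))
        + (fun v => slot₁ (y₁ v)) + (fun v => slot₂ (y₂ v)) + (fun v => slot₃ (y₃ v)) := by
    funext v
    simp [reSmul_apply, slot₁_apply, slot₂_apply, slot₃_apply, mul_comm]
  rw [e, map_add, map_add, map_add, map_add]
  refine Submodule.add_mem _ (Submodule.add_mem _ (Submodule.add_mem _ (Submodule.add_mem _ ?_ ?_)
    ?_) ?_) ?_
  · refine map_res_mem (NFA n₁ n₂ (k + 1)) (revPost fun v => reSmul (v.1, v.2.1, 0, 0, 0))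
      (fun a p q hk hν c => ?_) hg
    obtain ⟨A, hA, B, hB, h⟩ := H.decomp_zero hk hν
    rw [revPost_apply]
    have key : revProj phiCLM (fun v => reSmul (v.1, v.2.1, 0, 0, 0) (c * mono a 0 p q v))
        = (-c.im) • fun v => B v • GA n₁ n₂ 0 v := by
      funext v
      rw [revProj_apply, h, h, wRes_phi, alg_phi hA, alg_phi hB]
      simp [reSmul_apply, GA, phiCLM_apply]
      exact ⟨by ring, by ring, rfl⟩
    rw [key]
    exact Submodule.smul_mem _ _ (smul_GA_mem (by simp [dA]) (alg_shift 1 hB))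
  · refine map_res_mem (NFA n₁ n₂ (k + 1)) (revPost fun v => reSmul (0, 1, 0, 0, 0))
      (fun a p q hk hν c => ?_) hy₀
    obtain ⟨A, hA, B, hB, h⟩ := H.decomp_zero hk hν
    rw [revPost_apply]
    have key : revProj phiCLM (fun v => reSmul (0, 1, 0, 0, 0) (c * mono a 0 p q v))
        = c.re • fun v => A v • GA n₁ n₂ 1 v := by
      funext v
      rw [revProj_apply, h, h, wRes_phi, alg_phi hA, alg_phi hB]
      simp [reSmul_apply, GA, phiCLM_apply]
      exact ⟨by ring, rfl⟩
    rw [key]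
    exact Submodule.smul_mem _ _ (smul_GA_mem (by simp [dA]) hA)
  · refine map_res_mem (NFA n₁ n₂ (k + 1)) (revPost fun _ => slot₁) (fun a p q hk hν c => ?_) hy₁
    rcases H.decomp_one hk hν with h | h
    · exact revProj_slot_mem phi_slot₁ (fun v => rfl) (i := 2) (i' := 4) (fun v => rfl)
        (fun v => rfl) rfl rfl h c
    · exact revProj_slot_mem phi_slot₁ (fun v => by simp [phiCLM_apply, resField₁]) (i := 3)
        (i' := 5) (fun v => rfl) (fun v => rfl) rfl rfl h c
  · refine map_res_mem (NFA n₁ n₂ (k + 1)) (revPost fun _ => slot₂) (fun a p q hk hν c => ?_) hy₂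
    rcases H.decomp_two hk hν with h | h
    · exact revProj_slot_mem phi_slot₂ (fun v => rfl) (i := 6) (i' := 8) (fun v => rfl)
        (fun v => rfl) rfl rfl h c
    · exact revProj_slot_mem phi_slot₂ (fun v => by simp [phiCLM_apply, resField₂]) (i := 7)
        (i' := 9) (fun v => rfl) (fun v => rfl) rfl rfl h c
  · refine map_res_mem (NFA n₁ n₂ (k + 1)) (revPost fun _ => slot₃) (fun a p q hk hν c => ?_) hy₃
    exact revProj_slot_mem phi_slot₃ (fun v => rfl) (i := 10) (i' := 11) (fun v => rfl)
      (fun v => rfl) rfl rfl (H.decomp_three hk hν) c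

end Generators

/-! ### Action of the second involution on invariants and generators. -/

section Second

variable {n₁ n₂ : ℕ} (a₀ a₁ a₂ a₃ : ℝ)

/-- The involution `ψ` as a continuous linear map. -/
noncomputable def psiCLM : Phase →L[ℝ] Phase :=
  LinearMap.toContinuousLinearMap
    { toFun := psi a₀ a₁ a₂ a₃
      map_add' := fun u v => by
        simp only [psi, Prod.mk_add_mk, star_add, neg_add, mul_add]
      map_smul' := fun t v => by
        simp only [psi, Prod.smul_mk, Prod.smul_fst, Prod.smul_snd, smul_eq_mul, Complex.real_smul,
          star_mul', Complex.star_def, Complex.conj_ofReal, RingHom.id_apply, Prod.mk.injEq]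
        refine ⟨?_, ?_, ?_, ?_, ?_⟩ <;> ring }

theorem psiCLM_apply (v : Phase) : psiCLM a₀ a₁ a₂ a₃ v =
    (a₀ * v.1, -(a₀ * v.2.1), a₁ * star v.2.2.1, a₂ * star v.2.2.2.1, a₃ * star v.2.2.2.2) := rfl

/-- The signs of the generators of type A under `φψ`. -/
noncomputable def eps (s : ℝ) : Fin 12 → ℝ := ![s, a₀, 1, s, s, 1, 1, s, s, 1, 1, s]

variable {a₀ a₁ a₂ a₃}

theorem wRes_psi (v : Phase) : wRes n₁ n₂ (psiCLM a₀ a₁ a₂ a₃ v)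
    = ((a₁ ^ n₂ * a₂ ^ n₁ : ℝ) : ℂ) * star (wRes n₁ n₂ v) := by
  simp only [wRes, resMonomial, psiCLM_apply, star_mul', Complex.star_def, Complex.conj_ofReal,
    mul_pow, map_pow]
  push_cast
  ring

theorem norm_sign_mul {a : ℝ} (ha : a ^ 2 = 1) (z : ℂ) : ‖(a : ℂ) * star z‖ ^ 2 = ‖z‖ ^ 2 := by
  rw [norm_mul, norm_star, mul_pow, Complex.norm_real, Real.norm_eq_abs, sq_abs, ha, one_mul]

theorem monA_psi (h₁ : a₁ ^ 2 = 1) (h₂ : a₂ ^ 2 = 1) (h₃ : a₃ ^ 2 = 1) (d a b p c : ℕ)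
    (v : Phase) : monA n₁ n₂ d a b p c (psiCLM a₀ a₁ a₂ a₃ v)
      = a₀ ^ d * (a₁ ^ n₂ * a₂ ^ n₁) ^ p * monA n₁ n₂ d a b p c v := by
  simp only [monA, wRes_psi, Complex.re_ofReal_mul]
  simp only [psiCLM_apply, norm_sign_mul h₁, norm_sign_mul h₂, norm_sign_mul h₃]
  simp only [Complex.star_def, Complex.conj_re]
  ring

/-- The sign `a₁ ^ (n₂ - 1)` equals `a₁ ^ n₂ * a₁` because `a₁ ^ 2 = 1`; in this form the total sign
is that of `w` times that of the component. -/
theorem resField₁_psi (hn₂ : 0 < n₂) (h₁ : a₁ ^ 2 = 1) (v : Phase) :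
    resField₁ n₁ n₂ (a₁ * star v.2.2.1) (a₂ * star v.2.2.2.1)
      = ((a₁ ^ n₂ * a₂ ^ n₁ : ℝ) : ℂ) * a₁ * star (resField₁ n₁ n₂ v.2.2.1 v.2.2.2.1) := by
  obtain ⟨m, rfl⟩ : ∃ m, n₂ = m + 1 := ⟨n₂ - 1, by omega⟩
  have h : (a₁ : ℂ) ^ 2 = 1 := by exact_mod_cast h₁
  simp only [resField₁, Nat.add_sub_cancel, star_mul', star_pow, Complex.conj_conj,
    Complex.star_def,
    Complex.conj_ofReal, mul_pow]
  push_cast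
  linear_combination (-(a₁ : ℂ) ^ m * a₂ ^ n₁ * (v.2.2.1 ^ m
    * (starRingEnd ℂ v.2.2.2.1) ^ n₁)) * h

theorem resField₂_psi (hn₁ : 0 < n₁) (h₂ : a₂ ^ 2 = 1) (v : Phase) :
    resField₂ n₁ n₂ (a₁ * star v.2.2.1) (a₂ * star v.2.2.2.1)
      = ((a₁ ^ n₂ * a₂ ^ n₁ : ℝ) : ℂ) * a₂ * star (resField₂ n₁ n₂ v.2.2.1 v.2.2.2.1) := by
  obtain ⟨m, rfl⟩ : ∃ m, n₁ = m + 1 := ⟨n₁ - 1, by omega⟩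
  have h : (a₂ : ℂ) ^ 2 = 1 := by exact_mod_cast h₂
  simp only [resField₂, Nat.add_sub_cancel, star_mul', star_pow, Complex.conj_conj,
    Complex.star_def,
    Complex.conj_ofReal, mul_pow]
  push_cast
  linear_combination (-(a₂ : ℂ) ^ m * a₁ ^ n₂ * (v.2.2.2.1 ^ m
    * (starRingEnd ℂ v.2.2.1) ^ n₂)) * h

/-- Every generator is `ψ`-reversible up to the sign `eps`. The component signs `a₁`, `a₂`, `a₃` are
absorbed by the outer `ψ`, so only `a₀` and `s` remain. -/
theorem GA_psi (hn₁ : 0 < n₁) (hn₂ : 0 < n₂) (h₀ : a₀ ^ 2 = 1) (h₁ : a₁ ^ 2 = 1)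
    (h₂ : a₂ ^ 2 = 1) {s : ℝ} (hs : a₁ ^ n₂ * a₂ ^ n₁ = s) (hs2 : s ^ 2 = 1) (i : Fin 12)
    (v : Phase) : GA n₁ n₂ i (psiCLM a₀ a₁ a₂ a₃ v)
      = -(eps a₀ s i • psiCLM a₀ a₁ a₂ a₃ (GA n₁ n₂ i v)) := by
  have hw := wRes_psi (n₁ := n₁) (n₂ := n₂) (a₀ := a₀) (a₁ := a₁) (a₂ := a₂) (a₃ := a₃) v
  have him : (wRes n₁ n₂ (psiCLM a₀ a₁ a₂ a₃ v)).im = -(s * (wRes n₁ n₂ v).im) := by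
    rw [hw, hs, Complex.im_ofReal_mul]; simp
  have hq1 := resField₁_psi (n₁ := n₁) (a₂ := a₂) hn₂ h₁ v
  have hq2 := resField₂_psi (n₂ := n₂) (a₁ := a₁) hn₁ h₂ v
  rw [hs] at hq1 hq2
  have hsC : (s : ℂ) ^ 2 = 1 := by exact_mod_cast hs2
  rw [psiCLM_apply] at him ⊢
  fin_cases i <;> simp only [GA, eps, Fin.zero_eta, Fin.mk_one, Fin.reduceFinMk, Fin.isValue,
    Matrix.cons_val, him, hq1, hq2] <;> rw [psiCLM_apply] <;>
    simp only [slot₁_apply, slot₂_apply, slot₃_apply, Prod.smul_mk, Prod.neg_mk, smul_eq_mul,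
      star_zero, mul_zero, neg_zero, smul_zero, Complex.real_smul, Prod.mk.injEq, star_mul',
      Complex.star_def, Complex.conj_I, Complex.conj_ofReal, true_and, and_true,
      Complex.ofReal_neg, Complex.ofReal_mul, Complex.ofReal_one, one_mul, mul_one] <;>
    first
    | ring1
    | (refine ⟨?_, ?_⟩ <;> ring1)
    | linear_combination -h₀
    | linear_combination (-(a₁ : ℂ) * (starRingEnd ℂ (resField₁ n₁ n₂ v.2.2.1 v.2.2.2.1)
        * (wRes n₁ n₂ v).im)) * hsC
    | linear_combination (-(a₂ : ℂ) * (starRingEnd ℂ (resField₂ n₁ n₂ v.2.2.1 v.2.2.2.1)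
        * (wRes n₁ n₂ v).im)) * hsC

end Second

/-! ### Homogeneous fields with coefficients in prescribed invariants. -/

section NormalForm

variable {ι κ : Type*} [Fintype ι] [Fintype κ]

/-- The vector fields `∑ i, P i (U v) • G i v`, homogeneous of degree `k`. -/
noncomputable def NF (w : κ → ℕ) (U : Phase → κ → ℝ) (G : ι → Phase → Phase) (d : ι → ℕ) (k : ℕ) :
    Submodule ℝ (Phase → Phase) where
  carrier := {Y | ∃ P : ι → (κ → ℝ) → ℝ, (∀ i, IsCoeff w (d i) k (P i)) ∧
    ∀ v, Y v = ∑ i, P i (U v) • G i v}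
  zero_mem' := ⟨fun _ _ => 0, fun i => isCoeff_zero w (d i) k, fun v => by simp⟩
  add_mem' := by
    rintro Y Y' ⟨P, hP, h⟩ ⟨P', hP', h'⟩
    refine ⟨fun i u => P i u + P' i u, fun i => ⟨(hP i).1.add (hP' i).1, fun t u => ?_⟩,
      fun v => ?_⟩
    · rw [mul_add, (hP i).2, (hP' i).2, mul_add]
    · simp only [Pi.add_apply, h, h', add_smul, Finset.sum_add_distrib]
  smul_mem' := by
    rintro c Y ⟨P, hP, h⟩
    refine ⟨fun i u => c * P i u, fun i => ⟨contDiff_const.mul (hP i).1, fun t u => ?_⟩,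
      fun v => ?_⟩
    · rw [mul_left_comm, (hP i).2, mul_left_comm]
    · simp only [Pi.smul_apply, h, Finset.smul_sum, smul_smul]

theorem monomial_smul_mem {w : κ → ℕ} {U : Phase → κ → ℝ} {G : ι → Phase → Phase} {d : ι → ℕ}
    {k : ℕ} (j : ι) (m : κ → ℕ) (h : ∑ x, w x * m x + d j = k) {Y : Phase → Phase}
    (hY : ∀ v, Y v = (∏ x, U v x ^ m x) • G j v) : Y ∈ NF w U G d k := by
  classical
  refine ⟨fun i u => if i = j then ∏ x, u x ^ m x else 0, fun i => ?_, fun v => ?_⟩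
  · by_cases hi : i = j
    · subst hi
      simp only [if_true]
      refine ⟨contDiff_prod fun x _ => (contDiff_apply ℝ ℝ x).pow _, fun t u => ?_⟩
      simp only [dil_apply, mul_pow, Finset.prod_mul_distrib, ← pow_mul, Finset.prod_pow_eq_pow_sum]
      rw [← h, pow_add]
      ring
    · simp only [if_neg hi]
      exact isCoeff_zero w (d i) k
  · rw [hY]
    simp [Finset.sum_ite_eq', ite_smul]

end NormalForm

/-! ### The two commuting involutions and the linear part. -/

section Involutions

variable {a₀ a₁ a₂ a₃ : ℝ}

theorem psiCLM_psiCLM (h₀ : a₀ ^ 2 = 1) (h₁ : a₁ ^ 2 = 1) (h₂ : a₂ ^ 2 = 1) (h₃ : a₃ ^ 2 = 1)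
    (v : Phase) : psiCLM a₀ a₁ a₂ a₃ (psiCLM a₀ a₁ a₂ a₃ v) = v := by
  have h {a : ℝ} (ha : a ^ 2 = 1) (z : ℂ) : (a : ℂ) * star ((a : ℂ) * star z) = z := by
    have haC : (a : ℂ) ^ 2 = 1 := by exact_mod_cast ha
    simp only [star_mul', Complex.star_def, Complex.conj_conj, Complex.conj_ofReal]
    linear_combination z * haC
  simp only [psiCLM_apply, h h₁, h h₂, h h₃]
  refine Prod.ext ?_ (Prod.ext ?_ rfl)
  · simp only
    linear_combination v.1 * h₀
  · simp only
    linear_combination v.2.1 * h₀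

theorem phiCLM_phiCLM (v : Phase) : phiCLM (phiCLM v) = v := by
  simp [phiCLM_apply]

theorem phiCLM_psiCLM (v : Phase) :
    phiCLM (psiCLM a₀ a₁ a₂ a₃ v) = psiCLM a₀ a₁ a₂ a₃ (phiCLM v) := by
  simp [phiCLM_apply, psiCLM_apply]

theorem linCLM_phi (ω₁ ω₂ ω₃ : ℝ) (v : Phase) :
    linCLM ω₁ ω₂ ω₃ (phiCLM v) = -phiCLM (linCLM ω₁ ω₂ ω₃ v) := by
  simp [phiCLM_apply, linCLM_apply]

theorem linCLM_psi (ω₁ ω₂ ω₃ : ℝ) (v : Phase) :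
    linCLM ω₁ ω₂ ω₃ (psiCLM a₀ a₁ a₂ a₃ v) = -psiCLM a₀ a₁ a₂ a₃ (linCLM ω₁ ω₂ ω₃ v) := by
  simp [psiCLM_apply, linCLM_apply]
  refine ⟨?_, ?_, ?_⟩ <;> ring

end Involutions

/-! ### Degrees of the invariants and generators. -/

section Homogeneous

variable (n₁ n₂ : ℕ)

theorem isHom_wRes : IsHom (n₁ + n₂) (wRes n₁ n₂) := by
  have h := isHom_mono 0 0 ![n₂, 0, 0] ![0, n₁, 0]
  have e : mono 0 0 ![n₂, 0, 0] ![0, n₁, 0] = wRes n₁ n₂ := by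
    funext v
    simp [mono, zmon, wRes, resMonomial]
  rw [e] at h
  simpa [zdeg, add_comm] using h

theorem isHom_resField₁ (hn₂ : 0 < n₂) :
    IsHom (n₁ + n₂ - 1) fun v : Phase => resField₁ n₁ n₂ v.2.2.1 v.2.2.2.1 := by
  have h := isHom_mono 0 0 ![0, n₁, 0] ![n₂ - 1, 0, 0]
  have e : mono 0 0 ![0, n₁, 0] ![n₂ - 1, 0, 0]
      = fun v : Phase => resField₁ n₁ n₂ v.2.2.1 v.2.2.2.1 := by
    funext v
    simp [mono, zmon, resField₁]
  have hd : 0 + 0 + zdeg ![0, n₁, 0] ![n₂ - 1, 0, 0] = n₁ + n₂ - 1 := by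
    simp [zdeg]; omega
  rwa [e, hd] at h

theorem isHom_resField₂ (hn₁ : 0 < n₁) :
    IsHom (n₁ + n₂ - 1) fun v : Phase => resField₂ n₁ n₂ v.2.2.1 v.2.2.2.1 := by
  have h := isHom_mono 0 0 ![n₂, 0, 0] ![0, n₁ - 1, 0]
  have e : mono 0 0 ![n₂, 0, 0] ![0, n₁ - 1, 0]
      = fun v : Phase => resField₂ n₁ n₂ v.2.2.1 v.2.2.2.1 := by
    funext v
    simp [mono, zmon, resField₂]
  have hd : 0 + 0 + zdeg ![n₂, 0, 0] ![0, n₁ - 1, 0] = n₁ + n₂ - 1 := by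
    simp [zdeg]; omega
  rwa [e, hd] at h

theorem isHom_fst : IsHom 1 fun v : Phase => v.1 :=
  isHom_clm (ContinuousLinearMap.fst ℝ ℝ (ℝ × ℂ × ℂ × ℂ))

theorem isHom_z₁ : IsHom 1 fun v : Phase => v.2.2.1 :=
  isHom_clm ((ContinuousLinearMap.fst ℝ ℂ (ℂ × ℂ)).comp
    ((ContinuousLinearMap.snd ℝ ℝ (ℂ × ℂ × ℂ)).comp
      (ContinuousLinearMap.snd ℝ ℝ (ℝ × ℂ × ℂ × ℂ))))

theorem isHom_z₂ : IsHom 1 fun v : Phase => v.2.2.2.1 :=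
  isHom_clm ((ContinuousLinearMap.fst ℝ ℂ ℂ).comp ((ContinuousLinearMap.snd ℝ ℂ (ℂ × ℂ)).comp
    ((ContinuousLinearMap.snd ℝ ℝ (ℂ × ℂ × ℂ)).comp
      (ContinuousLinearMap.snd ℝ ℝ (ℝ × ℂ × ℂ × ℂ)))))

theorem isHom_z₃ : IsHom 1 fun v : Phase => v.2.2.2.2 :=
  isHom_clm ((ContinuousLinearMap.snd ℝ ℂ ℂ).comp ((ContinuousLinearMap.snd ℝ ℂ (ℂ × ℂ)).comp
    ((ContinuousLinearMap.snd ℝ ℝ (ℂ × ℂ × ℂ)).comp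
      (ContinuousLinearMap.snd ℝ ℝ (ℝ × ℂ × ℂ × ℂ)))))

theorem IsHom.norm_sq {E : Type*} [NormedAddCommGroup E] [NormedSpace ℝ E] {g : E → ℂ} {k : ℕ}
    (hg : IsHom k g) : IsHom (2 * k) fun v => ‖g v‖ ^ 2 := by
  refine ⟨hg.1.norm_sq ℝ, fun t v => ?_⟩
  simp only
  rw [hg.2, norm_smul, mul_pow, norm_pow, Real.norm_eq_abs, ← pow_mul, mul_comm k 2, pow_mul,
    sq_abs, ← pow_mul, smul_eq_mul]

theorem isHom_re_wRes : IsHom (n₁ + n₂) fun v => (wRes n₁ n₂ v).re :=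
  (isHom_wRes n₁ n₂).clm_comp Complex.reCLM

theorem isHom_im_wRes : IsHom (n₁ + n₂) fun v => (wRes n₁ n₂ v).im :=
  (isHom_wRes n₁ n₂).clm_comp Complex.imCLM

theorem IsHom.mul_im_wRes {g : Phase → ℂ} {k : ℕ} (hg : IsHom k g) :
    IsHom (n₁ + n₂ + k) fun v => g v * (wRes n₁ n₂ v).im := by
  have h := (isHom_im_wRes n₁ n₂).smul hg
  simpa only [Complex.real_smul, mul_comm] using h

theorem isHom_GA (hn₁ : 0 < n₁) (hn₂ : 0 < n₂) (i : Fin 12) :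
    IsHom (dA n₁ n₂ i) (GA n₁ n₂ i) := by
  have hq1 := isHom_resField₁ n₁ n₂ hn₂
  have hq2 := isHom_resField₂ n₁ n₂ hn₁
  fin_cases i
  · have h := (isHom_im_wRes n₁ n₂).smul (isHom_clm
      ((ContinuousLinearMap.fst ℝ ℝ (ℝ × ℂ × ℂ × ℂ)).prod
        (((ContinuousLinearMap.fst ℝ ℝ (ℂ × ℂ × ℂ)).comp
          (ContinuousLinearMap.snd ℝ ℝ (ℝ × ℂ × ℂ × ℂ))).prod (0 : Phase →L[ℝ] ℂ × ℂ × ℂ))))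
    have e : GA n₁ n₂ 0 = _ := funext fun v => by
      change (v.1 * (wRes n₁ n₂ v).im, v.2.1 * (wRes n₁ n₂ v).im, (0 : ℂ), (0 : ℂ), (0 : ℂ))
        = (wRes n₁ n₂ v).im • ((v.1, v.2.1, 0, 0, 0) : Phase)
      simp [mul_comm]
    exact e ▸ h
  · refine ⟨contDiff_const, fun t v => ?_⟩
    simp [GA, dA]
  · exact (isHom_const_mul Complex.I isHom_z₁).clm_comp slot₁
  · exact (isHom_const_mul Complex.I hq1).clm_comp slot₁
  · exact (isHom_z₁.mul_im_wRes n₁ n₂).clm_comp slot₁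
  · exact (hq1.mul_im_wRes n₁ n₂).clm_comp slot₁
  · exact (isHom_const_mul Complex.I isHom_z₂).clm_comp slot₂
  · exact (isHom_const_mul Complex.I hq2).clm_comp slot₂
  · exact (isHom_z₂.mul_im_wRes n₁ n₂).clm_comp slot₂
  · exact (hq2.mul_im_wRes n₁ n₂).clm_comp slot₂
  · exact (isHom_const_mul Complex.I isHom_z₃).clm_comp slot₃
  · exact (isHom_z₃.mul_im_wRes n₁ n₂).clm_comp slot₃

/-- The factors `1`, `x₁` and `Re w` multiplying the generators. -/
noncomputable def cfac : Fin 3 → Phase → ℝ :=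
  ![fun _ => 1, fun v => v.1, fun v => (wRes n₁ n₂ v).re]

/-- The degrees of the factors. -/
def cdeg : Fin 3 → ℕ := ![0, 1, n₁ + n₂]

/-- A factor times a generator. -/
noncomputable def gen (c : Fin 3 × Fin 12) (v : Phase) : Phase :=
  cfac n₁ n₂ c.1 v • GA n₁ n₂ c.2 v

/-- The degree of `gen`. -/
def genDeg (c : Fin 3 × Fin 12) : ℕ := cdeg n₁ n₂ c.1 + dA n₁ n₂ c.2

theorem isHom_gen (hn₁ : 0 < n₁) (hn₂ : 0 < n₂) (c : Fin 3 × Fin 12) :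
    IsHom (genDeg n₁ n₂ c) (gen n₁ n₂ c) := by
  refine IsHom.smul ?_ (isHom_GA n₁ n₂ hn₁ hn₂ c.2)
  obtain ⟨j, i⟩ := c
  fin_cases j
  · exact ⟨contDiff_const, fun t v => by simp [cfac, cdeg]⟩
  · exact isHom_fst
  · exact isHom_re_wRes n₁ n₂

end Homogeneous

/-! ### Solvability with both symmetries imposed. -/

section Solving

variable {n₁ n₂ : ℕ} {ω₁ ω₂ ω₃ a₀ a₁ a₂ a₃ s : ℝ} {ι κ : Type*} [Fintype ι] [Fintype κ]

/-- The sign in the scalar is `±1`, so this scalar is `1` or `0`: averaging over `ψ` only selects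
monomials and creates no new terms. -/
theorem revProj_psi_smul_GA (hn₁ : 0 < n₁) (hn₂ : 0 < n₂) (h₀ : a₀ ^ 2 = 1) (h₁ : a₁ ^ 2 = 1)
    (h₂ : a₂ ^ 2 = 1) (h₃ : a₃ ^ 2 = 1) (hs : a₁ ^ n₂ * a₂ ^ n₁ = s) (hs2 : s ^ 2 = 1)
    (d a b p c : ℕ) (i : Fin 12) :
    revProj (psiCLM a₀ a₁ a₂ a₃) (fun v => monA n₁ n₂ d a b p c v • GA n₁ n₂ i v)
      = ((1 + a₀ ^ d * s ^ p * eps a₀ s i) / 2) •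
        fun v => monA n₁ n₂ d a b p c v • GA n₁ n₂ i v := by
  funext v
  rw [revProj_apply, monA_psi h₁ h₂ h₃, hs, GA_psi hn₁ hn₂ h₀ h₁ h₂ hs hs2]
  simp only [map_smul, map_neg, psiCLM_psiCLM h₀ h₁ h₂ h₃, Pi.smul_apply]
  module

/-- Solvability of the homological equation for the group generated by `φ` and `ψ`, reduced to
monomials. -/
theorem Resonant.solvable (H : Resonant n₁ n₂ ω₁ ω₂ ω₃) (h₀ : a₀ ^ 2 = 1) (h₁ : a₁ ^ 2 = 1)
    (h₂ : a₂ ^ 2 = 1) (h₃ : a₃ ^ 2 = 1) (hs : a₁ ^ n₂ * a₂ ^ n₁ = s) (hs2 : s ^ 2 = 1)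
    {w : κ → ℕ} {U : Phase → κ → ℝ} {G : ι → Phase → Phase} {δ : ι → ℕ}
    (hmon : ∀ k d a b p c i, degA n₁ n₂ d a b p c + dA n₁ n₂ i = k →
      a₀ ^ d * s ^ p * eps a₀ s i = -1 ∨
        (fun v => monA n₁ n₂ d a b p c v • GA n₁ n₂ i v) ∈ NF w U G δ k) :
    Solvable (linCLM ω₁ ω₂ ω₃) {phiCLM, psiCLM a₀ a₁ a₂ a₃} w U G δ := by
  intro k hk Z hZ hZΓ
  obtain ⟨k, rfl⟩ : ∃ k', k = k' + 1 := ⟨k - 1, by omega⟩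
  have hZφ := hZΓ phiCLM (by simp)
  have hZψ := hZΓ (psiCLM a₀ a₁ a₂ a₃) (by simp)
  obtain ⟨h, hh, g, hg, y₀, hy₀, y₁, hy₁, y₂, hy₂, y₃, hy₃, hY⟩ :=
    exists_homological (ω₁ := ω₁) (ω₂ := ω₂) (ω₃ := ω₃) hZ
  obtain ⟨h', hh', hφ', hY', -⟩ :=
    exists_averaged_solution phiCLM_phiCLM (linCLM_phi ω₁ ω₂ ω₃) hZφ hh hY
  -- Averaging over `ψ` preserves the `φ`-equivariance already obtained because the involutions
  -- commute; `hcomm` records this.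
  obtain ⟨h'', hh'', hψ'', hY'', hcomm⟩ :=
    exists_averaged_solution (psiCLM_psiCLM h₀ h₁ h₂ h₃) (linCLM_psi ω₁ ω₂ ω₃) hZψ hh' hY'
  have hmem := H.revProj_mem hg hy₀ hy₁ hy₂ hy₃
  suffices hNF : ∀ Y ∈ NFA n₁ n₂ (k + 1), revProj (psiCLM a₀ a₁ a₂ a₃) Y ∈ NF w U G δ (k + 1) by
    obtain ⟨P, hP, hPY⟩ := hNF _ hmem
    refine ⟨h'', P, hh'', ?_, hP, fun v => by rw [hY'', ← hPY]⟩
    rintro _ (rfl | rfl)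
    · exact hcomm phiCLM (fun v => (phiCLM_psiCLM v).symm) hφ'
    · exact hψ''
  intro Y hYm
  refine Submodule.span_induction ?_ ?_ (fun f g _ _ h h' => ?_) (fun c f _ h => ?_) hYm
  · rintro _ ⟨i, d, a, b, p, c, hk', rfl⟩
    rw [revProj_psi_smul_GA H.pos₁ H.pos₂ h₀ h₁ h₂ h₃ hs hs2]
    rcases hmon _ d a b p c i hk' with h | h
    · rw [h]
      norm_num
    · exact Submodule.smul_mem _ _ h
  · rw [map_zero]
    exact Submodule.zero_mem _
  · rw [map_add]
    exact Submodule.add_mem _ h h'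
  · rw [map_smul]
    exact Submodule.smul_mem _ c h

/-- The normal form theorem for given invariants and generators. -/
theorem Resonant.exists_normalForm (H : Resonant n₁ n₂ ω₁ ω₂ ω₃) (h₀ : a₀ ^ 2 = 1)
    (h₁ : a₁ ^ 2 = 1) (h₂ : a₂ ^ 2 = 1) (h₃ : a₃ ^ 2 = 1) (hs : a₁ ^ n₂ * a₂ ^ n₁ = s)
    (hs2 : s ^ 2 = 1) {X : Phase → Phase} (hX : ContDiff ℝ ∞ X) (hX0 : X 0 = 0)
    (hL : ∀ v, fderiv ℝ X 0 v = linearPart ω₁ ω₂ ω₃ v) (hφ : IsReversingSymmetry phi X)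
    (hψ : IsReversingSymmetry (psi a₀ a₁ a₂ a₃) X)
    {w : κ → ℕ} {U : Phase → κ → ℝ} (hw : ∀ i, 1 ≤ w i) (hU : ∀ i, IsHom (w i) fun v => U v i)
    (τ : ι → Fin 3 × Fin 12)
    (hmon : ∀ k d a b p c i, degA n₁ n₂ d a b p c + dA n₁ n₂ i = k →
      a₀ ^ d * s ^ p * eps a₀ s i = -1 ∨ (fun v => monA n₁ n₂ d a b p c v • GA n₁ n₂ i v) ∈
        NF w U (fun j => gen n₁ n₂ (τ j)) (fun j => genDeg n₁ n₂ (τ j)) k) :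
    ∃ f : ι → (κ → ℝ) → ℝ, (∀ i, ContDiff ℝ ∞ (f i)) ∧
      FormallyConjugate X (fun v => linCLM ω₁ ω₂ ω₃ v + ∑ i, f i (U v) • gen n₁ n₂ (τ i) v) := by
  refine exists_formallyConjugate (Γ := {phiCLM, psiCLM a₀ a₁ a₂ a₃}) (w := w)
    (d := fun j => genDeg n₁ n₂ (τ j)) (contDiff_pi.2 fun i => (hU i).1) hw
    (fun t v => ?_) (fun i => isHom_gen n₁ n₂ H.pos₁ H.pos₂ _) ?_
    (H.solvable h₀ h₁ h₂ h₃ hs hs2 hmon) hX hX0 (ContinuousLinearMap.ext hL) ?_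
  · funext i
    rw [dil_apply]
    exact (hU i).2 t v
  · rintro _ (rfl | rfl)
    · exact linCLM_phi ω₁ ω₂ ω₃
    · exact linCLM_psi ω₁ ω₂ ω₃
  · rintro _ (rfl | rfl)
    · exact hφ
    · exact hψ

end Solving

/-! ### The four types, by parity of the exponents. -/

section Types

variable {n₁ n₂ : ℕ} {ω₁ ω₂ ω₃ : ℝ} {ι κ : Type*} [Fintype ι] [Fintype κ]

theorem monA_smul_mem {w : κ → ℕ} {U : Phase → κ → ℝ} {τ : ι → Fin 3 × Fin 12} {k d a b p c : ℕ}
    {i : Fin 12} {l : Fin 3} (hk : degA n₁ n₂ d a b p c + dA n₁ n₂ i = k) (m : κ → ℕ)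
    (hj : ∃ j, τ j = (l, i)) (hm : ∑ x, w x * m x + cdeg n₁ n₂ l = degA n₁ n₂ d a b p c)
    (hf : ∀ v, monA n₁ n₂ d a b p c v = (∏ x, U v x ^ m x) * cfac n₁ n₂ l v) :
    (fun v => monA n₁ n₂ d a b p c v • GA n₁ n₂ i v) ∈
      NF w U (fun j => gen n₁ n₂ (τ j)) (fun j => genDeg n₁ n₂ (τ j)) k := by
  obtain ⟨j, hj⟩ := hj
  refine monomial_smul_mem j m ?_ fun v => ?_
  · rw [hj, genDeg, ← hk, ← hm, add_assoc]
  · rw [hj, gen, hf, mul_smul]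

variable (n₁ n₂)

/-- The invariants of type A. -/
noncomputable def invA (v : Phase) : Fin 5 → ℝ :=
  ![v.1, ‖v.2.2.1‖ ^ 2, ‖v.2.2.2.1‖ ^ 2, (wRes n₁ n₂ v).re, ‖v.2.2.2.2‖ ^ 2]

/-- The invariants of type B. -/
noncomputable def invB (v : Phase) : Fin 5 → ℝ :=
  ![v.1, ‖v.2.2.1‖ ^ 2, ‖v.2.2.2.1‖ ^ 2, (wRes n₁ n₂ v).re ^ 2, ‖v.2.2.2.2‖ ^ 2]

/-- The invariants of type C. -/
noncomputable def invC (v : Phase) : Fin 5 → ℝ :=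
  ![v.1 ^ 2, ‖v.2.2.1‖ ^ 2, ‖v.2.2.2.1‖ ^ 2, (wRes n₁ n₂ v).re, ‖v.2.2.2.2‖ ^ 2]

/-- The invariants of type D. -/
noncomputable def invD (v : Phase) : Fin 6 → ℝ :=
  ![v.1 ^ 2, ‖v.2.2.1‖ ^ 2, ‖v.2.2.2.1‖ ^ 2, (wRes n₁ n₂ v).re ^ 2, v.1 * (wRes n₁ n₂ v).re,
    ‖v.2.2.2.2‖ ^ 2]

variable {n₁ n₂}

/-- The generators of type A. -/
def genA : Fin 12 → Fin 3 × Fin 12 := fun i => (0, i)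

/-- The generators of type B. -/
def genB : Fin 12 → Fin 3 × Fin 12 :=
  ![(2, 0), (0, 1), (0, 2), (0, 5), (2, 3), (2, 4), (0, 6), (0, 9), (2, 7), (2, 8), (0, 10),
    (2, 11)]

/-- The generators of type C. -/
def genC : Fin 12 → Fin 3 × Fin 12 :=
  ![(0, 0), (1, 1), (0, 2), (0, 3), (0, 4), (0, 5), (0, 6), (0, 7), (0, 8), (0, 9), (0, 10),
    (0, 11)]

/-- The generators of type D. -/
def genD : Fin 19 → Fin 3 × Fin 12 :=
  ![(1, 0), (2, 0), (1, 1), (2, 1), (0, 2), (0, 5), (1, 3), (1, 4), (2, 3), (2, 4), (0, 6), (0, 9),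
    (1, 7), (1, 8), (2, 7), (2, 8), (0, 10), (1, 11), (2, 11)]

theorem isHom_z₁_sq : IsHom 2 fun v : Phase => ‖v.2.2.1‖ ^ 2 := isHom_z₁.norm_sq
theorem isHom_z₂_sq : IsHom 2 fun v : Phase => ‖v.2.2.2.1‖ ^ 2 := isHom_z₂.norm_sq
theorem isHom_z₃_sq : IsHom 2 fun v : Phase => ‖v.2.2.2.2‖ ^ 2 := isHom_z₃.norm_sq

theorem IsHom.sq {E : Type*} [NormedAddCommGroup E] [NormedSpace ℝ E] {g : E → ℝ} {k : ℕ}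
    (hg : IsHom k g) : IsHom (2 * k) fun v => g v ^ 2 := by
  simpa only [smul_eq_mul, ← pow_two, two_mul] using hg.smul hg

theorem isHom_invA (i : Fin 5) : IsHom (![1, 2, 2, n₁ + n₂, 2] i) fun v => invA n₁ n₂ v i := by
  fin_cases i
  exacts [isHom_fst, isHom_z₁_sq, isHom_z₂_sq, isHom_re_wRes n₁ n₂, isHom_z₃_sq]

theorem isHom_invB (i : Fin 5) :
    IsHom (![1, 2, 2, 2 * (n₁ + n₂), 2] i) fun v => invB n₁ n₂ v i := by
  fin_cases i
  exacts [isHom_fst, isHom_z₁_sq, isHom_z₂_sq, (isHom_re_wRes n₁ n₂).sq, isHom_z₃_sq]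

theorem isHom_invC (i : Fin 5) : IsHom (![2, 2, 2, n₁ + n₂, 2] i) fun v => invC n₁ n₂ v i := by
  fin_cases i
  exacts [isHom_fst.sq, isHom_z₁_sq, isHom_z₂_sq, isHom_re_wRes n₁ n₂, isHom_z₃_sq]

theorem isHom_invD (i : Fin 6) :
    IsHom (![2, 2, 2, 2 * (n₁ + n₂), 1 + (n₁ + n₂), 2] i) fun v => invD n₁ n₂ v i := by
  fin_cases i
  exacts [isHom_fst.sq, isHom_z₁_sq, isHom_z₂_sq, (isHom_re_wRes n₁ n₂).sq,
    isHom_fst.smul (isHom_re_wRes n₁ n₂), isHom_z₃_sq]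

/-- A generator with sign `1` enters the normal form by itself, one with sign `-1` after
multiplication by the sign-changing factor `Re w`. The corresponding factor is `x₁` in type C, and
either of the two in type D. -/
theorem exists_genB (i : Fin 12) : (eps 1 (-1) i = 1 ∧ ∃ j, genB j = (0, i)) ∨
    (eps 1 (-1) i = -1 ∧ ∃ j, genB j = (2, i)) := by
  fin_cases i
  exacts [.inr ⟨rfl, 0, rfl⟩, .inl ⟨rfl, 1, rfl⟩, .inl ⟨rfl, 2, rfl⟩, .inr ⟨rfl, 4, rfl⟩,
    .inr ⟨rfl, 5, rfl⟩, .inl ⟨rfl, 3, rfl⟩, .inl ⟨rfl, 6, rfl⟩, .inr ⟨rfl, 8, rfl⟩,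
    .inr ⟨rfl, 9, rfl⟩, .inl ⟨rfl, 7, rfl⟩, .inl ⟨rfl, 10, rfl⟩, .inr ⟨rfl, 11, rfl⟩]

theorem exists_genC (i : Fin 12) : (eps (-1) 1 i = 1 ∧ ∃ j, genC j = (0, i)) ∨
    (eps (-1) 1 i = -1 ∧ ∃ j, genC j = (1, i)) := by
  fin_cases i
  exacts [.inl ⟨rfl, 0, rfl⟩, .inr ⟨rfl, 1, rfl⟩, .inl ⟨rfl, 2, rfl⟩, .inl ⟨rfl, 3, rfl⟩,
    .inl ⟨rfl, 4, rfl⟩, .inl ⟨rfl, 5, rfl⟩, .inl ⟨rfl, 6, rfl⟩, .inl ⟨rfl, 7, rfl⟩,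
    .inl ⟨rfl, 8, rfl⟩, .inl ⟨rfl, 9, rfl⟩, .inl ⟨rfl, 10, rfl⟩, .inl ⟨rfl, 11, rfl⟩]

theorem exists_genD (i : Fin 12) : (eps (-1) (-1) i = 1 ∧ ∃ j, genD j = (0, i)) ∨
    (eps (-1) (-1) i = -1 ∧ (∃ j, genD j = (1, i)) ∧ ∃ j, genD j = (2, i)) := by
  fin_cases i
  exacts [.inr ⟨rfl, ⟨0, rfl⟩, 1, rfl⟩, .inr ⟨rfl, ⟨2, rfl⟩, 3, rfl⟩, .inl ⟨rfl, 4, rfl⟩,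
    .inr ⟨rfl, ⟨6, rfl⟩, 8, rfl⟩, .inr ⟨rfl, ⟨7, rfl⟩, 9, rfl⟩, .inl ⟨rfl, 5, rfl⟩,
    .inl ⟨rfl, 10, rfl⟩, .inr ⟨rfl, ⟨12, rfl⟩, 14, rfl⟩, .inr ⟨rfl, ⟨13, rfl⟩, 15, rfl⟩,
    .inl ⟨rfl, 11, rfl⟩, .inl ⟨rfl, 16, rfl⟩, .inr ⟨rfl, ⟨17, rfl⟩, 18, rfl⟩]

variable {k d a b p c : ℕ} {i : Fin 12}

theorem mem_typeA (hk : degA n₁ n₂ d a b p c + dA n₁ n₂ i = k) :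
    (fun v => monA n₁ n₂ d a b p c v • GA n₁ n₂ i v) ∈
    NF ![1, 2, 2, n₁ + n₂, 2] (invA n₁ n₂) (fun j => gen n₁ n₂ (genA j))
      (fun j => genDeg n₁ n₂ (genA j)) k := by
  refine monA_smul_mem hk ![d, a, b, p, c] (l := 0) ⟨i, rfl⟩ ?_ fun v => ?_
  · simp [Fin.sum_univ_succ, cdeg, degA]
    ring
  · simp [Fin.prod_univ_succ, cfac, monA, invA]
    ring

theorem mem_typeB (hk : degA n₁ n₂ d a b p c + dA n₁ n₂ i = k) :
    (1 : ℝ) ^ d * (-1) ^ p * eps 1 (-1) i = -1 ∨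
    (fun v => monA n₁ n₂ d a b p c v • GA n₁ n₂ i v) ∈
    NF ![1, 2, 2, 2 * (n₁ + n₂), 2] (invB n₁ n₂) (fun j => gen n₁ n₂ (genB j))
      (fun j => genDeg n₁ n₂ (genB j)) k := by
  obtain ⟨q, rfl | rfl⟩ := p.even_or_odd' <;> rcases exists_genB i with ⟨he, hj⟩ | ⟨he, hj⟩
  · refine .inr (monA_smul_mem hk ![d, a, b, q, c] hj ?_ fun v => ?_)
    · simp [Fin.sum_univ_succ, cdeg, degA]
      ring
    · simp [Fin.prod_univ_succ, cfac, monA, invB, ← pow_mul]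
      ring
  · exact .inl (by simp [he])
  · exact .inl (by simp [he, pow_succ])
  · refine .inr (monA_smul_mem hk ![d, a, b, q, c] hj ?_ fun v => ?_)
    · simp [Fin.sum_univ_succ, cdeg, degA]
      ring
    · simp [Fin.prod_univ_succ, cfac, monA, invB, ← pow_mul]
      ring

theorem mem_typeC (hk : degA n₁ n₂ d a b p c + dA n₁ n₂ i = k) :
    (-1 : ℝ) ^ d * 1 ^ p * eps (-1) 1 i = -1 ∨
    (fun v => monA n₁ n₂ d a b p c v • GA n₁ n₂ i v) ∈
    NF ![2, 2, 2, n₁ + n₂, 2] (invC n₁ n₂) (fun j => gen n₁ n₂ (genC j))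
      (fun j => genDeg n₁ n₂ (genC j)) k := by
  obtain ⟨q, rfl | rfl⟩ := d.even_or_odd' <;> rcases exists_genC i with ⟨he, hj⟩ | ⟨he, hj⟩
  · refine .inr (monA_smul_mem hk ![q, a, b, p, c] hj ?_ fun v => ?_)
    · simp [Fin.sum_univ_succ, cdeg, degA]
      ring
    · simp [Fin.prod_univ_succ, cfac, monA, invC, ← pow_mul]
      ring
  · exact .inl (by simp [he])
  · exact .inl (by simp [he, pow_succ])
  · refine .inr (monA_smul_mem hk ![q, a, b, p, c] hj ?_ fun v => ?_)
    · simp [Fin.sum_univ_succ, cdeg, degA]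
      ring
    · simp [Fin.prod_univ_succ, cfac, monA, invC, ← pow_mul]
      ring

/-- Both `x₁` and `Re w` change sign, so survival depends on the parity of `d + p`. Two odd
exponents use the invariant `x₁ Re w`; exactly one odd exponent supplies the factor `x₁` or `Re w`
required by a generator of sign `-1`. -/
theorem mem_typeD (hk : degA n₁ n₂ d a b p c + dA n₁ n₂ i = k) :
    (-1 : ℝ) ^ d * (-1) ^ p * eps (-1) (-1) i = -1 ∨
    (fun v => monA n₁ n₂ d a b p c v • GA n₁ n₂ i v) ∈
    NF ![2, 2, 2, 2 * (n₁ + n₂), 1 + (n₁ + n₂), 2] (invD n₁ n₂) (fun j => gen n₁ n₂ (genD j))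
      (fun j => genDeg n₁ n₂ (genD j)) k := by
  obtain ⟨r, rfl | rfl⟩ := d.even_or_odd' <;> obtain ⟨q, rfl | rfl⟩ := p.even_or_odd' <;>
    rcases exists_genD i with ⟨he, hj⟩ | ⟨he, hj, hj'⟩
  · refine .inr (monA_smul_mem hk ![r, a, b, q, 0, c] hj ?_ fun v => ?_)
    · simp [Fin.sum_univ_succ, cdeg, degA]
      ring
    · simp [Fin.prod_univ_succ, cfac, monA, invD, ← pow_mul]
      ring
  · exact .inl (by simp [he])
  · exact .inl (by simp [he, pow_succ])
  · refine .inr (monA_smul_mem hk ![r, a, b, q, 0, c] hj' ?_ fun v => ?_)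
    · simp [Fin.sum_univ_succ, cdeg, degA]
      ring
    · simp [Fin.prod_univ_succ, cfac, monA, invD, ← pow_mul]
      ring
  · exact .inl (by simp [he, pow_succ])
  · refine .inr (monA_smul_mem hk ![r, a, b, q, 0, c] hj ?_ fun v => ?_)
    · simp [Fin.sum_univ_succ, cdeg, degA]
      ring
    · simp [Fin.prod_univ_succ, cfac, monA, invD, ← pow_mul]
      ring
  · refine .inr (monA_smul_mem hk ![r, a, b, q, 1, c] hj ?_ fun v => ?_)
    · simp [Fin.sum_univ_succ, cdeg, degA]
      ring
    · simp [Fin.prod_univ_succ, cfac, monA, invD, ← pow_mul]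
      ring
  · exact .inl (by simp [he, pow_succ])

theorem typeA_eq (f : Fin 12 → (Fin 5 → ℝ) → ℝ) : typeA n₁ n₂ ω₁ ω₂ ω₃ f =
    fun v => linCLM ω₁ ω₂ ω₃ v + ∑ i, f i (invA n₁ n₂ v) • gen n₁ n₂ (genA i) v := by
  -- With constant coefficients the identity is purely algebraic, and `simp` has no arguments of `f`
  -- to rewrite. Pointwise the general case is an instance of it.
  have h (F : Fin 12 → ℝ) (v : Phase) : typeA n₁ n₂ ω₁ ω₂ ω₃ (fun i _ => F i) v
      = linCLM ω₁ ω₂ ω₃ v + ∑ i, F i • gen n₁ n₂ (genA i) v := by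
    simp [Fin.sum_univ_succ, gen, cfac, GA, genA, typeA, linCLM_apply, slot₁_apply, slot₂_apply,
      slot₃_apply, wRes]
    refine ⟨?_, ?_, ?_, ?_, ?_⟩ <;> ring
  exact funext fun v => h (fun i => f i (invA n₁ n₂ v)) v

theorem typeB_eq (f : Fin 12 → (Fin 5 → ℝ) → ℝ) : typeB n₁ n₂ ω₁ ω₂ ω₃ f =
    fun v => linCLM ω₁ ω₂ ω₃ v + ∑ i, f i (invB n₁ n₂ v) • gen n₁ n₂ (genB i) v := by
  have h (F : Fin 12 → ℝ) (v : Phase) : typeB n₁ n₂ ω₁ ω₂ ω₃ (fun i _ => F i) v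
      = linCLM ω₁ ω₂ ω₃ v + ∑ i, F i • gen n₁ n₂ (genB i) v := by
    simp [Fin.sum_univ_succ, gen, cfac, GA, genB, typeB, linCLM_apply, slot₁_apply, slot₂_apply,
      slot₃_apply, wRes]
    refine ⟨?_, ?_, ?_, ?_, ?_⟩ <;> ring
  exact funext fun v => h (fun i => f i (invB n₁ n₂ v)) v

theorem typeC_eq (f : Fin 12 → (Fin 5 → ℝ) → ℝ) : typeC n₁ n₂ ω₁ ω₂ ω₃ f =
    fun v => linCLM ω₁ ω₂ ω₃ v + ∑ i, f i (invC n₁ n₂ v) • gen n₁ n₂ (genC i) v := by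
  have h (F : Fin 12 → ℝ) (v : Phase) : typeC n₁ n₂ ω₁ ω₂ ω₃ (fun i _ => F i) v
      = linCLM ω₁ ω₂ ω₃ v + ∑ i, F i • gen n₁ n₂ (genC i) v := by
    simp [Fin.sum_univ_succ, gen, cfac, GA, genC, typeC, linCLM_apply, slot₁_apply, slot₂_apply,
      slot₃_apply, wRes]
    refine ⟨?_, ?_, ?_, ?_, ?_⟩ <;> ring
  exact funext fun v => h (fun i => f i (invC n₁ n₂ v)) v

theorem typeD_eq (f : Fin 19 → (Fin 6 → ℝ) → ℝ) : typeD n₁ n₂ ω₁ ω₂ ω₃ f =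
    fun v => linCLM ω₁ ω₂ ω₃ v + ∑ i, f i (invD n₁ n₂ v) • gen n₁ n₂ (genD i) v := by
  have h (F : Fin 19 → ℝ) (v : Phase) : typeD n₁ n₂ ω₁ ω₂ ω₃ (fun i _ => F i) v
      = linCLM ω₁ ω₂ ω₃ v + ∑ i, F i • gen n₁ n₂ (genD i) v := by
    simp [Fin.sum_univ_succ, gen, cfac, GA, genD, typeD, linCLM_apply, slot₁_apply, slot₂_apply,
      slot₃_apply, wRes]
    refine ⟨?_, ?_, ?_, ?_, ?_⟩ <;> ring
  exact funext fun v => h (fun i => f i (invD n₁ n₂ v)) v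

end Types

end Bireversible

/-! ### The normal form theorem, by cases on the two signs. -/

theorem mainTheorem1
    (n₁ n₂ : ℕ) (hn₁ : 0 < n₁) (hn₂ : 0 < n₂) (hcop : Nat.Coprime n₁ n₂)
    (ω₁ ω₂ ω₃ : ℝ) (hω₁ : ω₁ ≠ 0) (hω₂ : ω₂ ≠ 0) (hω₃ : ω₃ ≠ 0)
    (hres : (n₁ : ℝ) * ω₂ = (n₂ : ℝ) * ω₁)
    (hind : ω₃ ∉ Submodule.span ℚ ({ω₁, ω₂} : Set ℝ))
    (a₀ a₁ a₂ a₃ : ℝ) (ha₀ : a₀ = 1 ∨ a₀ = -1) (ha₁ : a₁ = 1 ∨ a₁ = -1)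
    (ha₂ : a₂ = 1 ∨ a₂ = -1) (ha₃ : a₃ = 1 ∨ a₃ = -1)
    (X : Bireversible.Phase → Bireversible.Phase)
    (hX : ContDiff ℝ ∞ X) (hX0 : X 0 = 0)
    (hL : ∀ v, fderiv ℝ X 0 v = Bireversible.linearPart ω₁ ω₂ ω₃ v)
    (hφ : Bireversible.IsReversingSymmetry Bireversible.phi X)
    (hψ : Bireversible.IsReversingSymmetry (Bireversible.psi a₀ a₁ a₂ a₃) X) :
    (a₀ = 1 → a₁ ^ n₂ * a₂ ^ n₁ = 1 →
      ∃ f : Fin 12 → (Fin 5 → ℝ) → ℝ, (∀ i, ContDiff ℝ ∞ (f i)) ∧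
        Bireversible.FormallyConjugate X (Bireversible.typeA n₁ n₂ ω₁ ω₂ ω₃ f)) ∧
    (a₀ = 1 → a₁ ^ n₂ * a₂ ^ n₁ = -1 →
      ∃ f : Fin 12 → (Fin 5 → ℝ) → ℝ, (∀ i, ContDiff ℝ ∞ (f i)) ∧
        Bireversible.FormallyConjugate X (Bireversible.typeB n₁ n₂ ω₁ ω₂ ω₃ f)) ∧
    (a₀ = -1 → a₁ ^ n₂ * a₂ ^ n₁ = 1 →
      ∃ f : Fin 12 → (Fin 5 → ℝ) → ℝ, (∀ i, ContDiff ℝ ∞ (f i)) ∧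
        Bireversible.FormallyConjugate X (Bireversible.typeC n₁ n₂ ω₁ ω₂ ω₃ f)) ∧
    (a₀ = -1 → a₁ ^ n₂ * a₂ ^ n₁ = -1 →
      ∃ f : Fin 19 → (Fin 6 → ℝ) → ℝ, (∀ i, ContDiff ℝ ∞ (f i)) ∧
        Bireversible.FormallyConjugate X (Bireversible.typeD n₁ n₂ ω₁ ω₂ ω₃ f)) := by
  have sq {a : ℝ} (h : a = 1 ∨ a = -1) : a ^ 2 = 1 := by rcases h with rfl | rfl <;> norm_num
  have H : Bireversible.Resonant n₁ n₂ ω₁ ω₂ ω₃ := ⟨hn₁, hn₂, hcop, hω₁, hres, hind⟩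
  have h₁ := sq ha₁
  have h₂ := sq ha₂
  have h₃ := sq ha₃
  refine ⟨?_, ?_, ?_, ?_⟩ <;> rintro rfl hs
  · obtain ⟨f, hf, hc⟩ := H.exists_normalForm (sq ha₀) h₁ h₂ h₃ hs (by norm_num) hX hX0 hL hφ hψ
      (fun i => by (fin_cases i <;> simp); omega) Bireversible.isHom_invA Bireversible.genA
      fun k d a b p c i hk => .inr (Bireversible.mem_typeA hk)
    exact ⟨f, hf, Bireversible.typeA_eq f ▸ hc⟩
  · obtain ⟨f, hf, hc⟩ := H.exists_normalForm (sq ha₀) h₁ h₂ h₃ hs (by norm_num) hX hX0 hL hφ hψ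
      (fun i => by (fin_cases i <;> simp); omega) Bireversible.isHom_invB Bireversible.genB
      fun k d a b p c i hk => Bireversible.mem_typeB hk
    exact ⟨f, hf, Bireversible.typeB_eq f ▸ hc⟩
  · obtain ⟨f, hf, hc⟩ := H.exists_normalForm (sq ha₀) h₁ h₂ h₃ hs (by norm_num) hX hX0 hL hφ hψ
      (fun i => by (fin_cases i <;> simp); omega) Bireversible.isHom_invC Bireversible.genC
      fun k d a b p c i hk => Bireversible.mem_typeC hk
    exact ⟨f, hf, Bireversible.typeC_eq f ▸ hc⟩
  · obtain ⟨f, hf, hc⟩ := H.exists_normalForm (sq ha₀) h₁ h₂ h₃ hs (by norm_num) hX hX0 hL hφ hψ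
      (fun i => by (fin_cases i <;> simp); omega) Bireversible.isHom_invD Bireversible.genD
      fun k d a b p c i hk => Bireversible.mem_typeD hk
    exact ⟨f, hf, Bireversible.typeD_eq f ▸ hc⟩
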